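/- **Setting.** A directed acyclic graph on $n$ vertices is built online: we are given a starting acyclic graph with a topological order $T$ (a bijection from the vertices to $\{1,\dots,n\}$ with $T(x)<T(y)$ for every edge $x\to y$), and then distinct new edges arrive one at a time, the graph remaining acyclic. Write $u<v$ for $T(u)<T(v)$ and $d(u,v)=|T(u)-T(v)|$. Let $p\ge 0$ be an integer with $p=O(\log n)$ and let $t_0<t_1<\dots<t_{p+1}=n$ be thresholds. The algorithm maintains $T$ as follows. *Insert$(u,v)$*: if $v\le u$, call Reorder$(v,u,0,0)$; then insert the edge $u\to v$. *Reorder$(u,v,f_1,f_2)$*: if $v\le u$, exit. Let $\hat A_i=\{w: u\to w,\ d(u,w)\le t_i,\ w<v\}$ and $\hat B_i=\{w: w\to v,\ d(w,v)\le t_i,\ w>u\}$. If $t_i<d(u,v)\le t_{i+1}$ for some $0\le i\le p$, compute $\hat A_i$ and $\hat B_i$; put $A=\hat A_i$ if $\hat A_i\ne\emptyset$ or $f_1=1$, and otherwise compute $\hat A_{i+1}$ and put $A=\hat A_{i+1}$; put $B=\hat B_i$ if $\hat B_i\neq\emptyset$ or $f_2=1$, and otherwise compute $\hat B_{i+1}$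 and put $B=\hat B_{i+1}$. If $d(u,v)\le t_0$, compute and put $A=\hat A_0$, $B=\hat B_0$. If $A=B=\emptyset$, swap $u$ and $v$ in $T$. Otherwise, for each $u'\in\{u\}\cup A$ in decreasing order, and for each $v'\in B\cup\{v\}$ with $v'>u'$ in increasing order (all with respect to $T$ at the start of the call), call Reorder$(u',v',f_1',f_2')$, where $f_1'=1$ iff $u'=u$ and $A=\emptyset$, and $f_2'=1$ iff $v'=v$ and $B=\emptyset$. *Data structures*: arrays for $T$ and $T^{-1}$; for each vertex, its forward and backward adjacency lists as $n$-bit arrays; and, for each vertex $u$ and each $0\le i\le p+1$, balanced binary search trees ("pails") holding the out-neighbours, respectively the in-neighbours, of $u$ at distance at most $t_i$. The sets $\hat A_i,\hat B_i$ are read off the pails and sorted (by comparisons when $t_i<d(u,v)$, by counting sort when $d(u,v)\le t_i$). An edge insertion updates the adjacency lists and pails; a swap of $u$ and $v$ updates $T$, $T^{-1}$ and, for each $i$, only the pail entries in the $O(d(u,v))$ positions where membership may change. The running time is the number of elementary steps (array accesses, comparisons, tree nodes visited). **Statement.** Let $f(p)=\dfrac{3^{p+1}}{2\cdot 3^{p+1}-2^{p+1}}$,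 and take $t_0=n^{f(p)}$ and $t_i=t_0^{\,2-(2/3)^i}$ for $i=1,\dots,p+1$. Then the total running time of the algorithm while inserting a sequence of edges is $\tilde O(n^{2+f(p)})$. That is, there is an absolute constant $k$ such that for every $K$ there is a constant $C$ such that for all $n\ge 2$, all integers $0\le p\le K\log n$, every starting graph with a topological order and every admissible sequence of edges, the algorithm terminates, and its total running time (including the construction of the data structures for the starting graph) is at most $C\,n^{2+f(p)}(\log n)^k$. -/

import Mathlib

/-! Online topological ordering: the algorithm, written as a program over an explicit store that
counts its elementary steps. -/

namespace OnlineTopo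

/-- The store. The vertices are `0, …, n-1`.
* `pos` is the array `T` (current topological order) and `vert` its inverse array;
* `outList u`, `inList u` are the forward and backward adjacency lists, as `n`-bit arrays;
* `outPails u i`, `inPails u i` (with `i ≤ p + 1`) are the pails, size-balanced binary search trees
  keyed by vertex index; `outPails u i` is meant to hold the `w` with `u → w` and `d(u,w) ≤ t i`,
  and `inPails u i` the `w` with `w → u` and `d(w,u) ≤ t i`;
* `time` is the number of elementary steps executed so far. -/
structure Store (n : ℕ) where
  pos : Fin n → Fin n
  vert : Fin n → Fin n
  outList : Fin n → Fin n → Bool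
  inList : Fin n → Fin n → Bool
  outPails : Fin n → ℕ → Ordnode (Fin n)
  inPails : Fin n → ℕ → Ordnode (Fin n)
  time : ℕ

/-- Programs acting on the store; `none` means that the execution has been
abandoned because the bound on the recursion depth was exceeded. -/
abbrev Prog (n : ℕ) (α : Type) : Type := StateT (Store n) Option α

/-- Execute `k` elementary steps (array accesses, comparisons, visits of tree nodes). A constant
number of arithmetic operations on words between two charges is absorbed in them. -/
def tick {n : ℕ} (k : ℕ) : Prog n Unit := modify fun s => { s with time := s.time + k }

/-! ### Steps of the operations on balanced search trees -/

section Trees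

variable {α : Type}

/-- Nodes visited when walking down the leftmost branch. -/
def leftSteps : Ordnode α → ℕ
  | .nil => 1
  | .node _ l _ _ => leftSteps l + 1

/-- Nodes visited when walking down the rightmost branch. -/
def rightSteps : Ordnode α → ℕ
  | .nil => 1
  | .node _ _ _ r => rightSteps r + 1

/-- Nodes visited by `Ordnode.glue l r`, which extracts the maximum of `l` or the minimum of `r`. -/
def glueSteps (l r : Ordnode α) : ℕ :=
  if r.size < l.size then rightSteps l else leftSteps r

/-- Nodes visited by `Ordnode.insert x`. -/
def insertSteps [LE α] [DecidableLE α] (x : α) : Ordnode α → ℕ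
  | .nil => 1
  | .node _ l y r =>
    match cmpLE x y with
    | .lt => insertSteps x l + 1
    | .eq => 1
    | .gt => insertSteps x r + 1

/-- Nodes visited by `Ordnode.erase x`. -/
def eraseSteps [LE α] [DecidableLE α] (x : α) : Ordnode α → ℕ
  | .nil => 1
  | .node _ l y r =>
    match cmpLE x y with
    | .lt => eraseSteps x l + 1
    | .eq => glueSteps l r + 1
    | .gt => eraseSteps x r + 1

end Trees

variable {n : ℕ}

/-- Insertion into a balanced search tree. -/
def treeInsert (x : Fin n) (tr : Ordnode (Fin n)) : Prog n (Ordnode (Fin n)) := do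
  tick (insertSteps x tr)
  return Ordnode.insert x tr

/-- Deletion from a balanced search tree. -/
def treeErase (x : Fin n) (tr : Ordnode (Fin n)) : Prog n (Ordnode (Fin n)) := do
  tick (eraseSteps x tr)
  return Ordnode.erase x tr

/-- Report all elements of a balanced search tree, in increasing order of keys. -/
def treeCollect (tr : Ordnode (Fin n)) : Prog n (List (Fin n)) := do
  tick (tr.toList.length + 1)
  return tr.toList

/-! ### Array accesses -/

def getPos (u : Fin n) : Prog n ℕ := do
  tick 1
  return ((← get).pos u : ℕ)

def setOutPail (u : Fin n) (i : ℕ) (tr : Ordnode (Fin n)) : Prog n Unit := do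
  tick 1
  modify fun s =>
    { s with outPails := Function.update s.outPails u (Function.update (s.outPails u) i tr) }

def setInPail (u : Fin n) (i : ℕ) (tr : Ordnode (Fin n)) : Prog n Unit := do
  tick 1
  modify fun s =>
    { s with inPails := Function.update s.inPails u (Function.update (s.inPails u) i tr) }

def getOutPail (u : Fin n) (i : ℕ) : Prog n (Ordnode (Fin n)) := do
  tick 1
  return (← get).outPails u i

def getInPail (u : Fin n) (i : ℕ) : Prog n (Ordnode (Fin n)) := do
  tick 1
  return (← get).inPails u i

/-- Search `w` in the forward adjacency list of `u`. -/
def searchOut (u w : Fin n) : Prog n Bool := do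
  tick 1
  return (← get).outList u w

/-- Search `w` in the backward adjacency list of `u`. -/
def searchIn (u w : Fin n) : Prog n Bool := do
  tick 1
  return (← get).inList u w

/-- Record the pair `u → w` in the pails of index `i`. -/
def pailsInsert (u w : Fin n) (i : ℕ) : Prog n Unit := do
  setOutPail u i (← treeInsert w (← getOutPail u i))
  setInPail w i (← treeInsert u (← getInPail w i))

/-- Remove the pair `u → w` from the pails of index `i`. -/
def pailsErase (u w : Fin n) (i : ℕ) : Prog n Unit := do
  setOutPail u i (← treeErase w (← getOutPail u i))
  setInPail w i (← treeErase u (← getInPail w i))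

/-- The vertices `w` with `lo ≤ T(w) < hi`, read off the array `T⁻¹`. -/
def window (lo hi : ℕ) : Prog n (List (Fin n)) := do
  let s ← get
  tick (min hi n - lo + 1)
  return (List.range' lo (min hi n - lo)).filterMap
    fun x => if h : x < n then some (s.vert ⟨x, h⟩) else none

/-! ### The algorithm

`p` is the number of levels and `t 0, …, t (p + 1)` are the thresholds. As every distance
`d(u,v) = |T(v) - T(u)|` is an integer, real thresholds enter only through their integer parts. -/

/-- Insert the edge `u → v` into the graph: update the adjacency lists and the pails. -/
def insertEdge (p : ℕ) (t : ℕ → ℕ) (u v : Fin n) : Prog n Unit := do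
  tick 2
  modify fun s =>
    { s with
      outList := Function.update s.outList u (Function.update (s.outList u) v true)
      inList := Function.update s.inList v (Function.update (s.inList v) u true) }
  let x ← getPos u
  let y ← getPos v
  (List.range (p + 2)).forM fun i => do
    tick 1
    if Nat.dist x y ≤ t i then pailsInsert u v i

/-- Swap `u` and `v` in the order, where `T(u) < T(v)`, and update the pails. -/
def swap (p : ℕ) (t : ℕ → ℕ) (u v : Fin n) : Prog n Unit := do
  let x ← getPos u
  let y ← getPos v
  let d := y - x
  (List.range (p + 2)).forM fun i => do
    tick 1
    (← window (x - t i) (min x (x + d - t i))).forM fun w => pailsErase w u i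
    (← window (max (y + t i - d) y + 1) (y + t i + 1)).forM fun w => pailsErase v w i
    (← window (max y (x + t i) + 1) (x + t i + d + 1)).forM fun w => do
      if ← searchOut u w then pailsInsert u w i
    (← window (y - t i - d) (min x (y + d - t i))).forM fun w => do
      if ← searchIn v w then pailsInsert w v i
  tick 4
  modify fun s =>
    { s with
      pos := Function.update (Function.update s.pos u (s.pos v)) v (s.pos u)
      vert := Function.update (Function.update s.vert (s.pos u) v) (s.pos v) u }

/-- Sort vertices by the topological order, by comparisons: insert their positions into a balanced
search tree and read it off. -/
def comparisonSort (ws : List (Fin n)) : Prog n (List (Fin n)) := do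
  let s ← get
  let tr ← ws.foldlM (fun tr w => do tick 1; treeInsert (s.pos w) tr) Ordnode.nil
  let xs ← treeCollect tr
  tick xs.length
  return xs.map s.vert

/-- Sort vertices whose positions lie between `c` and `c + m` by the topological order, by counting
sort with an array of `m + 1` buckets. -/
def countingSort (c m : ℕ) (ws : List (Fin n)) : Prog n (List (Fin n)) := do
  tick (m + 1)
  let buckets ← ws.foldlM
    (fun b w => do
      let x ← getPos w
      tick 1
      return Function.update b (x - c) (some w))
    (fun _ => none)
  tick (m + 1)
  return (List.range (m + 1)).filterMap buckets

/-- `{w : u → w, d(u,w) ≤ t i, w < v}`, sorted by the topological order. The flag `cmp` selects the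
sorting method: by comparisons if it is set, by counting otherwise. -/
def hatA (t : ℕ → ℕ) (cmp : Bool) (u v : Fin n) (i : ℕ) : Prog n (List (Fin n)) := do
  let x ← getPos u
  let y ← getPos v
  let ws ← treeCollect (← getOutPail u i)
  let sorted ← if cmp then comparisonSort ws else countingSort x (t i) ws
  let s ← get
  tick (sorted.length + 1)
  return sorted.filter fun w => (s.pos w : ℕ) < y

/-- `{w : w → v, d(w,v) ≤ t i, w > u}`, sorted by the topological order. -/
def hatB (t : ℕ → ℕ) (cmp : Bool) (u v : Fin n) (i : ℕ) : Prog n (List (Fin n)) := do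
  let x ← getPos u
  let y ← getPos v
  let ws ← treeCollect (← getInPail v i)
  let sorted ← if cmp then comparisonSort ws else countingSort (y - t i) (t i) ws
  let s ← get
  tick (sorted.length + 1)
  return sorted.filter fun w => x < (s.pos w : ℕ)

/-- The index `i ≤ p` with `t i < d ≤ t (i + 1)`, if there is one. -/
def findLevel (p : ℕ) (t : ℕ → ℕ) (d : ℕ) : Prog n (Option ℕ) := do
  tick (p + 1)
  return (List.range (p + 1)).find? fun i => t i < d ∧ d ≤ t (i + 1)

/-- The pairs `(u', v')` of the two nested loops, in the order in which they are treated, for lists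
`A` and `B` sorted by the topological order: `u'` runs through `{u} ∪ A` in decreasing order and, for
each `u'`, `v'` runs through the elements of `B ∪ {v}` above `u'` in increasing order (these are found
by scanning `B ∪ {v}` downwards until an element below `u'` is met). The order is the one at the time
when the loops are entered. -/
def loopPairs (pos : Fin n → Fin n) (u v : Fin n) (A B : List (Fin n)) :
    List (Fin n × Fin n) :=
  (u :: A).reverse.flatMap fun u' =>
    ((B ++ [v]).reverse.takeWhile fun v' => pos u' < pos v').reverse.map fun v' => (u', v')

/-- The recursive procedure that makes `v` precede `u` in the order. The first argument bounds the depth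
of the recursion: an execution that exceeds it is abandoned with the value `none`. It does not influence
an execution that is not abandoned, so the procedure halts when the value is not `none` for some bound. -/
def reorder (p : ℕ) (t : ℕ → ℕ) : ℕ → Fin n → Fin n → Bool → Bool → Prog n Unit
  | 0, _, _, _, _ => failure
  | depth + 1, u, v, f₁, f₂ => do
    let x ← getPos u
    let y ← getPos v
    tick 1
    if y ≤ x then return ()
    else
      let (A, B) ← match ← findLevel p t (y - x) with
        | some i => do
          let A₀ ← hatA t true u v i
          let B₀ ← hatB t true u v i
          let A ← if A₀ ≠ [] ∨ f₁ = true then pure A₀ else hatA t false u v (i + 1)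
          let B ← if B₀ ≠ [] ∨ f₂ = true then pure B₀ else hatB t false u v (i + 1)
          pure (A, B)
        | none => do
          let A ← hatA t false u v 0
          let B ← hatB t false u v 0
          pure (A, B)
      if A = [] ∧ B = [] then swap p t u v
      else
        let pairs := loopPairs (← get).pos u v A B
        tick (pairs.length + A.length + B.length + 1)
        pairs.forM fun q =>
          reorder p t depth q.1 q.2 (decide (q.1 = u ∧ A = [])) (decide (q.2 = v ∧ B = []))

/-- The procedure called for each new edge `u → v`. -/
def insert (p : ℕ) (t : ℕ → ℕ) (depth : ℕ) (u v : Fin n) : Prog n Unit := do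
  let x ← getPos u
  let y ← getPos v
  tick 1
  if y ≤ x then reorder p t depth v u false false
  insertEdge p t u v

/-- The store for the graph without edges and the order `T₀`. The time is that of allocating the
arrays: `T` and `T⁻¹`, the two adjacency lists and the two arrays of pails of every vertex. -/
def initStore (p : ℕ) (T₀ : Equiv.Perm (Fin n)) : Store n where
  pos := T₀
  vert := T₀.symm
  outList := fun _ _ => false
  inList := fun _ _ => false
  outPails := fun _ _ => .nil
  inPails := fun _ _ => .nil
  time := 2 * n + 2 * n * n + 2 * n * (p + 2)

/-- The whole run. The data structures are built for the starting graph, which has the edges `E₀` and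
the topological order `T₀`; then the edges of `es` are inserted online, one after the other. The result
is the final store, whose field `time` is the total running time (construction included), or `none`
if the recursion depth has exceeded `depth`. -/
def run (p : ℕ) (t : ℕ → ℕ) (depth : ℕ) (T₀ : Equiv.Perm (Fin n))
    (E₀ es : List (Fin n × Fin n)) : Option (Store n) :=
  (do
    E₀.forM fun e => insertEdge p t e.1 e.2
    es.forM fun e => insert p t depth e.1 e.2
    get : Prog n (Store n)).run' (initStore p T₀)

/-- The exponent `f(p) = 3^(p+1) / (2·3^(p+1) - 2^(p+1))`. -/
noncomputable def expo (p : ℕ) : ℝ := 3 ^ (p + 1) / (2 * 3 ^ (p + 1) - 2 ^ (p + 1))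

end OnlineTopo

/-!
Write `θ = t 0`. A call for `u` and `v` swaps descendants of `u` with ancestors of `v`. If its
search for out-neighbours of `u` has to go on from level `i` to level `i + 1`, then no out-neighbour
of `u` is within distance `t i`, so that by the end of the call `u` has moved up by more than `t i`.
The cost of the search is about `t (i + 1) ≤ θ * √(t i)`, hence at most `θ` times the sum of the
`√d` over the swaps of `u`, where `d` is the distance of the swapped vertices. The calls for `u`
made in the loops then know all out-neighbours of `u` below `v`, and this limits the number of times
a swap is charged to two on either side. All other work is, up to factors `log n` and `p`, at most
`θ` for every call and every pair of the loops, each of which makes a swap, and `d ≤ θ * √d` for a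
swap itself, as `f(p) ≥ 1 / 2`. So a call that makes `N` swaps with `∑ √d = S` costs about
`θ * (N + S)`.

To bound `N + 2 * S` for the whole run, fix a topological order `F` of the final graph. The two
vertices of a swap are related by a path once the edge is inserted, hence are never swapped again;
since `F x > F y` for the vertex `x` that moves up, the scalar product `∑ w, F w * g w` with the
current order `g` grows by `(F x - F y) * d`. By the inequality of the means
`2 * √d ≤ n / (F x - F y) + (F x - F y) * d / n`. The scalar product never exceeds `n ^ 3`, and the
harmonic series bounds the sum of `1 + n / (F x - F y)` over all pairs by `n ^ 2 * (2 + log n)`.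

The exponents `2 - (2 / 3) ^ i` satisfy `t (i + 1) ≤ θ * √(t i)`, and `f(p)` is chosen so that the
last threshold is `n`.
-/

namespace OnlineTopo

open Relation (ReflTransGen TransGen)

/-! ### Balanced search trees -/

section Trees

open Ordnode

variable {α : Type}

/-- The number of levels of a search tree, which bounds the length of every root-to-leaf walk. -/
def height : Ordnode α → ℕ
  | .nil => 0
  | .node _ l _ r => max (height l) (height r) + 1

lemma leftSteps_le_height (t : Ordnode α) : leftSteps t ≤ height t + 1 := by
  induction t with
  | nil => simp [leftSteps, height]
  | node _ l _ r ihl _ => simp only [leftSteps, height]; omega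

lemma rightSteps_le_height (t : Ordnode α) : rightSteps t ≤ height t + 1 := by
  induction t with
  | nil => simp [rightSteps, height]
  | node _ l _ r _ ihr => simp only [rightSteps, height]; omega

lemma glueSteps_le_height (l r : Ordnode α) : glueSteps l r ≤ max (height l) (height r) + 1 := by
  have := leftSteps_le_height r
  have := rightSteps_le_height l
  unfold glueSteps
  split_ifs <;> omega

lemma insertSteps_le_height [LE α] [DecidableLE α] (x : α) (t : Ordnode α) :
    insertSteps x t ≤ height t + 1 := by
  induction t with
  | nil => simp [insertSteps, height]
  | node _ l y r ihl ihr =>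
    simp only [insertSteps, height]
    cases cmpLE x y <;> dsimp only <;> omega

lemma eraseSteps_le_height [LE α] [DecidableLE α] (x : α) (t : Ordnode α) :
    eraseSteps x t ≤ height t + 1 := by
  induction t with
  | nil => simp [eraseSteps, height]
  | node _ l y r ihl ihr =>
    have := glueSteps_le_height l r
    simp only [eraseSteps, height]
    cases cmpLE x y <;> dsimp only <;> omega

/-- Each subtree of a size-balanced tree carries at most `3/4` of the leaves. -/
lemma four_pow_height_le {t : Ordnode α} (hsized : t.Sized) (hbal : t.Balanced) :
    4 ^ height t ≤ 3 ^ height t * (t.size + 1) := by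
  induction t with
  | nil => simp [height]
  | node s l x r ihl ihr =>
    obtain ⟨hsize, hsl, hsr⟩ := hsized
    obtain ⟨hlr, hbl, hbr⟩ := hbal
    have node_of_child : ∀ c : Ordnode α, 4 ^ height c ≤ 3 ^ height c * (c.size + 1) →
        4 * (c.size + 1) ≤ 3 * (s + 1) → 4 ^ (height c + 1) ≤ 3 ^ (height c + 1) * (s + 1) := by
      intro c ihc hc
      calc 4 ^ (height c + 1) = 4 * 4 ^ height c := pow_succ' ..
        _ ≤ 4 * (3 ^ height c * (c.size + 1)) := by gcongr
        _ = 3 ^ height c * (4 * (c.size + 1)) := by ring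
        _ ≤ 3 ^ height c * (3 * (s + 1)) := by gcongr
        _ = 3 ^ (height c + 1) * (s + 1) := by ring
    unfold BalancedSz delta at hlr
    simp only [size]
    rcases max_choice (height l) (height r) with h | h
    · simp only [height, h]
      exact node_of_child l (ihl hsl hbl) (by omega)
    · simp only [height, h]
      exact node_of_child r (ihr hsr hbr) (by omega)

/-- A bound for the number of nodes visited by an operation on a balanced search tree with at most
`n` nodes; the factor `4` comes from `1 / 4 ≤ log (4 / 3)`. -/
noncomputable def logBound (n : ℕ) : ℕ := ⌊4 * Real.log (n + 1)⌋₊ + 1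

lemma one_le_logBound (n : ℕ) : 1 ≤ logBound n := Nat.le_add_left _ _

lemma logBound_mono : Monotone logBound := fun m n hmn => by
  unfold logBound
  gcongr

lemma height_lt_logBound_size {t : Ordnode α} (hsized : t.Sized) (hbal : t.Balanced) :
    height t < logBound t.size := by
  have hpow : (4 / 3 : ℝ) ^ height t ≤ t.size + 1 := by
    rw [div_pow, div_le_iff₀' (by positivity)]
    exact_mod_cast four_pow_height_le hsized hbal
  have hlog : (height t : ℝ) * Real.log (4 / 3) ≤ Real.log (t.size + 1) := by
    rw [← Real.log_pow]
    exact Real.log_le_log (by positivity) hpow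
  have hquarter : (1 / 4 : ℝ) ≤ Real.log (4 / 3) := by
    convert Real.one_sub_inv_le_log_of_pos (show (0 : ℝ) < 4 / 3 by norm_num) using 1
    norm_num
  refine Nat.lt_succ_of_le (Nat.le_floor ?_)
  nlinarith [(height t).cast_nonneg (α := ℝ)]

lemma all_ne_imp_iff {P : α → Prop} {x : α} {t : Ordnode α} (h : All (· ≠ x) t) :
    All (fun y => y ≠ x → P y) t ↔ All P t := by
  simp only [all_iff_forall] at h ⊢
  exact forall₂_congr fun y hy => imp_iff_right (h y hy)

lemma mem_toList_iff_forall_all {x : α} {t : Ordnode α} :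
    x ∈ t.toList ↔ ∀ P : α → Prop, All P t → P x := by
  rw [← emem_iff_mem_toList, emem_iff_all]

variable [LinearOrder α]

lemma pairwise_lt_toList {t : Ordnode α} {o₁ o₂} (h : Bounded t o₁ o₂) :
    t.toList.Pairwise (· < ·) := by
  induction t generalizing o₁ o₂ with
  | nil => simp
  | node s l y r ihl ihr =>
    have hl := h.1.mem_lt
    have hr := h.2.mem_gt
    simp only [all_iff_forall, emem_iff_mem_toList] at hl hr
    rw [toList_node, List.pairwise_append, List.pairwise_cons]
    refine ⟨ihl h.1, ⟨hr, ihr h.2⟩, fun a ha b hb => ?_⟩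
    rcases List.mem_cons.1 hb with rfl | hb
    · exact hl a ha
    · exact (hl a ha).trans (hr b hb)

lemma size_le_card [Fintype α] {t : Ordnode α} (h : t.Valid) : t.size ≤ Fintype.card α := by
  rw [← Ordnode.length_toList h.2]
  have hnodup : t.toList.Nodup := (pairwise_lt_toList h.1).imp ne_of_lt
  exact hnodup.length_le_card

lemma height_lt_logBound_card [Fintype α] {t : Ordnode α} (h : t.Valid) :
    height t < logBound (Fintype.card α) :=
  (height_lt_logBound_size h.2 h.3).trans_le (logBound_mono (size_le_card h))

lemma all_insert {P : α → Prop} (x : α) {t : Ordnode α} {o₁ o₂} (ht : Valid' o₁ t o₂)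
    (h₁ : Bounded nil o₁ x) (h₂ : Bounded nil x o₂) :
    All P (Ordnode.insert x t) ↔ P x ∧ All P t := by
  induction t generalizing o₁ o₂ with
  | nil => simp only [Ordnode.insert, All, and_true]; exact all_singleton
  | node s l y r ihl ihr =>
    unfold Ordnode.insert
    rw [cmpLE]
    split_ifs with hxy hyx <;> dsimp only
    · obtain rfl := le_antisymm hxy hyx
      simp only [All]; tauto
    · have hx : Bounded nil (x : WithBot α) (y : WithTop α) := lt_of_not_ge hyx
      have hv := insertWith.valid_aux (fun _ => x) x (fun _ _ => ⟨le_rfl, le_rfl⟩) ht.left h₁ hx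
      rw [← insert_eq_insertWith] at hv
      rw [all_balanceL hv.1.3 ht.3.2.2 hv.1.2 ht.2.2.2 (Or.inl ⟨_, hv.2, ht.3.1⟩),
        ihl ht.left h₁ hx]
      simp only [All]; tauto
    · have hx : Bounded nil (y : WithBot α) (x : WithTop α) := lt_of_not_ge hxy
      have hv := insertWith.valid_aux (fun _ => x) x (fun _ _ => ⟨le_rfl, le_rfl⟩) ht.right hx h₂
      rw [← insert_eq_insertWith] at hv
      rw [all_balanceR ht.3.2.1 hv.1.3 ht.2.2.1 hv.1.2 (Or.inr ⟨_, hv.2, ht.3.1⟩),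
        ihr ht.right hx h₂]
      simp only [All]; tauto

lemma all_eraseMax {P : α → Prop} {s l r} {x : α} {o₁ o₂} (h : Valid' o₁ (.node s l x r) o₂) :
    All P (eraseMax (.node s l x r)) ∧ P (findMax' x r) ↔ All P l ∧ P x ∧ All P r := by
  induction r generalizing s l x o₁ with
  | nil => simp [eraseMax, findMax', All]
  | node rs rl rx rr _ ih =>
    have hv := Valid'.eraseMax_aux h.right
    rw [← h.right.2.eq_node'] at hv
    rw [eraseMax, findMax', all_balanceL h.left.3 hv.1.3 h.left.2 hv.1.2
      (Or.inr ⟨_, Or.inr hv.2, h.3.1⟩), and_assoc, and_assoc, ih h.right]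
    rfl

lemma all_eraseMin {P : α → Prop} {s l r} {x : α} {o₁ o₂} (h : Valid' o₁ (.node s l x r) o₂) :
    P (findMin' l x) ∧ All P (eraseMin (.node s l x r)) ↔ All P l ∧ P x ∧ All P r := by
  induction l generalizing s r x o₂ with
  | nil => simp [eraseMin, findMin', All]
  | node ls ll lx lr ih _ =>
    have hv := Valid'.eraseMin_aux h.left
    rw [← h.left.2.eq_node'] at hv
    rw [eraseMin, findMin', all_balanceR hv.1.3 h.right.3 hv.1.2 h.right.2
      (Or.inl ⟨_, Or.inr hv.2, h.3.1⟩), ← and_assoc, ih h.left]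
    rfl

lemma all_glue {P : α → Prop} {l r} {x : α} {o₁ o₂} (hl : Valid' o₁ l x) (hr : Valid' x r o₂)
    (hlr : BalancedSz (size l) (size r)) : All P (glue l r) ↔ All P l ∧ All P r := by
  obtain - | ⟨ls, ll, lx, lr⟩ := l
  · simp [glue, All]
  obtain - | ⟨rs, rl, rx, rr⟩ := r
  · simp [glue, All]
  dsimp only [glue]
  split_ifs
  · have hv := Valid'.eraseMax_aux hl
    rw [← hl.2.eq_node'] at hv
    rw [splitMax_eq ls]
    dsimp only
    rw [all_balanceR hv.1.3 hr.3 hv.1.2 hr.2 (Or.inl ⟨_, Or.inr hv.2, hlr⟩), ← and_assoc,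
      all_eraseMax hl]
    rfl
  · have hv := Valid'.eraseMin_aux hr
    rw [← hr.2.eq_node'] at hv
    rw [splitMin_eq rs]
    dsimp only
    rw [all_balanceL hl.3 hv.1.3 hl.2 hv.1.2 (Or.inr ⟨_, Or.inr hv.2, hlr⟩), all_eraseMin hr]
    rfl

lemma all_erase {P : α → Prop} (x : α) {t : Ordnode α} {o₁ o₂} (ht : Valid' o₁ t o₂) :
    All P (erase x t) ↔ All (fun y => y ≠ x → P y) t := by
  induction t generalizing o₁ o₂ with
  | nil => simp [erase, All]
  | node s l y r ihl ihr =>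
    have hl (hyx : y ≤ x) : All (fun z => z ≠ x → P z) l ↔ All P l :=
      all_ne_imp_iff (All.imp (fun _ hz => (lt_of_lt_of_le hz hyx).ne) ht.1.1.mem_lt)
    have hr (hxy : x ≤ y) : All (fun z => z ≠ x → P z) r ↔ All P r :=
      all_ne_imp_iff (All.imp (fun _ hz => (lt_of_le_of_lt hxy hz).ne') ht.1.2.mem_gt)
    unfold erase
    rw [cmpLE]
    split_ifs with hxy hyx <;> dsimp only
    · obtain rfl := le_antisymm hxy hyx
      rw [all_glue ht.left ht.right ht.3.1]
      simp only [All, hl le_rfl, hr le_rfl]; tauto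
    · have hv := Valid'.erase_aux x ht.left
      have hne : y ≠ x := fun h => hyx h.le
      rw [all_balanceR hv.1.3 ht.right.3 hv.1.2 ht.right.2 (Or.inl ⟨_, hv.2, ht.3.1⟩), ihl ht.left]
      simp only [All, hr hxy]; tauto
    · have hv := Valid'.erase_aux x ht.right
      have hne : y ≠ x := fun h => hxy h.ge
      rw [all_balanceL ht.left.3 hv.1.3 ht.left.2 hv.1.2 (Or.inr ⟨_, hv.2, ht.3.1⟩), ihr ht.right]
      simp only [All, hl (le_of_not_ge hxy)]; tauto

lemma mem_toList_insert {x y : α} {t : Ordnode α} (h : Valid t) :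
    y ∈ (Ordnode.insert x t).toList ↔ y = x ∨ y ∈ t.toList := by
  simp only [mem_toList_iff_forall_all, all_insert x h ⟨⟩ ⟨⟩]
  constructor
  · intro hy
    by_contra! ⟨hyx, P, hP, hPy⟩
    exact (hy (fun z => P z ∨ z = x) ⟨Or.inr rfl, hP.imp fun _ => Or.inl⟩).elim hPy hyx
  · rintro (rfl | hy) P ⟨hPx, hPt⟩
    exacts [hPx, hy P hPt]

lemma mem_toList_erase {x y : α} {t : Ordnode α} (h : Valid t) :
    y ∈ (Ordnode.erase x t).toList ↔ y ∈ t.toList ∧ y ≠ x := by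
  simp only [mem_toList_iff_forall_all, all_erase x h]
  constructor
  · intro hy
    exact ⟨fun P hP => hy P (All.imp (fun z (hPz : P z) (_ : z ≠ x) => hPz) hP),
      hy (· ≠ x) (all_iff_forall.2 fun _ _ => id)⟩
  · rintro ⟨hy, hyx⟩ P hP
    exact hy _ hP hyx

end Trees

/-! ### Programs -/

/-- The total-correctness judgement for programs: `m`, started in `s`, is not abandoned, and its
result and final store satisfy `Q`. -/
def Ends {n : ℕ} {α : Type} (m : Prog n α) (s : Store n) (Q : α → Store n → Prop) : Prop :=
  ∃ a s', m s = some (a, s') ∧ Q a s'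

section Programs

variable {n : ℕ} {α β : Type} {s : Store n}

lemma Ends.mono {m : Prog n α} {Q Q' : α → Store n → Prop} (h : Ends m s Q)
    (hQ : ∀ a s', Q a s' → Q' a s') : Ends m s Q' := by
  obtain ⟨a, s', hrun, hs'⟩ := h
  exact ⟨a, s', hrun, hQ _ _ hs'⟩

lemma ends_bind {m : Prog n α} {f : α → Prog n β} {Q : β → Store n → Prop} :
    Ends (m >>= f) s Q ↔ Ends m s fun a s' => Ends (f a) s' Q := by
  have bind_eq : (m >>= f) s = (m s).bind fun x => f x.1 x.2 := rfl
  simp only [Ends, bind_eq, Option.bind_eq_some_iff, Prod.exists]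
  tauto

lemma ends_pure {a : α} {Q : α → Store n → Prop} : Ends (pure a : Prog n α) s Q ↔ Q a s :=
  ⟨fun ⟨_, _, h, hQ⟩ => by cases h; exact hQ, fun hQ => ⟨a, s, rfl, hQ⟩⟩

lemma ends_get {Q : Store n → Store n → Prop} : Ends (get : Prog n (Store n)) s Q ↔ Q s s :=
  ⟨fun ⟨_, _, h, hQ⟩ => by cases h; exact hQ, fun hQ => ⟨s, s, rfl, hQ⟩⟩

lemma ends_modify {f : Store n → Store n} {Q : Unit → Store n → Prop} :
    Ends (modify f : Prog n Unit) s Q ↔ Q () (f s) :=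
  ⟨fun ⟨_, _, h, hQ⟩ => by cases h; exact hQ, fun hQ => ⟨(), f s, rfl, hQ⟩⟩

lemma ends_tick {k : ℕ} {Q : Unit → Store n → Prop} :
    Ends (tick k : Prog n Unit) s Q ↔ Q () { s with time := s.time + k } :=
  ends_modify

lemma ends_getPos {u : Fin n} {Q : ℕ → Store n → Prop} :
    Ends (getPos u) s Q ↔ Q (s.pos u) { s with time := s.time + 1 } := by
  simp only [getPos, ends_bind, ends_tick, ends_get, ends_pure]

lemma Ends.foldlM {f : β → α → Prog n β} (I : List α → List α → β → Store n → Prop)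
    (step : ∀ done x rest b s, I done (x :: rest) b s → Ends (f b x) s (I (done ++ [x]) rest))
    {ws : List α} {b : β} (init : I [] ws b s) : Ends (ws.foldlM f b) s (I ws []) := by
  suffices ∀ done rest b s, I done rest b s →
      Ends (rest.foldlM f b) s (I (done ++ rest) []) from this [] ws b s init
  intro done rest
  induction rest generalizing done with
  | nil => exact fun b s h => ends_pure.2 (by simpa using h)
  | cons x rest ih =>
    intro b s h
    rw [List.foldlM_cons, ends_bind]
    refine (step done x rest b s h).mono fun b' s' h' => ?_
    simpa using ih (done ++ [x]) b' s' h'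

lemma Ends.forM {f : α → Prog n Unit} (I : List α → List α → Store n → Prop)
    (step : ∀ done x rest s, I done (x :: rest) s →
      Ends (f x) s fun _ => I (done ++ [x]) rest)
    {ws : List α} (init : I [] ws s) : Ends (ws.forM f) s fun _ => I ws [] := by
  have forM_eq : ∀ ws : List α, ws.forM f = ws.foldlM (fun _ x => f x) () := fun ws => by
    induction ws with
    | nil => rfl
    | cons x ws ih => exact congrArg (f x >>= fun _ => ·) ih
  rw [forM_eq]
  exact Ends.foldlM (fun done rest _ => I done rest) (fun done x rest _ => step done x rest) init

lemma Ends.forM_range {f : ℕ → Prog n Unit} {m : ℕ} (I : ℕ → Store n → Prop)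
    (step : ∀ k < m, ∀ s, I k s → Ends (f k) s fun _ => I (k + 1)) (init : I 0 s) :
    Ends ((List.range m).forM f) s fun _ => I m := by
  refine (Ends.forM (fun done rest s => done ++ rest = List.range m ∧ I done.length s)
    ?_ ⟨rfl, init⟩).mono fun _ s' hs' => List.length_range (n := m) ▸ hs'.2
  rintro done k rest s ⟨hsplit, hI⟩
  have hlt : done.length < m := by
    have := congrArg List.length hsplit
    simp only [List.length_append, List.length_cons, List.length_range] at this
    omega
  obtain rfl : k = done.length := by simpa [hlt] using congrArg (·[done.length]?) hsplit
  exact (step _ hlt s hI).mono fun _ s' hs' => ⟨by simpa using hsplit, by simpa using hs'⟩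

end Programs

/-! ### Pails -/

/-- The search tree `tr` is balanced and holds exactly the elements of `S`. -/
structure IsPail {α : Type} [LinearOrder α] (tr : Ordnode α) (S : α → Prop) : Prop where
  valid : tr.Valid
  mem_iff : ∀ b, b ∈ tr.toList ↔ S b

namespace IsPail

variable {α : Type} [LinearOrder α] {tr : Ordnode α} {S S' : α → Prop}

lemma congr (h : IsPail tr S) (hS : ∀ b, S b ↔ S' b) : IsPail tr S' :=
  ⟨h.valid, fun b => (h.mem_iff b).trans (hS b)⟩

lemma nil (hS : ∀ b, ¬ S b) : IsPail Ordnode.nil S :=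
  ⟨Ordnode.valid_nil, fun b => by simpa using hS b⟩

lemma insert (h : IsPail tr S) (x : α) : IsPail (Ordnode.insert x tr) fun b => b = x ∨ S b :=
  ⟨Ordnode.insert.valid x h.valid, fun b => by rw [mem_toList_insert h.valid, h.mem_iff]⟩

lemma erase (h : IsPail tr S) (x : α) : IsPail (Ordnode.erase x tr) fun b => S b ∧ b ≠ x :=
  ⟨Ordnode.erase.valid x h.valid, fun b => by rw [mem_toList_erase h.valid, h.mem_iff]⟩

lemma insertSteps_le [Fintype α] (h : IsPail tr S) (x : α) :
    insertSteps x tr ≤ logBound (Fintype.card α) :=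
  (insertSteps_le_height x tr).trans (height_lt_logBound_card h.valid)

lemma eraseSteps_le [Fintype α] (h : IsPail tr S) (x : α) :
    eraseSteps x tr ≤ logBound (Fintype.card α) :=
  (eraseSteps_le_height x tr).trans (height_lt_logBound_card h.valid)

end IsPail

/-- The pails of index at most `p + 1` represent the relation `R`: the pair `a → b` is recorded at
index `i` if and only if `R i a b`. -/
def PailsRep {n : ℕ} (p : ℕ) (R : ℕ → Fin n → Fin n → Prop) (s : Store n) : Prop :=
  ∀ i < p + 2, ∀ a, IsPail (s.outPails a i) (R i a) ∧ IsPail (s.inPails a i) fun b => R i b a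

/-- The invariant of the loops that update pails: the arrays of `s` are those of `s₀`, its pails
represent `R`, and its clock shows at most `T`. -/
structure PailState {n : ℕ} (p : ℕ) (s₀ : Store n) (R : ℕ → Fin n → Fin n → Prop) (T : ℕ)
    (s : Store n) : Prop where
  pos : s.pos = s₀.pos
  vert : s.vert = s₀.vert
  outList : s.outList = s₀.outList
  inList : s.inList = s₀.inList
  time : s.time ≤ T
  pails : PailsRep p R s

section Pails

variable {n p : ℕ} {s₀ s : Store n} {R R' : ℕ → Fin n → Fin n → Prop} {T T' : ℕ}

lemma PailsRep.congr (h : PailsRep p R s) (hR : ∀ i < p + 2, ∀ a b, R i a b ↔ R' i a b) :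
    PailsRep p R' s := fun i hi a =>
  ⟨(h i hi a).1.congr (hR i hi a), (h i hi a).2.congr fun b => hR i hi b a⟩

lemma isPail_update {f : Fin n → ℕ → Ordnode (Fin n)} {S : Fin n → Prop} {tr : Ordnode (Fin n)}
    {u a : Fin n} {i j : ℕ} (hself : a = u → j = i → IsPail tr S)
    (hother : ¬ (a = u ∧ j = i) → IsPail (f a j) S) :
    IsPail (Function.update f u (Function.update (f u) i tr) a j) S := by
  by_cases ha : a = u
  · subst ha
    by_cases hj : j = i
    · subst hj; simpa using hself rfl rfl
    · simpa [hj] using hother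
  · simpa [ha] using hother

lemma PailsRep.update (h : PailsRep p R s) {u w : Fin n} {i : ℕ} {trOut trIn : Ordnode (Fin n)}
    (hout : IsPail trOut (R' i u)) (hin : IsPail trIn fun b => R' i b w)
    (hR : ∀ j a b, ¬ (j = i ∧ a = u ∧ b = w) → (R j a b ↔ R' j a b)) {k : ℕ} :
    PailsRep p R' { s with
      outPails := Function.update s.outPails u (Function.update (s.outPails u) i trOut)
      inPails := Function.update s.inPails w (Function.update (s.inPails w) i trIn)
      time := k } := fun j hj a =>
  ⟨isPail_update (fun ha hji => by subst ha hji; exact hout)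
      fun hne => (h j hj a).1.congr fun b => hR j a b (by tauto),
    isPail_update (fun ha hji => by subst ha hji; exact hin)
      fun hne => (h j hj a).2.congr fun b => hR j b a (by tauto)⟩

lemma PailState.congr (h : PailState p s₀ R T s) (hR : ∀ i < p + 2, ∀ a b, R i a b ↔ R' i a b)
    (hT : T ≤ T') : PailState p s₀ R' T' s :=
  { h with time := h.time.trans hT, pails := h.pails.congr hR }

lemma PailState.addTime (h : PailState p s₀ R T s) (k : ℕ) :
    PailState p s₀ R (T + k) { s with time := s.time + k } :=
  { h with time := Nat.add_le_add_right h.time k }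

lemma PailState.ends_pailsErase (h : PailState p s₀ R T s) (u w : Fin n) {i : ℕ}
    (hi : i < p + 2) :
    Ends (pailsErase u w i) s fun _ => PailState p s₀
      (fun j a b => R j a b ∧ ¬ (j = i ∧ a = u ∧ b = w)) (T + (2 * logBound n + 4)) := by
  simp only [pailsErase, getOutPail, getInPail, setOutPail, setInPail, treeErase, ends_bind,
    ends_tick, ends_get, ends_pure, ends_modify]
  have hu := (h.pails i hi u).1
  have hw := (h.pails i hi w).2
  have stepsOut := hu.eraseSteps_le w
  have stepsIn := hw.eraseSteps_le u
  have := h.time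
  rw [Fintype.card_fin] at stepsOut stepsIn
  exact ⟨h.pos, h.vert, h.outList, h.inList, by dsimp only; omega,
    h.pails.update ((hu.erase w).congr (by simp)) ((hw.erase u).congr (by simp)) (by tauto)⟩

lemma PailState.ends_pailsInsert (h : PailState p s₀ R T s) (u w : Fin n) {i : ℕ}
    (hi : i < p + 2) :
    Ends (pailsInsert u w i) s fun _ => PailState p s₀
      (fun j a b => R j a b ∨ (j = i ∧ a = u ∧ b = w)) (T + (2 * logBound n + 4)) := by
  simp only [pailsInsert, getOutPail, getInPail, setOutPail, setInPail, treeInsert, ends_bind,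
    ends_tick, ends_get, ends_pure, ends_modify]
  have hu := (h.pails i hi u).1
  have hw := (h.pails i hi w).2
  have stepsOut := hu.insertSteps_le w
  have stepsIn := hw.insertSteps_le u
  have := h.time
  rw [Fintype.card_fin] at stepsOut stepsIn
  exact ⟨h.pos, h.vert, h.outList, h.inList, by dsimp only; omega,
    h.pails.update ((hu.insert w).congr (by simp [or_comm]))
      ((hw.insert u).congr (by simp [or_comm])) (by tauto)⟩

lemma PailState.ends_pailsInsert_of_searchOut (h : PailState p s₀ R T s) (u w : Fin n) {i : ℕ}
    (hi : i < p + 2) :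
    Ends (do if ← searchOut u w then pailsInsert u w i) s fun _ => PailState p s₀
      (fun j a b => R j a b ∨ (s₀.outList u w = true ∧ j = i ∧ a = u ∧ b = w))
      (T + (2 * logBound n + 5)) := by
  simp only [searchOut, ends_bind, ends_tick, ends_get, ends_pure]
  split_ifs with hsearch <;> rw [show s.outList = s₀.outList from h.outList] at hsearch
  · refine ((h.addTime 1).ends_pailsInsert u w hi).mono fun _ _ h' =>
      h'.congr (by simp [hsearch]) (by omega)
  · refine ends_pure.2 ((h.addTime 1).congr (by simp [hsearch]) (by omega))

lemma PailState.ends_pailsInsert_of_searchIn (h : PailState p s₀ R T s) (u w : Fin n) {i : ℕ}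
    (hi : i < p + 2) :
    Ends (do if ← searchIn u w then pailsInsert w u i) s fun _ => PailState p s₀
      (fun j a b => R j a b ∨ (s₀.inList u w = true ∧ j = i ∧ a = w ∧ b = u))
      (T + (2 * logBound n + 5)) := by
  simp only [searchIn, ends_bind, ends_tick, ends_get, ends_pure]
  split_ifs with hsearch <;> rw [show s.inList = s₀.inList from h.inList] at hsearch
  · refine ((h.addTime 1).ends_pailsInsert w u hi).mono fun _ _ h' =>
      h'.congr (by simp [hsearch]) (by omega)
  · refine ends_pure.2 ((h.addTime 1).congr (by simp [hsearch]) (by omega))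

lemma PailState.ends_forM_erase {α : Type} {f : α → Prog n Unit}
    {g : α → ℕ → Fin n → Fin n → Prop} {c : ℕ}
    (hf : ∀ w R T s, PailState p s₀ R T s →
      Ends (f w) s fun _ => PailState p s₀ (fun j a b => R j a b ∧ ¬ g w j a b) (T + c))
    (h : PailState p s₀ R T s) (ws : List α) :
    Ends (ws.forM f) s fun _ => PailState p s₀ (fun j a b => R j a b ∧ ¬ ∃ w ∈ ws, g w j a b)
      (T + ws.length * c) := by
  refine Ends.forM (fun done _ => PailState p s₀ (fun j a b => R j a b ∧ ¬ ∃ w ∈ done, g w j a b)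
    (T + done.length * c)) (fun done w _ s' h' => (hf w _ _ s' h').mono fun _ _ h'' =>
      h''.congr (fun j _ a b => ?_) ?_) (by simpa using h)
  · simp only [List.mem_append, List.mem_singleton, or_and_right, exists_or, exists_eq_left, not_or,
      and_assoc]
  · rw [List.length_append, List.length_singleton, add_mul, one_mul, add_assoc]

lemma PailState.ends_forM_insert {α : Type} {f : α → Prog n Unit}
    {g : α → ℕ → Fin n → Fin n → Prop} {c : ℕ}
    (hf : ∀ w R T s, PailState p s₀ R T s →
      Ends (f w) s fun _ => PailState p s₀ (fun j a b => R j a b ∨ g w j a b) (T + c))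
    (h : PailState p s₀ R T s) (ws : List α) :
    Ends (ws.forM f) s fun _ => PailState p s₀ (fun j a b => R j a b ∨ ∃ w ∈ ws, g w j a b)
      (T + ws.length * c) := by
  refine Ends.forM (fun done _ => PailState p s₀ (fun j a b => R j a b ∨ ∃ w ∈ done, g w j a b)
    (T + done.length * c)) (fun done w _ s' h' => (hf w _ _ s' h').mono fun _ _ h'' =>
      h''.congr (fun j _ a b => ?_) ?_) (by simpa using h)
  · simp only [List.mem_append, List.mem_singleton, or_and_right, exists_or, exists_eq_left,
      or_assoc]
  · rw [List.length_append, List.length_singleton, add_mul, one_mul, add_assoc]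

end Pails

/-! ### Updates of the order and of the graph -/

section Store

variable {n : ℕ}

/-- The list that `window lo hi` returns in the store `s`. -/
def windowList (s : Store n) (lo hi : ℕ) : List (Fin n) :=
  (List.range' lo (min hi n - lo)).filterMap
    fun x => if h : x < n then some (s.vert ⟨x, h⟩) else none

/-- The edge relation of the stored graph, read off the forward adjacency lists. -/
def Store.Edge (s : Store n) (a b : Fin n) : Prop := s.outList a b = true

/-- The edges of the stored graph that the pails of index `i` are meant to hold. As edges point
forward in the order, their length is bounded without an absolute value. -/
def Store.Close (t : ℕ → ℕ) (s : Store n) (i : ℕ) (a b : Fin n) : Prop :=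
  s.Edge a b ∧ (s.pos b : ℕ) ≤ s.pos a + t i

/-- The invariant of the algorithm between two updates: `T` and `T⁻¹` are inverse to each other, so
are the two adjacency lists, `T` is a topological order, and the pails are what they are meant to
be. -/
structure Consistent (p : ℕ) (t : ℕ → ℕ) (s : Store n) : Prop where
  vert_pos : ∀ w, s.vert (s.pos w) = w
  pos_vert : ∀ x, s.pos (s.vert x) = x
  inList_eq : ∀ a b, s.inList b a = s.outList a b
  topo : ∀ a b, s.Edge a b → s.pos a < s.pos b
  pails : PailsRep p (s.Close t) s

variable {p lo hi m c T : ℕ} {t : ℕ → ℕ} {s s' : Store n} {R : ℕ → Fin n → Fin n → Prop}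

lemma ends_window {Q : List (Fin n) → Store n → Prop} :
    Ends (window lo hi) s Q ↔
      Q (windowList s lo hi) { s with time := s.time + (min hi n - lo + 1) } := by
  simp only [window, ends_bind, ends_tick, ends_get, ends_pure, windowList]

lemma length_windowList_le (s : Store n) (lo hi : ℕ) : (windowList s lo hi).length ≤ hi - lo :=
  (List.length_filterMap_le _ _).trans (by rw [List.length_range']; omega)

namespace Consistent

lemma pos_injective (h : Consistent p t s) : Function.Injective s.pos :=
  Function.LeftInverse.injective h.vert_pos

lemma vert_injective (h : Consistent p t s) : Function.Injective s.vert :=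
  Function.LeftInverse.injective h.pos_vert

lemma addTime (h : Consistent p t s) (k : ℕ) : Consistent p t { s with time := s.time + k } :=
  ⟨h.vert_pos, h.pos_vert, h.inList_eq, h.topo, h.pails⟩

lemma pailState (h : Consistent p t s) : PailState p s (s.Close t) s.time s :=
  ⟨rfl, rfl, rfl, rfl, le_rfl, h.pails⟩

lemma mem_windowList (h : Consistent p t s) {w : Fin n} :
    w ∈ windowList s lo hi ↔ lo ≤ s.pos w ∧ (s.pos w : ℕ) < hi := by
  simp only [windowList, List.mem_filterMap, List.mem_range'_1]
  constructor
  · rintro ⟨x, hx, hxw⟩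
    split_ifs at hxw with hxn
    obtain rfl := Option.some.inj hxw
    simp only [h.pos_vert]
    omega
  · rintro ⟨hlo, hhi⟩
    have := (s.pos w).2
    exact ⟨s.pos w, by omega, by simp [h.vert_pos]⟩

lemma ends_window_erase (h : Consistent p t s) (h' : PailState p s R T s') {f : Fin n → Prog n Unit}
    {g : Fin n → ℕ → Fin n → Fin n → Prop}
    (hf : ∀ w R T s', PailState p s R T s' →
      Ends (f w) s' fun _ => PailState p s (fun j a b => R j a b ∧ ¬ g w j a b) (T + c))
    (hm : hi - lo ≤ m) :
    Ends (do (← window lo hi).forM f) s' fun _ => PailState p s (fun j a b => R j a b ∧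
      ¬ ∃ w, (lo ≤ s.pos w ∧ (s.pos w : ℕ) < hi) ∧ g w j a b) (T + (m + 1 + m * c)) := by
  rw [ends_bind, ends_window, show windowList s' lo hi = windowList s lo hi by
    simp only [windowList, h'.vert]]
  refine (PailState.ends_forM_erase hf (h'.addTime _) _).mono fun _ _ h'' =>
    h''.congr (fun j _ a b => by simp only [h.mem_windowList]) ?_
  have := Nat.mul_le_mul_right c ((length_windowList_le s lo hi).trans hm)
  omega

lemma ends_window_insert (h : Consistent p t s) (h' : PailState p s R T s')
    {f : Fin n → Prog n Unit} {g : Fin n → ℕ → Fin n → Fin n → Prop}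
    (hf : ∀ w R T s', PailState p s R T s' →
      Ends (f w) s' fun _ => PailState p s (fun j a b => R j a b ∨ g w j a b) (T + c))
    (hm : hi - lo ≤ m) :
    Ends (do (← window lo hi).forM f) s' fun _ => PailState p s (fun j a b => R j a b ∨
      ∃ w, (lo ≤ s.pos w ∧ (s.pos w : ℕ) < hi) ∧ g w j a b) (T + (m + 1 + m * c)) := by
  rw [ends_bind, ends_window, show windowList s' lo hi = windowList s lo hi by
    simp only [windowList, h'.vert]]
  refine (PailState.ends_forM_insert hf (h'.addTime _) _).mono fun _ _ h'' =>
    h''.congr (fun j _ a b => by simp only [h.mem_windowList]) ?_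
  have := Nat.mul_le_mul_right c ((length_windowList_le s lo hi).trans hm)
  omega

end Consistent

end Store

section Swap

variable {α β : Type} [DecidableEq α] {E : α → α → Prop} {u v : α}

lemma topo_comp_swap [Preorder β] {P : α → β} (huv : P u < P v) (topo : ∀ a b, E a b → P a < P b)
    (hu : ∀ z, E u z → P v < P z) (hv : ∀ z, E z v → P z < P u) {a b : α} (hab : E a b) :
    P (Equiv.swap u v a) < P (Equiv.swap u v b) := by
  have hlt := topo a b hab
  have hne : a ≠ b := by rintro rfl; exact hlt.false
  rcases eq_or_ne a u with rfl | hau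
  · have hvb := hu b hab
    have hbv : b ≠ v := by rintro rfl; exact hvb.false
    simpa [Equiv.swap_apply_of_ne_of_ne hne.symm hbv] using hvb
  rcases eq_or_ne b v with rfl | hbv
  · simpa [Equiv.swap_apply_of_ne_of_ne hau hne] using hv a hab
  rcases eq_or_ne a v with rfl | hav
  · have hbu : b ≠ u := by rintro rfl; exact (hlt.trans huv).false
    simpa [Equiv.swap_apply_of_ne_of_ne hbu hbv] using huv.trans hlt
  rw [Equiv.swap_apply_of_ne_of_ne hau hav]
  rcases eq_or_ne b u with rfl | hbu
  · simpa using hlt.trans huv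
  · rwa [Equiv.swap_apply_of_ne_of_ne hbu hbv]

/-- The four groups of conditions are the two windows in which `swap` erases pairs and the two in
which it inserts them. -/
lemma close_swap_iff {P : α → ℕ} {τ : ℕ} (huv : P u < P v) (topo : ∀ a b, E a b → P a < P b)
    (hu : ∀ z, E u z → P v < P z) (hv : ∀ z, E z v → P z < P u) (a b : α) :
    ((((E a b ∧ P b ≤ P a + τ) ∧
      ¬ (b = u ∧ P u - τ ≤ P a ∧ P a < min (P u) (P u + (P v - P u) - τ))) ∧
      ¬ (a = v ∧ max (P v + τ - (P v - P u)) (P v) + 1 ≤ P b ∧ P b < P v + τ + 1)) ∨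
      (E a b ∧ a = u ∧ max (P v) (P u + τ) + 1 ≤ P b ∧ P b < P u + τ + (P v - P u) + 1)) ∨
      (E a b ∧ b = v ∧ P v - τ - (P v - P u) ≤ P a ∧ P a < min (P u) (P v + (P v - P u) - τ)) ↔
    E a b ∧ P (Equiv.swap u v b) ≤ P (Equiv.swap u v a) + τ := by
  have huv_ne : u ≠ v := by rintro rfl; omega
  by_cases hE : E a b
  · have hab := topo a b hE
    have hne : a ≠ b := by rintro rfl; omega
    rcases eq_or_ne a u with rfl | hau
    · have hvb := hu b hE
      have hbv : b ≠ v := by rintro rfl; omega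
      simp only [hE, hne.symm, hbv, huv_ne, Equiv.swap_apply_left,
        Equiv.swap_apply_of_ne_of_ne hne.symm hbv, true_and, false_and, not_false_iff,
        and_true, or_false]
      clear topo hu hv
      omega
    rcases eq_or_ne a v with rfl | hav
    · have hbu : b ≠ u := by rintro rfl; omega
      simp only [hE, hau, hbu, hne.symm, Equiv.swap_apply_right,
        Equiv.swap_apply_of_ne_of_ne hbu hne.symm, true_and, false_and, not_false_iff,
        and_true, or_false]
      clear topo hu hv
      omega
    rw [Equiv.swap_apply_of_ne_of_ne hau hav]
    rcases eq_or_ne b u with rfl | hbu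
    · simp only [hE, hau, hav, huv_ne, Equiv.swap_apply_left, true_and, false_and, not_false_iff,
        and_true, or_false]
      clear topo hu hv
      omega
    rcases eq_or_ne b v with rfl | hbv
    · have := hv a hE
      simp only [hE, hau, hav, hbu, Equiv.swap_apply_right, true_and, false_and, not_false_iff,
        and_true, or_false]
      clear topo hu hv
      omega
    simp only [hE, hau, hav, hbu, hbv, Equiv.swap_apply_of_ne_of_ne hbu hbv, true_and, false_and,
      or_false, not_false_iff, and_true]
  · simp only [hE, false_and, or_false]

/-- The body of the loop of `swap`, for vertices `u` and `v` in positions `x` and `y`. -/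
def swapLevel {n : ℕ} (t : ℕ → ℕ) (u v : Fin n) (x y i : ℕ) : Prog n Unit := do
  tick 1
  (← window (x - t i) (min x (x + (y - x) - t i))).forM fun w => pailsErase w u i
  (← window (max (y + t i - (y - x)) y + 1) (y + t i + 1)).forM fun w => pailsErase v w i
  (← window (max y (x + t i) + 1) (x + t i + (y - x) + 1)).forM fun w => do
    if ← searchOut u w then pailsInsert u w i
  (← window (y - t i - (y - x)) (min x (y + (y - x) - t i))).forM fun w => do
    if ← searchIn v w then pailsInsert w v i

variable {n p : ℕ} {t : ℕ → ℕ} {s s' : Store n} {R : ℕ → Fin n → Fin n → Prop} {T : ℕ}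

lemma ends_swap_iff {u v : Fin n} {Q : Unit → Store n → Prop} :
    Ends (swap p t u v) s Q ↔
      Ends ((List.range (p + 2)).forM (swapLevel t u v (s.pos u) (s.pos v)))
        { s with time := s.time + 1 + 1 } fun _ s' => Q () { s' with
          pos := Function.update (Function.update s'.pos u (s'.pos v)) v (s'.pos u)
          vert := Function.update (Function.update s'.vert (s'.pos u) v) (s'.pos v) u
          time := s'.time + 4 } := by
  simp only [swap, ends_bind, ends_getPos, ends_tick, ends_modify]
  rfl

namespace Consistent

variable {u v : Fin n}

lemma ends_swapLevel (h : Consistent p t s) (h' : PailState p s R T s') {i : ℕ} (hi : i < p + 2)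
    (hR : ∀ a b, R i a b ↔ s.Close t i a b) (huv : s.pos u < s.pos v)
    (hu : ∀ z, s.Edge u z → s.pos v < s.pos z) (hv : ∀ z, s.Edge z v → s.pos z < s.pos u) :
    Ends (swapLevel t u v (s.pos u) (s.pos v) i) s' fun _ => PailState p s
      (Function.update R i fun a b => s.Edge a b ∧
        (s.pos (Equiv.swap u v b) : ℕ) ≤ s.pos (Equiv.swap u v a) + t i)
      (T + 50 * logBound n * (s.pos v - s.pos u : ℕ)) := by
  have hd : 1 ≤ (s.pos v - s.pos u : ℕ) := Nat.sub_pos_of_lt huv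
  rw [swapLevel, ends_bind, ends_tick, ← bind_assoc, ends_bind]
  refine (h.ends_window_erase (h'.addTime 1) (m := s.pos v - s.pos u)
    (fun w R T s h => h.ends_pailsErase w u hi) (by omega)).mono fun _ s₁ h₁ => ?_
  rw [← bind_assoc, ends_bind]
  refine (h.ends_window_erase h₁ (m := s.pos v - s.pos u)
    (fun w R T s h => h.ends_pailsErase v w hi) (by omega)).mono fun _ s₂ h₂ => ?_
  rw [← bind_assoc, ends_bind]
  refine (h.ends_window_insert h₂ (m := s.pos v - s.pos u)
    (fun w R T s h => h.ends_pailsInsert_of_searchOut u w hi) (by omega)).mono fun _ s₃ h₃ => ?_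
  refine (h.ends_window_insert h₃ (m := 2 * (s.pos v - s.pos u))
    (fun w R T s h => h.ends_pailsInsert_of_searchIn v w hi) (by omega)).mono fun _ s₄ h₄ => ?_
  refine h₄.congr (fun j _ a b => ?_) ?_
  · rcases eq_or_ne j i with rfl | hji
    · rw [Function.update_self, ← close_swap_iff (P := fun w => (s.pos w : ℕ)) huv h.topo hu hv,
        hR]
      simp only [h.inList_eq]
      refine or_congr (or_congr (and_congr (and_congr Iff.rfl (not_congr ?_)) (not_congr ?_)) ?_) ?_
      · exact ⟨fun ⟨_, hw, _, ha, hb⟩ => ⟨hb, ha ▸ hw⟩, fun ⟨hb, hw⟩ => ⟨a, hw, ⟨⟩, rfl, hb⟩⟩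
      · exact ⟨fun ⟨_, hw, _, ha, hb⟩ => ⟨ha, hb ▸ hw⟩, fun ⟨ha, hw⟩ => ⟨b, hw, ⟨⟩, ha, rfl⟩⟩
      · exact ⟨fun ⟨_, hw, hE, _, ha, hb⟩ => ⟨ha ▸ hb ▸ hE, ha, hb ▸ hw⟩,
          fun ⟨hE, ha, hw⟩ => ⟨b, hw, ha ▸ hE, ⟨⟩, ha, rfl⟩⟩
      · exact ⟨fun ⟨_, hw, hE, _, ha, hb⟩ => ⟨ha ▸ hb ▸ hE, hb, ha ▸ hw⟩,
          fun ⟨hE, hb, hw⟩ => ⟨a, hw, hb ▸ hE, ⟨⟩, rfl, hb⟩⟩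
    · simp only [hji, Function.update_of_ne hji, false_and, and_false, exists_false,
        not_false_iff, and_true, or_false]
  · have hL : (s.pos v - s.pos u : ℕ) ≤ (s.pos v - s.pos u) * logBound n :=
      Nat.le_mul_of_pos_right _ (one_le_logBound n)
    nlinarith

lemma of_swap (h : Consistent p t s) (huv : s.pos u < s.pos v)
    (hu : ∀ z, s.Edge u z → s.pos v < s.pos z) (hv : ∀ z, s.Edge z v → s.pos z < s.pos u)
    (hpos : s'.pos = s.pos ∘ Equiv.swap u v) (hvert : s'.vert = Equiv.swap u v ∘ s.vert)
    (hout : s'.outList = s.outList) (hin : s'.inList = s.inList)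
    (hpails : PailsRep p (fun i a b => s.Edge a b ∧
      (s.pos (Equiv.swap u v b) : ℕ) ≤ s.pos (Equiv.swap u v a) + t i) s') :
    Consistent p t s' where
  vert_pos w := by simp [hpos, hvert, h.vert_pos]
  pos_vert x := by simp [hpos, hvert, h.pos_vert]
  inList_eq a b := by rw [hin, hout, h.inList_eq]
  topo a b hab := by
    rw [Store.Edge, hout] at hab
    rw [hpos]
    exact topo_comp_swap huv h.topo hu hv hab
  pails := hpails.congr fun i _ a b => by
    simp only [Store.Close, Store.Edge, hpos, hout, Function.comp]

lemma update_vert (h : Consistent p t s) (u v : Fin n) :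
    Function.update (Function.update s.vert (s.pos u) v) (s.pos v) u = Equiv.swap u v ∘ s.vert := by
  conv_rhs => rw [← h.vert_pos u, ← h.vert_pos v, h.vert_injective.swap_comp, Equiv.swap_comm,
    Equiv.comp_swap_eq_update, h.vert_pos, h.vert_pos]

lemma ends_swap (h : Consistent p t s) (huv : s.pos u < s.pos v)
    (hu : ∀ z, s.Edge u z → s.pos v < s.pos z) (hv : ∀ z, s.Edge z v → s.pos z < s.pos u) :
    Ends (swap p t u v) s fun _ s' => Consistent p t s' ∧ s'.outList = s.outList ∧
      s'.pos = s.pos ∘ Equiv.swap u v ∧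
      s'.time ≤ s.time + 60 * (p + 2) * logBound n * (s.pos v - s.pos u : ℕ) := by
  have hdL : 1 ≤ logBound n * (s.pos v - s.pos u : ℕ) :=
    Nat.mul_pos (one_le_logBound n) (Nat.sub_pos_of_lt huv)
  set c := logBound n * (s.pos v - s.pos u : ℕ)
  rw [ends_swap_iff]
  refine (Ends.forM_range (fun k => PailState p s (fun i a b => s.Edge a b ∧
      if i < k then (s.pos (Equiv.swap u v b) : ℕ) ≤ s.pos (Equiv.swap u v a) + t i
      else (s.pos b : ℕ) ≤ s.pos a + t i) (s.time + 2 + k * (50 * c)))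
    (fun k hk s₁ h₁ => ?_) ?_).mono fun _ s₁ h₁ => ?_
  · refine (h.ends_swapLevel h₁ hk (by simp [Store.Close]) huv hu hv).mono fun _ s₂ h₂ =>
      h₂.congr (fun i _ a b => ?_) (by simp only [c]; apply le_of_eq; ring)
    rcases eq_or_ne i k with rfl | hik
    · simp
    · simp only [Function.update_of_ne hik, Nat.lt_succ_iff_lt_or_eq, hik, or_false]
  · exact (h.pailState.addTime 2).congr (by simp [Store.Close]) (by simp)
  · have hpos : Function.update (Function.update s₁.pos u (s₁.pos v)) v (s₁.pos u) =
        s.pos ∘ Equiv.swap u v := by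
      rw [h₁.pos, Equiv.swap_comm, Equiv.comp_swap_eq_update]
    refine ⟨h.of_swap huv hu hv hpos ?_ h₁.outList h₁.inList (h₁.pails.congr fun i hi a b => ?_),
      h₁.outList, hpos, ?_⟩
    · simp only [h₁.pos, h₁.vert, h.update_vert]
    · simp only [hi, if_true]
    · have := h₁.time
      have : (p + 2) * 1 ≤ (p + 2) * c := Nat.mul_le_mul_left _ hdL
      rw [show 60 * (p + 2) * logBound n * (s.pos v - s.pos u : ℕ) = 60 * ((p + 2) * c) by
        simp only [c]; ring]
      dsimp only
      linarith

end Consistent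

end Swap

section InsertEdge

variable {n p : ℕ} {t : ℕ → ℕ} {s : Store n} {u v : Fin n}

lemma update_update_eq_true_iff {α β : Type} [DecidableEq α] [DecidableEq β] (f : α → β → Bool)
    (u a : α) (v b : β) : Function.update f u (Function.update (f u) v true) a b = true ↔
      f a b = true ∨ (a = u ∧ b = v) := by
  rcases eq_or_ne a u with rfl | ha
  · rcases eq_or_ne b v with rfl | hb <;> simp [*]
  · simp [ha]

namespace Consistent

lemma of_insertEdge {s' : Store n} (h : Consistent p t s) (huv : s.pos u < s.pos v)
    (hpos : s'.pos = s.pos) (hvert : s'.vert = s.vert)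
    (hedge : ∀ a b, s'.Edge a b ↔ s.Edge a b ∨ (a = u ∧ b = v))
    (hin : ∀ a b, s'.inList b a = true ↔ s.Edge a b ∨ (a = u ∧ b = v))
    (hpails : PailsRep p (fun i a b => s.Close t i a b ∨
      a = u ∧ b = v ∧ (s.pos v : ℕ) ≤ s.pos u + t i) s') :
    Consistent p t s' where
  vert_pos := by rw [hpos, hvert]; exact h.vert_pos
  pos_vert := by rw [hpos, hvert]; exact h.pos_vert
  inList_eq a b := by rw [Bool.eq_iff_iff, hin, ← hedge, Store.Edge]
  topo a b hab := by
    rw [hpos]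
    obtain hab | ⟨rfl, rfl⟩ := (hedge a b).1 hab
    exacts [h.topo a b hab, huv]
  pails := hpails.congr fun i _ a b => by
    simp only [Store.Close, hedge, or_and_right, hpos]
    refine or_congr Iff.rfl ⟨?_, ?_⟩
    · rintro ⟨rfl, rfl, hle⟩; exact ⟨⟨rfl, rfl⟩, hle⟩
    · rintro ⟨⟨rfl, rfl⟩, hle⟩; exact ⟨rfl, rfl, hle⟩

lemma ends_insertEdge (h : Consistent p t s) (huv : s.pos u < s.pos v) :
    Ends (insertEdge p t u v) s fun _ s' => Consistent p t s' ∧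
      (∀ a b, s'.Edge a b ↔ s.Edge a b ∨ (a = u ∧ b = v)) ∧
      s'.pos = s.pos ∧ s'.time ≤ s.time + 9 * (p + 2) * logBound n := by
  simp only [insertEdge, ends_bind, ends_tick, ends_modify, ends_getPos]
  set s₀ : Store n := { s with
    outList := Function.update s.outList u (Function.update (s.outList u) v true)
    inList := Function.update s.inList v (Function.update (s.inList v) u true) } with hs₀
  refine (Ends.forM_range (fun k => PailState p s₀ (fun i a b => s.Close t i a b ∨
      i < k ∧ a = u ∧ b = v ∧ (s.pos v : ℕ) ≤ s.pos u + t i)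
      (s.time + 4 + k * (2 * logBound n + 5))) (fun k hk s₁ h₁ => ?_) ?_).mono fun _ s₁ h₁ => ?_
  · rw [ends_bind, ends_tick]
    have hdist : Nat.dist (s.pos u) (s.pos v) ≤ t k ↔ (s.pos v : ℕ) ≤ s.pos u + t k := by
      rw [Nat.dist_eq_sub_of_le huv.le, Nat.sub_le_iff_le_add']
    split_ifs with hclose <;> rw [hdist] at hclose
    · refine ((h₁.addTime 1).ends_pailsInsert u v hk).mono fun _ s₂ h₂ =>
        h₂.congr (fun i _ a b => ?_) (by rw [add_mul]; omega)
      rw [or_assoc, Nat.lt_succ_iff_lt_or_eq]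
      refine or_congr Iff.rfl ⟨?_, ?_⟩
      · rintro (⟨hi, rest⟩ | ⟨rfl, ha, hb⟩)
        exacts [⟨.inl hi, rest⟩, ⟨.inr rfl, ha, hb, hclose⟩]
      · rintro ⟨hi | rfl, ha, hb, hle⟩
        exacts [.inl ⟨hi, ha, hb, hle⟩, .inr ⟨rfl, ha, hb⟩]
    · refine ends_pure.2 ((h₁.addTime 1).congr (fun i _ a b => ?_) (by rw [add_mul]; omega))
      rw [Nat.lt_succ_iff_lt_or_eq]
      refine or_congr Iff.rfl (and_congr_left fun ⟨_, _, hle⟩ => ?_)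
      exact ⟨.inl, fun hi => hi.resolve_right (by rintro rfl; exact hclose hle)⟩
  · exact ⟨rfl, rfl, rfl, rfl, by simp, h.pails.congr (by simp)⟩
  · have hedge : ∀ a b, s₁.Edge a b ↔ s.Edge a b ∨ (a = u ∧ b = v) := fun a b => by
      rw [Store.Edge, h₁.outList, hs₀, update_update_eq_true_iff, Store.Edge]
    refine ⟨h.of_insertEdge huv h₁.pos h₁.vert hedge (fun a b => ?_)
      (h₁.pails.congr fun i hi a b => by simp only [hi, true_and]), hedge, h₁.pos, ?_⟩
    · rw [h₁.inList, hs₀, update_update_eq_true_iff, h.inList_eq, and_comm, Store.Edge]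
    · have := h₁.time
      have : (p + 2) * 1 ≤ (p + 2) * logBound n := Nat.mul_le_mul_left _ (one_le_logBound n)
      nlinarith

end Consistent

end InsertEdge

/-! ### Reading off the neighbours -/

/-- `s'` differs from `s` only in that at most `T` more steps have been executed. -/
def Later {n : ℕ} (s : Store n) (T : ℕ) (s' : Store n) : Prop :=
  ∃ k ≤ T, s' = { s with time := s.time + k }

namespace Later

variable {n p : ℕ} {t : ℕ → ℕ} {s s' s'' : Store n} {T T' : ℕ}

lemma of_addTime (s : Store n) (k : ℕ) : Later s k { s with time := s.time + k } := ⟨k, le_rfl, rfl⟩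

lemma refl (s : Store n) : Later s 0 s := of_addTime s 0

lemma trans (h : Later s T s') (h' : Later s' T' s'') : Later s (T + T') s'' := by
  obtain ⟨j, hj, rfl⟩ := h
  obtain ⟨k, hk, rfl⟩ := h'
  exact ⟨j + k, by omega, by simp [add_assoc]⟩

lemma addTime (h : Later s T s') (k : ℕ) : Later s (T + k) { s' with time := s'.time + k } :=
  h.trans (of_addTime s' k)

lemma mono (h : Later s T s') (hT : T ≤ T') : Later s T' s' :=
  let ⟨k, hk, hs'⟩ := h
  ⟨k, hk.trans hT, hs'⟩

lemma pos (h : Later s T s') : s'.pos = s.pos := by obtain ⟨k, -, rfl⟩ := h; rfl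

lemma consistent (h : Later s T s') (hs : Consistent p t s) : Consistent p t s' := by
  obtain ⟨k, -, rfl⟩ := h
  exact hs.addTime k

end Later

/-- The list `A` enumerates the elements satisfying `S` in strictly increasing order of `f`. -/
structure IsSorting {α β : Type} [Preorder β] (f : α → β) (S : α → Prop) (A : List α) : Prop where
  sorted : A.Pairwise (f · < f ·)
  mem_iff : ∀ w, w ∈ A ↔ S w

namespace IsSorting

variable {α β : Type} [Preorder β] {f : α → β} {S S' : α → Prop} {A ws : List α}

lemma congr (h : IsSorting f S A) (hS : ∀ w, S w ↔ S' w) : IsSorting f S' A :=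
  ⟨h.sorted, fun w => (h.mem_iff w).trans (hS w)⟩

lemma nodup (h : IsSorting f S A) : A.Nodup :=
  h.sorted.imp fun hlt => by rintro rfl; exact lt_irrefl _ hlt

lemma length_le (h : IsSorting f S A) (hS : ∀ w, S w → w ∈ ws) : A.length ≤ ws.length :=
  (h.nodup.subperm fun w hw => hS w ((h.mem_iff w).1 hw)).length_le

lemma le_length (h : IsSorting f S A) (hws : ws.Nodup) (hS : ∀ w ∈ ws, S w) :
    ws.length ≤ A.length :=
  (hws.subperm fun w hw => (h.mem_iff w).2 (hS w hw)).length_le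

lemma filter (h : IsSorting f S A) (P : α → Bool) :
    IsSorting f (fun w => S w ∧ P w = true) (A.filter P) :=
  ⟨h.sorted.filter _, fun w => by rw [List.mem_filter, h.mem_iff]⟩

end IsSorting

section Neighbours

variable {n p : ℕ} {t : ℕ → ℕ} {s : Store n} {ws : List (Fin n)} {c m : ℕ}

lemma Consistent.ends_comparisonSort (h : Consistent p t s) (ws : List (Fin n)) :
    Ends (comparisonSort ws) s fun A s' => IsSorting s.pos (· ∈ ws) A ∧
      Later s (ws.length * (logBound n + 3) + 1) s' := by
  simp only [comparisonSort, ends_bind, ends_get, treeCollect, ends_tick, ends_pure]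
  refine (Ends.foldlM (fun done _ tr s' => IsPail tr (fun x => s.vert x ∈ done) ∧
    Later s (done.length * (logBound n + 1)) s') ?_ ?_).mono ?_
  · rintro done w _ tr s₁ ⟨htr, hs₁⟩
    simp only [treeInsert, ends_bind, ends_tick, ends_pure]
    refine ⟨(htr.insert (s.pos w)).congr fun x => ?_, ((hs₁.addTime 1).addTime _).mono ?_⟩
    · rw [List.mem_append, List.mem_singleton, or_comm]
      refine or_congr Iff.rfl ⟨?_, ?_⟩
      · rintro rfl; exact h.vert_pos w
      · rintro rfl; exact (h.pos_vert x).symm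
    · have := htr.insertSteps_le (s.pos w)
      rw [Fintype.card_fin] at this
      rw [List.length_append, List.length_singleton, add_mul]
      omega
  · exact ⟨IsPail.nil (by simp), (Later.refl s).mono (by simp)⟩
  · rintro tr s₁ ⟨htr, hs₁⟩
    have hsort : IsSorting s.pos (· ∈ ws) (tr.toList.map s.vert) := by
      refine ⟨?_, fun w => ?_⟩
      · rw [List.pairwise_map]
        simpa only [h.pos_vert] using pairwise_lt_toList htr.valid.1
      · simp only [List.mem_map, htr.mem_iff]
        exact ⟨by rintro ⟨x, hx, rfl⟩; exact hx, fun hw => ⟨s.pos w, by rwa [h.vert_pos],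
          h.vert_pos w⟩⟩
    have hlen := hsort.length_le fun w hw => hw
    rw [List.length_map] at hlen
    exact ⟨hsort, ((hs₁.addTime _).addTime _).mono (by simp only [mul_add]; omega)⟩

/-- `b` is the array of buckets of `countingSort` after the vertices of `ws` have been thrown in:
bucket `x` holds the vertex at position `c + x`. -/
def IsBuckets (s : Store n) (c : ℕ) (ws : List (Fin n)) (b : ℕ → Option (Fin n)) : Prop :=
  ∀ x w, b x = some w ↔ w ∈ ws ∧ (s.pos w : ℕ) = c + x

lemma IsBuckets.update (hinj : s.pos.Injective) {b : ℕ → Option (Fin n)} {w : Fin n}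
    (hb : IsBuckets s c ws b) (hw : c ≤ s.pos w) :
    IsBuckets s c (ws ++ [w]) (Function.update b (s.pos w - c) (some w)) := by
  intro x z
  rw [List.mem_append, List.mem_singleton]
  rcases eq_or_ne x (s.pos w - c) with rfl | hx
  · rw [Function.update_self, Option.some_inj, Nat.add_sub_cancel' hw, Fin.val_inj, hinj.eq_iff]
    exact ⟨fun hz => ⟨.inr hz.symm, hz.symm⟩, fun hz => hz.2.symm⟩
  · rw [Function.update_of_ne hx, hb]
    refine and_congr_left fun hz => ⟨.inl, fun hmem => hmem.resolve_right ?_⟩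
    rintro rfl
    omega

lemma IsBuckets.isSorting {b : ℕ → Option (Fin n)} (hb : IsBuckets s c ws b)
    (hws : ∀ w ∈ ws, c ≤ s.pos w ∧ (s.pos w : ℕ) ≤ c + m) :
    IsSorting s.pos (· ∈ ws) ((List.range (m + 1)).filterMap b) where
  sorted := by
    rw [List.pairwise_filterMap]
    refine List.pairwise_lt_range.imp fun {x y} hxy w hw z hz => ?_
    rw [Fin.lt_def, ((hb x w).1 hw).2, ((hb y z).1 hz).2]
    omega
  mem_iff w := by
    simp only [List.mem_filterMap, fun x => hb x w, List.mem_range]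
    refine ⟨fun ⟨_, _, hw, _⟩ => hw, fun hw => ⟨s.pos w - c, ?_, hw, ?_⟩⟩ <;>
      have := hws w hw <;> omega

lemma ends_countingSort (hinj : s.pos.Injective)
    (hws : ∀ w ∈ ws, c ≤ s.pos w ∧ (s.pos w : ℕ) ≤ c + m) :
    Ends (countingSort c m ws) s fun A s' => IsSorting s.pos (· ∈ ws) A ∧
      Later s (2 * (m + 1) + 2 * ws.length) s' := by
  simp only [countingSort, ends_bind, ends_tick, ends_pure]
  refine (Ends.foldlM (fun done rest b s' => done ++ rest = ws ∧ IsBuckets s c done b ∧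
    Later s (m + 1 + 2 * done.length) s') ?_ ?_).mono ?_
  · rintro done w rest b s₁ ⟨hsplit, hb, hs₁⟩
    simp only [ends_bind, ends_getPos, ends_tick, ends_pure]
    refine ⟨by simpa using hsplit, ?_, ((hs₁.addTime 1).addTime 1).mono ?_⟩
    · rw [hs₁.pos]
      exact hb.update hinj (hws w (by simp [← hsplit])).1
    · rw [List.length_append, List.length_singleton]
      omega
  · exact ⟨rfl, fun x w => by simp, ((Later.refl s).addTime _).mono (by simp)⟩
  · exact fun b s₁ ⟨_, hb, hs₁⟩ => ⟨hb.isSorting hws, (hs₁.addTime _).mono (by omega)⟩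

lemma length_le_of_pos_mem_Icc (hinj : s.pos.Injective) (hnd : ws.Nodup)
    (hws : ∀ w ∈ ws, c ≤ s.pos w ∧ (s.pos w : ℕ) ≤ c + m) : ws.length ≤ m + 1 := by
  rw [← List.toFinset_card_of_nodup hnd]
  refine (Finset.card_le_card_of_injOn (fun w => (s.pos w : ℕ)) (t := Finset.Icc c (c + m))
    (fun w hw => Finset.mem_coe.2 (Finset.mem_Icc.2 (hws w (by simpa using hw))))
    (Fin.val_injective.comp hinj).injOn).trans (by simp; omega)

/-- The common part of `hatA` and `hatB`: sort the content `ws` of a pail, and filter. -/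
def sortFilter (cmp : Bool) (c m : ℕ) (ws : List (Fin n)) (P : (Fin n → Fin n) → Fin n → Bool) :
    Prog n (List (Fin n)) := do
  let sorted ← if cmp then comparisonSort ws else countingSort c m ws
  let s ← get
  tick (sorted.length + 1)
  return sorted.filter (P s.pos)

lemma Consistent.ends_sortFilter (h : Consistent p t s) {cmp : Bool} (hnd : ws.Nodup)
    (hws : ∀ w ∈ ws, c ≤ s.pos w ∧ (s.pos w : ℕ) ≤ c + m) {P : (Fin n → Fin n) → Fin n → Bool}
    (hcmp : cmp = true → ∀ w ∈ ws, P s.pos w = true) :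
    Ends (sortFilter cmp c m ws P) { s with time := s.time + 1 + 1 + 1 + (ws.length + 1) }
      fun A s' => IsSorting s.pos (fun w => w ∈ ws ∧ P s.pos w = true) A ∧
        Later s (if cmp then 6 * logBound n * (A.length + 1) else 11 * (m + 1)) s' := by
  have hlen := length_le_of_pos_mem_Icc h.pos_injective hnd hws
  have h₀ := ((((Later.refl s).addTime 1).addTime 1).addTime 1).addTime (ws.length + 1)
  have filter_sorted : ∀ {A s₁ T}, IsSorting s.pos (· ∈ ws) A ∧
      Later { s with time := s.time + 1 + 1 + 1 + (ws.length + 1) } T s₁ →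
      IsSorting s.pos (fun w => w ∈ ws ∧ P s.pos w = true) (A.filter (P s₁.pos)) ∧
      Later s (2 * ws.length + 5 + T) { s₁ with time := s₁.time + (A.length + 1) } := by
    rintro A s₁ T ⟨hA, hs₁⟩
    have := hA.length_le fun w hw => hw
    refine ⟨?_, ((h₀.trans hs₁).addTime _).mono (by omega)⟩
    rw [(h₀.trans hs₁).pos]
    exact hA.filter _
  cases cmp <;> simp only [sortFilter, Bool.false_eq_true, if_false, if_true, ends_bind, ends_get,
    ends_tick, ends_pure]
  · refine (ends_countingSort (h₀.consistent h).pos_injective hws).mono fun A s₁ hs₁ => ?_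
    obtain ⟨hA, hlater⟩ := filter_sorted hs₁
    exact ⟨hA, hlater.mono (by omega)⟩
  · refine (((h₀.consistent h)).ends_comparisonSort ws).mono fun A s₁ hs₁ => ?_
    obtain ⟨hA, hlater⟩ := filter_sorted hs₁
    refine ⟨hA, hlater.mono ?_⟩
    have := hA.le_length hnd fun w hw => ⟨hw, hcmp rfl w hw⟩
    have := one_le_logBound n
    nlinarith

namespace Consistent

lemma ends_hatA (h : Consistent p t s) {cmp : Bool} {u v : Fin n} {i : ℕ} (hi : i < p + 2)
    (hcmp : cmp = true → (s.pos u : ℕ) + t i < s.pos v) :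
    Ends (hatA t cmp u v i) s fun A s' =>
      IsSorting s.pos (fun w => s.Close t i u w ∧ s.pos w < s.pos v) A ∧
      Later s (if cmp then 6 * logBound n * (A.length + 1) else 11 * (t i + 1)) s' := by
  obtain ⟨hvalid, hmem⟩ := (h.pails i hi u).1
  have hws : ∀ w ∈ (s.outPails u i).toList,
      (s.pos u : ℕ) ≤ s.pos w ∧ (s.pos w : ℕ) ≤ s.pos u + t i := fun w hw =>
    ⟨(h.topo u w ((hmem w).1 hw).1).le, ((hmem w).1 hw).2⟩
  have hsort := h.ends_sortFilter ((pairwise_lt_toList hvalid.1).imp ne_of_lt) hws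
    (P := fun f w => decide ((f w : ℕ) < s.pos v)) fun hc w hw => by
      simpa using (hws w hw).2.trans_lt (hcmp hc)
  simp only [hatA, ends_bind, ends_getPos, getOutPail, treeCollect, ends_tick, ends_get, ends_pure]
  refine hsort.mono fun A s' ⟨hA, hs'⟩ => ⟨hA.congr fun w => ?_, hs'⟩
  rw [hmem, decide_eq_true_eq, Fin.lt_def]

lemma ends_hatB (h : Consistent p t s) {cmp : Bool} {u v : Fin n} {i : ℕ} (hi : i < p + 2)
    (hcmp : cmp = true → (s.pos u : ℕ) + t i < s.pos v) :
    Ends (hatB t cmp u v i) s fun B s' =>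
      IsSorting s.pos (fun w => s.Close t i w v ∧ s.pos u < s.pos w) B ∧
      Later s (if cmp then 6 * logBound n * (B.length + 1) else 11 * (t i + 1)) s' := by
  obtain ⟨hvalid, hmem⟩ := (h.pails i hi v).2
  have hclose : ∀ w ∈ (s.inPails v i).toList,
      (s.pos v : ℕ) ≤ s.pos w + t i ∧ (s.pos w : ℕ) < s.pos v := fun w hw =>
    ⟨((hmem w).1 hw).2, h.topo w v ((hmem w).1 hw).1⟩
  have hsort := h.ends_sortFilter ((pairwise_lt_toList hvalid.1).imp ne_of_lt)
    (c := s.pos v - t i) (m := t i) (fun w hw => by have := hclose w hw; omega)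
    (P := fun f w => decide ((s.pos u : ℕ) < f w)) fun hc w hw => by
      have := hclose w hw; have := hcmp hc; exact decide_eq_true (by omega)
  simp only [hatB, ends_bind, ends_getPos, getInPail, treeCollect, ends_tick, ends_get, ends_pure]
  refine hsort.mono fun A s' ⟨hA, hs'⟩ => ⟨hA.congr fun w => ?_, hs'⟩
  rw [hmem, decide_eq_true_eq, Fin.lt_def]

end Consistent

lemma ends_findLevel {d : ℕ} (hd : d ≤ t (p + 1)) :
    Ends (findLevel p t d) s fun level s' => Later s (p + 1) s' ∧
      match level with
      | some i => i < p + 1 ∧ t i < d ∧ d ≤ t (i + 1)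
      | none => d ≤ t 0 := by
  simp only [findLevel, ends_bind, ends_tick, ends_pure]
  refine ⟨Later.of_addTime s _, ?_⟩
  split
  case h_1 i hi =>
    exact ⟨List.mem_range.1 (List.mem_of_find?_eq_some hi), by simpa using List.find?_some hi⟩
  case h_2 hnone =>
    classical
    have hex : ∃ i, d ≤ t i := ⟨p + 1, hd⟩
    rcases hi : Nat.find hex with _ | i
    · exact hi ▸ Nat.find_spec hex
    · have hle : Nat.find hex ≤ p + 1 := Nat.find_le hd
      have hlt : t i < d := not_le.1 (Nat.find_min hex (by omega))
      have hspec : d ≤ t (i + 1) := hi ▸ Nat.find_spec hex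
      exact absurd (decide_eq_true ⟨hlt, hspec⟩)
        (List.find?_eq_none.1 hnone i (List.mem_range.2 (by omega)))

end Neighbours

/-! ### The pairs treated by the nested loops -/

section LoopPairs

lemma takeWhile_eq_filter_of_pairwise {α : Type} {P : α → Bool} {l : List α}
    (hl : l.Pairwise fun a b => P b = true → P a = true) : l.takeWhile P = l.filter P := by
  induction l with
  | nil => rfl
  | cons a l ih =>
    obtain ⟨ha, hl⟩ := List.pairwise_cons.1 hl
    by_cases hPa : P a = true
    · rw [List.takeWhile_cons_of_pos hPa, List.filter_cons_of_pos hPa, ih hl]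
    · rw [List.takeWhile_cons_of_neg hPa, List.filter_cons_of_neg hPa, eq_comm,
        List.filter_eq_nil_iff]
      exact fun b hb hPb => hPa (ha b hb hPb)

variable {n : ℕ} {f : Fin n → Fin n} {u v : Fin n} {A B : List (Fin n)}

lemma loopPairs_eq_filter (hB : (B ++ [v]).Pairwise (f · < f ·)) :
    loopPairs f u v A B =
      (u :: A).reverse.flatMap fun a => ((B ++ [v]).filter (f a < f ·)).map fun b => (a, b) := by
  refine congrArg (List.flatMap · _) (funext fun a => congrArg (List.map _) ?_)
  rw [takeWhile_eq_filter_of_pairwise, List.filter_reverse, List.reverse_reverse]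
  rw [List.pairwise_reverse]
  exact hB.imp fun hlt hb => by simpa using (of_decide_eq_true hb).trans hlt

lemma mem_loopPairs (hB : (B ++ [v]).Pairwise (f · < f ·)) {a b : Fin n} :
    (a, b) ∈ loopPairs f u v A B ↔ (a = u ∨ a ∈ A) ∧ (b ∈ B ∨ b = v) ∧ f a < f b := by
  simp only [loopPairs_eq_filter hB, List.mem_flatMap, List.mem_map, List.mem_filter, Prod.mk.injEq,
    List.mem_reverse, List.mem_cons, List.mem_append, List.mem_nil_iff, or_false, decide_eq_true_eq]
  exact ⟨fun ⟨_, ha, _, ⟨hb, hlt⟩, haa, hbb⟩ => haa ▸ hbb ▸ ⟨ha, hb, hlt⟩,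
    fun ⟨ha, hb, hlt⟩ => ⟨a, ha, b, ⟨hb, hlt⟩, rfl, rfl⟩⟩

lemma pairwise_loopPairs (hA : (u :: A).Pairwise (f · < f ·))
    (hB : (B ++ [v]).Pairwise (f · < f ·)) :
    (loopPairs f u v A B).Pairwise fun q q' =>
      (q'.1 = q.1 ∧ f q.2 < f q'.2) ∨ f q'.1 < f q.1 := by
  rw [loopPairs_eq_filter hB, List.pairwise_flatMap, List.pairwise_reverse]
  refine ⟨fun a _ => ?_, hA.imp fun hlt => ?_⟩
  · rw [List.pairwise_map]
    exact (hB.filter _).imp fun hlt => .inl ⟨rfl, hlt⟩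
  · simp only [List.mem_map]
    rintro _ ⟨_, _, rfl⟩ _ ⟨_, _, rfl⟩
    exact .inr hlt

lemma length_add_one_le_length_loopPairs_left (hA : (u :: A).Pairwise (f · < f ·))
    (hB : (B ++ [v]).Pairwise (f · < f ·)) (hAv : ∀ a ∈ u :: A, f a < f v) :
    A.length + 1 ≤ (loopPairs f u v A B).length := by
  have hnd : ((u :: A).map fun a => (a, v)).Nodup :=
    List.Nodup.map (fun _ _ h => congrArg Prod.fst h) (IsSorting.nodup ⟨hA, fun _ => Iff.rfl⟩)
  refine le_trans (by simp) (hnd.subperm fun q hq => ?_).length_le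
  obtain ⟨a, ha, rfl⟩ := List.mem_map.1 hq
  exact (mem_loopPairs hB).2 ⟨List.mem_cons.1 ha, .inr rfl, hAv a ha⟩

lemma length_add_one_le_length_loopPairs_right (hB : (B ++ [v]).Pairwise (f · < f ·))
    (hBu : ∀ b ∈ B ++ [v], f u < f b) : B.length + 1 ≤ (loopPairs f u v A B).length := by
  have hnd : ((B ++ [v]).map fun b => (u, b)).Nodup :=
    List.Nodup.map (fun _ _ h => congrArg Prod.snd h) (IsSorting.nodup ⟨hB, fun _ => Iff.rfl⟩)
  refine le_trans (by simp) (hnd.subperm fun q hq => ?_).length_le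
  obtain ⟨b, hb, rfl⟩ := List.mem_map.1 hq
  exact (mem_loopPairs hB).2 ⟨.inl rfl, by simpa using hb, hBu b hb⟩

end LoopPairs

/-! ### Sequences of swaps -/

/-- The order `g` arises from `f` by `N` swaps of a vertex in `U` with a higher vertex in `V`, all
at positions between `lo` and `hi`. The sum of the square roots of the distances is `S`. -/
inductive Moves {n : ℕ} (U V : Fin n → Prop) (lo hi : ℕ) (f : Fin n → Fin n) :
    (Fin n → Fin n) → ℕ → ℝ → Prop
  | refl : Moves U V lo hi f f 0 0
  | step {g : Fin n → Fin n} {N : ℕ} {S : ℝ} {x y : Fin n} : Moves U V lo hi f g N S → U x → V y →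
      lo ≤ g x → g x < g y → g y ≤ hi →
      Moves U V lo hi f (g ∘ Equiv.swap x y) (N + 1) (S + √((g y : ℝ) - g x))

lemma comp_swap_cases {α β : Type*} [DecidableEq α] (g : α → β) (x y w : α) :
    (w = x ∧ (g ∘ Equiv.swap x y) w = g y) ∨ (w = y ∧ (g ∘ Equiv.swap x y) w = g x) ∨
      (w ≠ x ∧ w ≠ y ∧ (g ∘ Equiv.swap x y) w = g w) := by
  by_cases hx : w = x
  · subst hx; simp
  · by_cases hy : w = y
    · subst hy; simp
    · simp [hx, hy, Equiv.swap_apply_of_ne_of_ne]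

lemma sqrt_abs_sub_le (a b c : ℝ) : √|a - c| ≤ √|a - b| + √|b - c| := by
  refine Real.sqrt_le_iff.2 ⟨by positivity, (abs_sub_le a b c).trans ?_⟩
  rw [add_sq, Real.sq_sqrt (abs_nonneg _), Real.sq_sqrt (abs_nonneg _)]
  linarith [show 0 ≤ 2 * √|a - b| * √|b - c| by positivity]

namespace Moves

variable {n : ℕ} {U V U' V' : Fin n → Prop} {lo hi lo' hi' : ℕ} {f g h : Fin n → Fin n} {N N' : ℕ}
  {S S' : ℝ}

lemma trans (hfg : Moves U V lo hi f g N S) (hgh : Moves U V lo hi g h N' S') :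
    Moves U V lo hi f h (N + N') (S + S') := by
  induction hgh with
  | refl => simpa using hfg
  | step _ hx hy hlo hlt hhi ih => rw [← add_assoc, ← add_assoc]; exact ih.step hx hy hlo hlt hhi

lemma mono (hm : Moves U V lo hi f g N S) (hU : ∀ x, U x → U' x) (hV : ∀ x, V x → V' x)
    (hlo : lo' ≤ lo) (hhi : hi ≤ hi') : Moves U' V' lo' hi' f g N S := by
  induction hm with
  | refl => exact .refl
  | step _ hx hy hlox hlt hyhi ih =>
    exact ih.step (hU _ hx) (hV _ hy) (hlo.trans hlox) hlt (hyhi.trans hhi)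

lemma rev (hm : Moves U V lo hi f g N S) :
    Moves V U (n - (hi + 1)) (n - (lo + 1)) (Fin.rev ∘ f) (Fin.rev ∘ g) N S := by
  induction hm with
  | refl => exact .refl
  | @step g N S x y _ hx hy hlo hlt hhi ih =>
    have hstep := ih.step hy hx (by simp only [Function.comp_apply, Fin.val_rev]; omega)
      (Fin.rev_lt_rev.2 hlt) (by simp only [Function.comp_apply, Fin.val_rev]; omega)
    rw [Equiv.swap_comm, Function.comp_assoc] at hstep
    convert hstep using 3
    have rev_add (a b : Fin n) : ((Fin.rev a : ℕ) : ℝ) + a = (Fin.rev b : ℕ) + b := by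
      rw [Fin.val_rev, Fin.val_rev]
      exact_mod_cast (by omega : n - (a + 1 : ℕ) + a = n - (b + 1 : ℕ) + b)
    simp only [Function.comp_apply]
    linarith [rev_add (g x) (g y)]

lemma nonneg (hm : Moves U V lo hi f g N S) : 0 ≤ S := by
  induction hm with
  | refl => exact le_rfl
  | step _ _ _ _ _ _ ih => positivity

lemma eq_of_zero (hm : Moves U V lo hi f g 0 S) : g = f := by
  cases hm with
  | refl => rfl

lemma up (hm : Moves U V lo hi f g N S) (hUV : ∀ x, U x → ¬ V x) {w : Fin n} (hw : U w) :
    f w ≤ g w := by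
  induction hm with
  | refl => exact le_rfl
  | @step g _ _ x y _ _ hy _ hlt _ ih =>
    rcases comp_swap_cases g x y w with ⟨rfl, h⟩ | ⟨rfl, h⟩ | ⟨-, -, h⟩ <;> rw [h]
    · exact ih.trans hlt.le
    · exact absurd hy (hUV _ hw)
    · exact ih

lemma down (hm : Moves U V lo hi f g N S) (hUV : ∀ x, U x → ¬ V x) {w : Fin n} (hw : V w) :
    g w ≤ f w :=
  Fin.rev_le_rev.1 (hm.rev.up (fun x hV hU => hUV x hU hV) hw)

lemma inside (hm : Moves U V lo hi f g N S) {w : Fin n} (hw : lo ≤ f w ∧ f w ≤ hi) :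
    lo ≤ g w ∧ g w ≤ hi := by
  induction hm with
  | refl => exact hw
  | @step g _ _ x y _ _ _ hlo hlt hhi ih =>
    rw [Fin.lt_def] at hlt
    rcases comp_swap_cases g x y w with ⟨rfl, h⟩ | ⟨rfl, h⟩ | ⟨-, -, h⟩ <;> rw [h]
    · exact ⟨by omega, hhi⟩
    · exact ⟨hlo, by omega⟩
    · exact ih

lemma outside (hm : Moves U V lo hi f g N S) {w : Fin n} (hw : f w < lo ∨ hi < f w) :
    g w = f w := by
  induction hm with
  | refl => rfl
  | @step g _ _ x y _ _ _ hlo hlt hhi ih =>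
    rw [Fin.lt_def] at hlt
    rcases comp_swap_cases g x y w with ⟨rfl, h⟩ | ⟨rfl, h⟩ | ⟨-, -, h⟩ <;> rw [h]
    · rw [← ih] at hw; omega
    · rw [← ih] at hw; omega
    · exact ih

lemma lt_of_lt_left (hm : Moves U V lo hi f g N S) {w y : Fin n} (hw : f w < lo) (hwy : f w < f y) :
    g w < g y := by
  rw [Fin.lt_def, hm.outside (Or.inl hw)]
  by_cases hy : lo ≤ f y ∧ f y ≤ hi
  · exact hw.trans_le (hm.inside hy).1
  · rwa [hm.outside (by omega)]

lemma lt_of_lt_right (hm : Moves U V lo hi f g N S) {w y : Fin n} (hw : hi < f w)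
    (hyw : f y < f w) : g y < g w :=
  Fin.rev_lt_rev.1 (hm.rev.lt_of_lt_left (by simp only [Function.comp_apply, Fin.val_rev]; omega)
    (Fin.rev_lt_rev.2 hyw))

lemma sqrt_le (hm : Moves U V lo hi f g N S) (w : Fin n) : √|(g w : ℝ) - f w| ≤ S := by
  induction hm with
  | refl => simp
  | @step g _ _ x y _ _ _ _ hlt _ ih =>
    have hlt' : (g x : ℝ) < g y := mod_cast hlt
    refine (sqrt_abs_sub_le _ (g w : ℝ) _).trans ?_
    rw [add_comm]
    refine add_le_add ih ?_
    rcases comp_swap_cases g x y w with ⟨rfl, h⟩ | ⟨rfl, h⟩ | ⟨-, -, h⟩ <;> rw [h]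
    · rw [abs_of_pos (by linarith)]
    · rw [abs_sub_comm, abs_of_pos (by linarith)]
    · simp

lemma mem_of_isUpperSet (hm : Moves U V lo hi f g N S) (hUV : ∀ x, U x → ¬ V x)
    {W : Set (Fin n)} (hW : IsUpperSet W) {u v : Fin n} (hu : U u)
    (hUW : ∀ x, U x → x ≠ u → f x ∈ W) (hv : V v) (hvW : f v ∈ W) (hvu : g v < g u) :
    g u ∈ W := by
  -- Until `u` and `v` trade places, `v` is only swapped with vertices of `U` whose positions are
  -- in `W`.
  suffices h : g u ∈ W ∨ g v ∈ W from h.elim id (hW hvu.le)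
  clear hvu
  induction hm with
  | refl => exact Or.inr hvW
  | @step g N S x y hm hx hy _ hlt _ ih =>
    rcases comp_swap_cases g x y u with ⟨rfl, hgu⟩ | ⟨rfl, -⟩ | ⟨hux, -, hgu⟩
    · rcases comp_swap_cases g u y v with ⟨rfl, -⟩ | ⟨rfl, -⟩ | ⟨-, -, hgv⟩
      · exact absurd hv (hUV _ hu)
      · rw [hgu]; exact Or.inl (ih.elim (hW hlt.le) id)
      · rw [hgu, hgv]; exact ih.imp_left (hW hlt.le)
    · exact absurd hy (hUV _ hu)
    · rcases comp_swap_cases g x y v with ⟨rfl, -⟩ | ⟨rfl, hgv⟩ | ⟨-, -, hgv⟩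
      · exact absurd hv (hUV _ hx)
      · rw [hgv]; exact Or.inr (hW (hm.up hUV hx) (hUW x hx hux.symm))
      · rw [hgu, hgv]; exact ih

end Moves

/-- The agreement of two orders, as measured by the scalar product. -/
def agreement {n : ℕ} (F f : Fin n → Fin n) : ℕ := ∑ w, (F w : ℕ) * f w

variable {n : ℕ}

lemma agreement_le (F f : Fin n → Fin n) : agreement F f ≤ n * (n * n) := by
  refine (Finset.sum_le_card_nsmul _ _ (n * n) fun w _ =>
    Nat.mul_le_mul (F w).2.le (f w).2.le).trans ?_
  simp

lemma agreement_comp_swap {F g : Fin n → Fin n} {x y : Fin n} (hF : F y < F x) (hg : g x < g y) :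
    agreement F (g ∘ Equiv.swap x y) = agreement F g + (F x - F y) * (g y - g x) := by
  have hxy : x ≠ y := by rintro rfl; exact lt_irrefl _ hF
  have sum_split (φ : Fin n → ℕ) :
      ∑ w, φ w = φ x + (φ y + ∑ w ∈ (Finset.univ.erase x).erase y, φ w) := by
    rw [Finset.add_sum_erase _ _ (Finset.mem_erase.2 ⟨hxy.symm, Finset.mem_univ y⟩),
      Finset.add_sum_erase _ _ (Finset.mem_univ x)]
  have sum_rest : ∑ w ∈ (Finset.univ.erase x).erase y, (F w : ℕ) * (g ∘ Equiv.swap x y) w =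
      ∑ w ∈ (Finset.univ.erase x).erase y, (F w : ℕ) * g w := by
    refine Finset.sum_congr rfl fun w hw => ?_
    rw [Finset.mem_erase, Finset.mem_erase] at hw
    rw [Function.comp, Equiv.swap_apply_of_ne_of_ne hw.2.1 hw.1]
  rw [agreement, agreement, sum_split, sum_split, sum_rest]
  simp only [Function.comp, Equiv.swap_apply_left, Equiv.swap_apply_right]
  zify [Fin.le_def.1 hF.le, Fin.le_def.1 hg.le]
  ring

lemma Moves.agreement_add_le {U V : Fin n → Prop} {lo hi N : ℕ} {f g F : Fin n → Fin n} {S : ℝ}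
    (hm : Moves U V lo hi f g N S) (hF : ∀ x y, U x → V y → F y < F x) :
    agreement F f + N ≤ agreement F g := by
  induction hm with
  | refl => exact le_rfl
  | @step g N S x y _ hx hy _ hlt _ ih =>
    rw [agreement_comp_swap (hF x y hx hy) hlt]
    have : 0 < ((F x : ℕ) - F y) * (g y - g x) :=
      Nat.mul_pos (Nat.sub_pos_of_lt (hF x y hx hy)) (Nat.sub_pos_of_lt hlt)
    omega

/-! ### One side of a call -/

section Side

variable {n : ℕ} (E : Fin n → Fin n → Prop) (f g : Fin n → Fin n) (u v : Fin n)

/-- No out-neighbour of `u` precedes `v` in the order `g`. -/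
def NoOut : Prop := ∀ z, E u z → g v ≤ g z

/-- The list `A` contains all out-neighbours of `u` that precede `v` in the order `g`. -/
def Covers (A : List (Fin n)) : Prop := ∀ z, E u z → g z < g v → z ∈ A

/-- The properties of a list `A` found by the search for out-neighbours of `u` that precede `v`,
where `flag` tells that there are none and the search has cost `c`, up to a constant factor. A
positive cost is the square root of a distance that `A`, which then contains all those
out-neighbours, keeps from `u`. -/
structure OutInfo (A : List (Fin n)) (flag : Bool) (c : ℝ) : Prop where
  mem : ∀ w ∈ A, E u w ∧ g w < g v
  nil : A = [] → Covers E g u v A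
  charge : c = 0 ∨ (flag = false ∧ Covers E g u v A ∧
    ∃ τ : ℕ, c = √((τ : ℝ) + 1) ∧ (g u : ℕ) + τ < g v ∧ ∀ w ∈ A, (g u : ℕ) + τ < g w)

/-- The factor `α` at which a call with the given flag pays for its searches for out-neighbours. -/
structure OutRate (flag : Bool) (α : ℝ) : Prop where
  noOut : flag = true → NoOut E g u v
  cases : (flag = true ∧ α = 0) ∨ (NoOut E g u v ∧ α = 1) ∨ α = 2

/-- No in-neighbour of `v` succeeds `u`. As for all other notions for in-neighbours, this is the
notion for out-neighbours in the reversed graph with the reversed order. -/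
def NoIn : Prop := NoOut (Function.swap E) (Fin.rev ∘ g) v u

/-- The analogue of `OutInfo` for the in-neighbours of `v` that succeed `u`. -/
def InInfo (B : List (Fin n)) (flag : Bool) (c : ℝ) : Prop :=
  OutInfo (Function.swap E) (Fin.rev ∘ g) v u B flag c

/-- The analogue of `OutRate` for the in-neighbours of `v`. -/
def InRate (flag : Bool) (β : ℝ) : Prop := OutRate (Function.swap E) (Fin.rev ∘ g) v u flag β

/-- The factor `α` at which the calls with first argument `u` in the loops over a list `A` of
out-neighbours pay for their searches. -/
def CoverRate (A : List (Fin n)) (α : ℝ) : Prop :=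
  (A = [] ∧ α = 0) ∨ (Covers E g u v A ∧ α = 1) ∨ α = 2

/-- Swaps with total cost `S` lead from the order `f` to `g`. The share of those made by calls for
`u` is paid at the rate `α`, that of those made by calls for members of `A` at the rate `2`; the sum
is `C`. -/
def SideCost (A : List (Fin n)) (α S C : ℝ) : Prop :=
  ∃ SA SU : ℝ, SA + SU = S ∧ (A = [] → SA = 0) ∧ √|(g u : ℝ) - f u| ≤ SU ∧ C = 2 * SA + α * SU

/-- The swaps that a call for `u` and `v` makes: descendants of `u` pass ancestors of `v`. -/
abbrev CallMoves (N : ℕ) (S : ℝ) : Prop :=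
  Moves (ReflTransGen E u) (fun y => ReflTransGen E y v) (f u) (f v) f g N S

end Side

variable {n : ℕ} {E : Fin n → Fin n → Prop} {f g g' : Fin n → Fin n} {a b u v : Fin n}
  {A : List (Fin n)} {flag : Bool} {c α α' C S S' : ℝ} {lo hi N : ℕ}

lemma noOut_iff_covers_nil : NoOut E g u v ↔ Covers E g u v [] := by
  simp [NoOut, Covers]

lemma NoOut.lt (h : NoOut E g u v) (hinj : Function.Injective g) (huv : ¬ E u v) {z : Fin n}
    (hz : E u z) : g v < g z :=
  (h z hz).lt_of_ne fun hvz => huv (hinj hvz ▸ hz)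

lemma NoIn.lt (h : NoIn E g u v) (hinj : Function.Injective g) (huv : ¬ E u v) {z : Fin n}
    (hz : E z v) : g z < g u :=
  Fin.rev_lt_rev.1 (NoOut.lt h (Fin.rev_injective.comp hinj) huv hz)

lemma noOut_of_covers (hA : Covers E f u v A) (hinj : Function.Injective f) (huv : ¬ E u v)
    (hfix : ∀ z, f v < f z → g z = f z) (hb : g b ≤ f v) (hbA : ∀ z ∈ A, E u z → g b ≤ g z) :
    NoOut E g u b := by
  intro z hz
  by_cases hzA : z ∈ A
  · exact hbA z hzA hz
  · have hvz : f v < f z :=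
      (not_lt.1 fun h => hzA (hA z hz h)).lt_of_ne fun h => huv (hinj h ▸ hz)
    rw [hfix z hvz]
    exact hb.trans hvz.le

lemma CallMoves.reflect (hm : CallMoves E f g u v N S) :
    CallMoves (Function.swap E) (Fin.rev ∘ f) (Fin.rev ∘ g) v u N S :=
  hm.rev.mono (fun _ => Relation.reflTransGen_swap.2) (fun _ => Relation.reflTransGen_swap.2)
    (Fin.val_rev _).le (Fin.val_rev _).ge

lemma callMoves_comp_swap (huv : f u < f v) :
    CallMoves E f (f ∘ Equiv.swap u v) u v 1 (√((f v : ℝ) - f u)) := by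
  simpa using Moves.refl.step (U := ReflTransGen E u) (V := fun y => ReflTransGen E y v) .refl .refl
    le_rfl huv le_rfl

lemma not_reach_of_reach (huv : ¬ ReflTransGen E u v) (x : Fin n) (hx : ReflTransGen E u x) :
    ¬ ReflTransGen E x v :=
  fun hxv => huv (hx.trans hxv)

lemma reach_le {γ : Type*} [Preorder γ] {F : Fin n → γ} (hF : ∀ a b, E a b → F a < F b)
    (h : ReflTransGen E a b) : F a ≤ F b := by
  induction h with
  | refl => exact le_rfl
  | tail _ hbc ih => exact ih.trans (hF _ _ hbc).le

/-! ### The charges -/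

namespace OutInfo

lemma noOut (h : OutInfo E g u v [] flag c) : NoOut E g u v :=
  noOut_iff_covers_nil.2 (h.nil rfl)

lemma eq_nil (h : OutInfo E g u v A flag c) (hno : NoOut E g u v) : A = [] :=
  List.eq_nil_iff_forall_not_mem.2 fun w hw => (hno w (h.mem w hw).1).not_gt (h.mem w hw).2

lemma nonneg (h : OutInfo E g u v A flag c) : 0 ≤ c := by
  obtain h | ⟨-, -, τ, h, -⟩ := h.charge <;> rw [h]
  positivity

lemma of_forall_mem_iff (hA : ∀ w, w ∈ A ↔ E u w ∧ g w < g v) : OutInfo E g u v A flag 0 where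
  mem w := (hA w).1
  nil _ z hz hzv := (hA z).2 ⟨hz, hzv⟩
  charge := Or.inl rfl

lemma of_near {τ : ℕ} (hA : ∀ w, w ∈ A ↔ E u w ∧ (g w : ℕ) ≤ g u + τ ∧ g w < g v)
    (hne : A ≠ [] ∨ flag = true) (hflag : flag = true → NoOut E g u v) :
    OutInfo E g u v A flag 0 where
  mem w hw := ⟨((hA w).1 hw).1, ((hA w).1 hw).2.2⟩
  nil hnil := hnil ▸ noOut_iff_covers_nil.1 (hflag (hne.resolve_left (not_not.2 hnil)))
  charge := Or.inl rfl

lemma of_far {τ : ℕ} (hA : ∀ w, w ∈ A ↔ E u w ∧ g w < g v) (huv : (g u : ℕ) + τ < g v)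
    (hfar : ∀ w, E u w → g w < g v → (g u : ℕ) + τ < g w) :
    OutInfo E g u v A false (√((τ : ℝ) + 1)) where
  mem w := (hA w).1
  nil _ z hz hzv := (hA z).2 ⟨hz, hzv⟩
  charge := Or.inr ⟨rfl, fun z hz hzv => (hA z).2 ⟨hz, hzv⟩, τ, rfl, huv,
    fun w hw => hfar w ((hA w).1 hw).1 ((hA w).1 hw).2⟩

lemma charge_le_sqrt_sub (h : OutInfo E g u v A flag c) :
    c = 0 ∨ flag = false ∧ c ≤ √((g v : ℝ) - g u) := by
  obtain hc | ⟨hflag, -, τ, rfl, hτ, -⟩ := h.charge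
  · exact Or.inl hc
  · refine Or.inr ⟨hflag, Real.sqrt_le_sqrt ?_⟩
    have : (g u : ℝ) + τ + 1 ≤ g v := mod_cast hτ
    linarith

/-- All vertices that `u` can pass before it passes `v` are descendants of an out-neighbour. -/
lemma charge_le_sqrt_shift (h : OutInfo E g u v A flag c) (htopo : ∀ a b, E a b → g a < g b)
    (huv : ¬ ReflTransGen E u v) (hm : CallMoves E g g' u v N S) (hvu : g' v < g' u) :
    c ≤ √|(g' u : ℝ) - g u| := by
  obtain rfl | ⟨-, hcov, τ, rfl, hτv, hτA⟩ := h.charge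
  · positivity
  have hbeyond (x : Fin n) (hx : ReflTransGen E u x) (hxu : x ≠ u) : (g u : ℕ) + τ < g x := by
    obtain ⟨rfl⟩ | ⟨z, huz, hzx⟩ := hx.cases_head
    · exact absurd rfl hxu
    · refine lt_of_lt_of_le ?_ (Fin.le_def.1 (reach_le htopo hzx))
      by_cases hzv : g z < g v
      · exact hτA z (hcov z huz hzv)
      · exact hτv.trans_le (not_lt.1 hzv)
  have hτu : (g u : ℕ) + τ < g' u :=
    hm.mem_of_isUpperSet (not_reach_of_reach huv) (W := {x | (g u : ℕ) + τ < x})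
      (fun _ _ hxy hx => lt_of_lt_of_le hx (Fin.le_def.1 hxy)) .refl hbeyond .refl hτv hvu
  have : (g u : ℝ) + τ + 1 ≤ g' u := mod_cast hτu
  exact Real.sqrt_le_sqrt (le_trans (by linarith) (le_abs_self _))

/-- The search for out-neighbours is paid for by the upward moves of `u`. -/
lemma exists_coverRate (h : OutInfo E g u v A flag c) (htopo : ∀ a b, E a b → g a < g b)
    (huv : ¬ ReflTransGen E u v) (hα : OutRate E g u v flag α) :
    ∃ a, CoverRate E g u v A a ∧ ∀ {N : ℕ} {S C : ℝ} {g' : Fin n → Fin n},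
      CallMoves E g g' u v N S → g' v < g' u → SideCost g g' u A a S C → C + c ≤ α * S := by
  obtain ⟨hflag, rfl⟩ | ⟨hno, rfl⟩ | rfl := hα.cases
  · have hc : c = 0 := h.charge.resolve_right fun h => by simp [hflag] at h
    have hnil := h.eq_nil (hα.noOut hflag)
    refine ⟨0, Or.inl ⟨hnil, rfl⟩, ?_⟩
    rintro _ _ _ _ - - ⟨SA, SU, -, hSA, -, rfl⟩
    simp [hSA hnil, hc]
  · have hnil := h.eq_nil hno
    refine ⟨0, Or.inl ⟨hnil, rfl⟩, ?_⟩
    rintro _ _ _ _ hm hvu ⟨SA, SU, rfl, hSA, hSU, rfl⟩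
    linarith [h.charge_le_sqrt_shift htopo huv hm hvu, hSA hnil]
  · obtain hc | ⟨-, hcov, -⟩ := h.charge
    · refine ⟨2, Or.inr (Or.inr rfl), ?_⟩
      rintro _ _ _ _ - - ⟨SA, SU, rfl, -, -, rfl⟩
      linarith
    · refine ⟨1, Or.inr (Or.inl ⟨hcov, rfl⟩), ?_⟩
      rintro _ _ _ _ hm hvu ⟨SA, SU, rfl, -, hSU, rfl⟩
      linarith [h.charge_le_sqrt_shift htopo huv hm hvu]

end OutInfo

lemma OutRate.nonneg (h : OutRate E g u v flag α) : 0 ≤ α := by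
  obtain ⟨-, rfl⟩ | ⟨-, rfl⟩ | rfl := h.cases <;> norm_num

lemma OutRate.one_le (h : OutRate E g u v flag α) (hflag : flag = false) : 1 ≤ α := by
  obtain ⟨hflag', -⟩ | ⟨-, rfl⟩ | rfl := h.cases
  · simp [hflag] at hflag'
  · exact le_rfl
  · norm_num

lemma OutInfo.charge_le_rate (h : OutInfo E g u v A flag c) (hα : OutRate E g u v flag α) :
    c ≤ α * √((g v : ℝ) - g u) := by
  obtain rfl | ⟨hflag, hc⟩ := h.charge_le_sqrt_sub
  · have := hα.nonneg
    positivity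
  · exact hc.trans (le_mul_of_one_le_left (Real.sqrt_nonneg _) (hα.one_le hflag))

lemma InInfo.charge_le_rate (h : InInfo E g u v A flag c) (hα : InRate E g u v flag α) :
    c ≤ α * √((g v : ℝ) - g u) := by
  have val_rev (a : Fin n) : ((Fin.rev a : ℕ) : ℝ) = n - (a + 1) := by
    rw [Fin.val_rev, Nat.cast_sub (by omega)]
    norm_cast
  convert OutInfo.charge_le_rate h hα using 3
  simp only [Function.comp_apply, val_rev]
  ring

lemma CoverRate.exists_outRate (hα : CoverRate E f u v A α) (hnil : A = [] → Covers E f u v A)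
    (hno : a = u → Covers E f u v A → NoOut E g u b) :
    ∃ α', OutRate E g a b (decide (a = u ∧ A = [])) α' ∧ (α' = α ∨ a ≠ u ∧ α' = 2) := by
  have hflag : decide (a = u ∧ A = []) = true → NoOut E g a b := fun h => by
    obtain ⟨rfl, hA⟩ := of_decide_eq_true h
    exact hno rfl (hnil hA)
  by_cases hau : a = u
  · subst hau
    refine ⟨α, ⟨hflag, ?_⟩, Or.inl rfl⟩
    exact hα.imp (fun h => ⟨by simp [h.1], h.2⟩) (Or.imp_left fun h => ⟨hno rfl h.1, h.2⟩)
  · exact ⟨2, ⟨hflag, Or.inr (Or.inr rfl)⟩, Or.inr ⟨hau, rfl⟩⟩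

namespace SideCost

lemma refl (f : Fin n → Fin n) (u : Fin n) (A : List (Fin n)) (α : ℝ) :
    SideCost f f u A α 0 0 :=
  ⟨0, 0, by simp⟩

lemma step {U V : Fin n → Prop} (h : SideCost f g u A α S C) (hm : Moves U V lo hi g g' N S')
    (hα' : α' = α ∨ A ≠ [] ∧ g' u = g u ∧ α' = 2) :
    SideCost f g' u A α (S + S') (C + α' * S') := by
  obtain ⟨SA, SU, rfl, hnil, hSU, rfl⟩ := h
  obtain rfl | ⟨hA, hfix, rfl⟩ := hα'
  · refine ⟨SA, SU + S', by ring, hnil, ?_, by ring⟩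
    linarith [sqrt_abs_sub_le (g' u) (g u) (f u), hm.sqrt_le u]
  · exact ⟨SA + S', SU, by ring, fun h => absurd h hA, by rwa [hfix], by ring⟩

end SideCost

/-! ### The search for neighbours -/

section Search

variable {n p : ℕ} {t : ℕ → ℕ} {θ : ℝ}

/-- The properties of the thresholds that the analysis uses: the thresholds up to level `0` are paid
for by `θ`, and a counting sort at level `i + 1` is paid for by `θ` times the square root of a
distance greater than `t i`. -/
structure Thresholds (n p : ℕ) (t : ℕ → ℕ) (θ : ℝ) : Prop where
  one_le : 1 ≤ θ
  zero_le : (t 0 : ℝ) ≤ θ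
  succ_le : ∀ i ≤ p, (t (i + 1) : ℝ) ≤ θ * √((t i : ℝ) + 1)
  top_le : n ≤ t (p + 1)
  sqrt_le : √(n : ℝ) ≤ θ

lemma Thresholds.sort_le (hθ : Thresholds n p t θ) {i T : ℕ} (hi : i ≤ p)
    (hT : T ≤ 11 * (t (i + 1) + 1)) : (T : ℝ) ≤ 22 * θ * √((t i : ℝ) + 1) := by
  have hT' : (T : ℝ) ≤ 11 * (t (i + 1) + 1) := mod_cast hT
  have hsqrt : 1 ≤ √((t i : ℝ) + 1) := Real.one_le_sqrt.2 (by simp)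
  nlinarith [hθ.succ_le i hi, hθ.one_le]

/-- The part of `reorder` that replaces the list `A₀` of near out-neighbours, if it has to. -/
def chooseOut (t : ℕ → ℕ) (flag : Bool) (u v : Fin n) (i : ℕ) (A₀ : List (Fin n)) :
    Prog n (List (Fin n)) :=
  if A₀ ≠ [] ∨ flag = true then pure A₀ else hatA t false u v (i + 1)

/-- The part of `reorder` that replaces the list `B₀` of near in-neighbours, if it has to. -/
def chooseIn (t : ℕ → ℕ) (flag : Bool) (u v : Fin n) (i : ℕ) (B₀ : List (Fin n)) :
    Prog n (List (Fin n)) :=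
  if B₀ ≠ [] ∨ flag = true then pure B₀ else hatB t false u v (i + 1)

/-- The part of `reorder` that determines `A` and `B`, for the distance `d` of `u` and `v`. -/
def neighbourLists (p : ℕ) (t : ℕ → ℕ) (u v : Fin n) (f₁ f₂ : Bool) (d : ℕ) :
    Prog n (List (Fin n) × List (Fin n)) := do
  match ← findLevel p t d with
  | some i => do
    let A₀ ← hatA t true u v i
    let B₀ ← hatB t true u v i
    let A ← chooseOut t f₁ u v i A₀
    let B ← chooseIn t f₂ u v i B₀
    pure (A, B)
  | none => do
    let A ← hatA t false u v 0
    let B ← hatB t false u v 0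
    pure (A, B)

/-- The part of `reorder` that follows once `A` and `B` have been determined. -/
def reorderBody (p : ℕ) (t : ℕ → ℕ) (depth : ℕ) (u v : Fin n) (A B : List (Fin n)) :
    Prog n Unit := do
  if A = [] ∧ B = [] then swap p t u v
  else
    let pairs := loopPairs (← get).pos u v A B
    tick (pairs.length + A.length + B.length + 1)
    pairs.forM fun q =>
      reorder p t depth q.1 q.2 (decide (q.1 = u ∧ A = [])) (decide (q.2 = v ∧ B = []))

variable {s : Store n} {u v : Fin n} {f₁ f₂ : Bool}

lemma ends_reorder_succ {depth : ℕ} (huv : s.pos u < s.pos v) {Q : Unit → Store n → Prop}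
    (h : Ends (neighbourLists p t u v f₁ f₂ (s.pos v - s.pos u)) { s with time := s.time + 3 }
      fun AB s' => Ends (reorderBody p t depth u v AB.1 AB.2) s' Q) :
    Ends (reorder p t (depth + 1) u v f₁ f₂) s Q := by
  simp only [reorder, ends_bind, ends_getPos, ends_tick]
  rw [if_neg (not_le.2 (Fin.lt_def.1 huv))]
  simp only [neighbourLists, ends_bind] at h ⊢
  refine Ends.mono h fun level s' h' => ?_
  cases level with
  | none => simpa only [ends_bind, ends_pure, reorderBody] using h'
  | some i =>
    simp only [ends_bind, ends_pure] at h' ⊢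
    refine Ends.mono h' fun A₀ _ hA₀ => Ends.mono hA₀ fun B₀ _ hB₀ => ?_
    simp only [chooseOut, chooseIn] at hB₀
    split_ifs at hB₀ ⊢ <;> simpa only [ends_bind, ends_pure, reorderBody] using hB₀

section Choose

variable {i : ℕ} {flag : Bool}

lemma rev_le_rev_add {a b : Fin n} {τ : ℕ} : (Fin.rev a : ℕ) ≤ Fin.rev b + τ ↔ (b : ℕ) ≤ a + τ := by
  simp only [Fin.val_rev]
  omega

lemma rev_add_lt_rev {a b : Fin n} {τ : ℕ} : (Fin.rev a : ℕ) + τ < Fin.rev b ↔ (b : ℕ) + τ < a := by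
  simpa only [not_le] using rev_le_rev_add.not

lemma Consistent.ends_chooseOut (h : Consistent p t s) (hθ : Thresholds n p t θ) (hi : i ≤ p)
    (hnear : (s.pos u : ℕ) + t i < s.pos v) (hfar : (s.pos v : ℕ) ≤ s.pos u + t (i + 1))
    (hflag : flag = true → NoOut s.Edge s.pos u v) {A₀ : List (Fin n)}
    (hA₀ : IsSorting s.pos (fun w => s.Close t i u w ∧ s.pos w < s.pos v) A₀) :
    Ends (chooseOut t flag u v i A₀) s fun A s' => ∃ (T : ℕ) (c : ℝ), Later s T s' ∧
      (T : ℝ) ≤ 22 * θ * c ∧ A₀.length ≤ A.length ∧ A.Pairwise (s.pos · < s.pos ·) ∧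
      OutInfo s.Edge s.pos u v A flag c := by
  have hmem (w : Fin n) := (hA₀.mem_iff w).trans and_assoc
  unfold chooseOut
  split_ifs with hkeep
  · exact ends_pure.2 ⟨0, 0, .refl s, by simp, le_rfl, hA₀.sorted, .of_near hmem hkeep hflag⟩
  · obtain ⟨rfl, hflag'⟩ : A₀ = [] ∧ flag = false := by simpa using hkeep
    subst hflag'
    refine (h.ends_hatA (cmp := false) (i := i + 1) (by omega) (by simp)).mono
      fun A s' ⟨hA, hlater⟩ => ⟨_, _, hlater, hθ.sort_le hi le_rfl, by simp, hA.sorted,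
        .of_far (fun w => ?_) hnear fun w huw hwv => ?_⟩
    · refine (hA.mem_iff w).trans ⟨fun hw => ⟨hw.1.1, hw.2⟩, fun hw => ⟨⟨hw.1, ?_⟩, hw.2⟩⟩
      exact (Fin.lt_def.1 hw.2).le.trans hfar
    · exact not_le.1 fun hle => List.not_mem_nil ((hmem w).2 ⟨huw, hle, hwv⟩)

lemma Consistent.ends_chooseIn (h : Consistent p t s) (hθ : Thresholds n p t θ) (hi : i ≤ p)
    (hnear : (s.pos u : ℕ) + t i < s.pos v) (hfar : (s.pos v : ℕ) ≤ s.pos u + t (i + 1))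
    (hflag : flag = true → NoIn s.Edge s.pos u v) {B₀ : List (Fin n)}
    (hB₀ : IsSorting s.pos (fun w => s.Close t i w v ∧ s.pos u < s.pos w) B₀) :
    Ends (chooseIn t flag u v i B₀) s fun B s' => ∃ (T : ℕ) (c : ℝ), Later s T s' ∧
      (T : ℝ) ≤ 22 * θ * c ∧ B₀.length ≤ B.length ∧ B.Pairwise (s.pos · < s.pos ·) ∧
      InInfo s.Edge s.pos u v B flag c := by
  have hmem (w : Fin n) : w ∈ B₀ ↔ s.Edge w v ∧
      (Fin.rev (s.pos w) : ℕ) ≤ Fin.rev (s.pos v) + t i ∧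
      Fin.rev (s.pos w) < Fin.rev (s.pos u) := by
    rw [hB₀.mem_iff, Store.Close, and_assoc, Fin.rev_lt_rev, rev_le_rev_add]
  unfold chooseIn
  split_ifs with hkeep
  · exact ends_pure.2 ⟨0, 0, .refl s, by simp, le_rfl, hB₀.sorted, .of_near hmem hkeep hflag⟩
  · obtain ⟨rfl, hflag'⟩ : B₀ = [] ∧ flag = false := by simpa using hkeep
    subst hflag'
    refine (h.ends_hatB (cmp := false) (i := i + 1) (by omega) (by simp)).mono
      fun B s' ⟨hB, hlater⟩ => ⟨_, _, hlater, hθ.sort_le hi le_rfl, by simp, hB.sorted,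
        .of_far (fun w => ?_) (rev_add_lt_rev.2 hnear) fun w hwv huw => ?_⟩
    · refine (hB.mem_iff w).trans ⟨fun hw => ⟨hw.1.1, Fin.rev_lt_rev.2 hw.2⟩,
        fun hw => ⟨⟨hw.1, ?_⟩, Fin.rev_lt_rev.1 hw.2⟩⟩
      have := Fin.lt_def.1 (Fin.rev_lt_rev.1 hw.2)
      omega
    · exact not_le.1 fun hle => List.not_mem_nil ((hmem w).2 ⟨hwv, hle, huw⟩)

end Choose

/-- The lists found by the search of a call for `u` and `v`, at the cost `c₁` for the out-neighbours
of `u` and `c₂` for the in-neighbours of `v`. -/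
structure Neighbours (E : Fin n → Fin n → Prop) (g : Fin n → Fin n) (u v : Fin n)
    (A B : List (Fin n)) (f₁ f₂ : Bool) (c₁ c₂ : ℝ) : Prop where
  sorted_left : A.Pairwise (g · < g ·)
  sorted_right : B.Pairwise (g · < g ·)
  out : OutInfo E g u v A f₁ c₁
  inn : InInfo E g u v B f₂ c₂

lemma Consistent.ends_nearestLists (h : Consistent p t s) (hθ : Thresholds n p t θ)
    (hnear : (s.pos v : ℕ) ≤ s.pos u + t 0) :
    Ends (hatA t false u v 0 >>= fun A => hatB t false u v 0 >>= fun B => pure (A, B)) s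
      fun AB s' => ∃ T : ℕ, Later s T s' ∧ (T : ℝ) ≤ 44 * θ ∧
        Neighbours s.Edge s.pos u v AB.1 AB.2 f₁ f₂ 0 0 := by
  simp only [ends_bind, ends_pure]
  refine (h.ends_hatA (cmp := false) (i := 0) (by omega) (by simp)).mono fun A s₁ ⟨hA, hs₁⟩ => ?_
  obtain ⟨k, -, rfl⟩ := id hs₁
  refine ((hs₁.consistent h).ends_hatB (cmp := false) (i := 0) (by omega) (by simp)).mono
    fun B s₂ ⟨hB, hs₂⟩ => ⟨_, hs₁.trans hs₂, ?_, hA.sorted, hB.sorted,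
      .of_forall_mem_iff fun w => (hA.mem_iff w).trans ?_,
      .of_forall_mem_iff fun w => (hB.mem_iff w).trans ?_⟩
  · have := hθ.zero_le
    have := hθ.one_le
    push_cast [Bool.false_eq_true, if_false]
    linarith
  · refine ⟨fun hw => ⟨hw.1.1, hw.2⟩, fun hw => ⟨⟨hw.1, ?_⟩, hw.2⟩⟩
    exact (Fin.lt_def.1 hw.2).le.trans hnear
  · refine ⟨fun hw => ⟨hw.1.1, Fin.rev_lt_rev.2 hw.2⟩,
      fun hw => ⟨⟨hw.1, ?_⟩, Fin.rev_lt_rev.1 hw.2⟩⟩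
    exact hnear.trans (Nat.add_le_add_right (Fin.lt_def.1 (Fin.rev_lt_rev.1 hw.2)).le _)

lemma Consistent.ends_levelLists (h : Consistent p t s) (hθ : Thresholds n p t θ) {i : ℕ}
    (hi : i ≤ p) (hnear : (s.pos u : ℕ) + t i < s.pos v)
    (hfar : (s.pos v : ℕ) ≤ s.pos u + t (i + 1))
    (h₁ : f₁ = true → NoOut s.Edge s.pos u v) (h₂ : f₂ = true → NoIn s.Edge s.pos u v) :
    Ends (hatA t true u v i >>= fun A₀ => hatB t true u v i >>= fun B₀ =>
        chooseOut t f₁ u v i A₀ >>= fun A => chooseIn t f₂ u v i B₀ >>= fun B => pure (A, B)) s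
      fun AB s' => ∃ (T : ℕ) (c₁ c₂ : ℝ), Later s T s' ∧
        (T : ℝ) ≤ 6 * logBound n * (AB.1.length + AB.2.length + 2) + 22 * θ * (c₁ + c₂) ∧
        Neighbours s.Edge s.pos u v AB.1 AB.2 f₁ f₂ c₁ c₂ := by
  simp only [ends_bind, ends_pure]
  refine (h.ends_hatA (i := i) (by omega) fun _ => hnear).mono fun A₀ s₁ ⟨hA₀, hs₁⟩ => ?_
  obtain ⟨k₁, -, rfl⟩ := id hs₁
  refine ((hs₁.consistent h).ends_hatB (i := i) (by omega) fun _ => hnear).mono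
    fun B₀ s₂ ⟨hB₀, hs₂⟩ => ?_
  have hs₂ := hs₁.trans hs₂
  obtain ⟨k₂, -, rfl⟩ := id hs₂
  refine ((hs₂.consistent h).ends_chooseOut hθ hi hnear hfar h₁ hA₀).mono
    fun A s₃ ⟨T₁, c₁, hs₃, hT₁, hA, hAsort, hAinfo⟩ => ?_
  have hs₃ := hs₂.trans hs₃
  obtain ⟨k₃, -, rfl⟩ := id hs₃
  refine ((hs₃.consistent h).ends_chooseIn hθ hi hnear hfar h₂ hB₀).mono
    fun B s₄ ⟨T₂, c₂, hs₄, hT₂, hB, hBsort, hBinfo⟩ =>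
      ⟨_, c₁, c₂, hs₃.trans hs₄, ?_, hAsort, hBsort, hAinfo, hBinfo⟩
  have hlen : (6 * logBound n * (A₀.length + B₀.length + 2) : ℝ) ≤
      6 * logBound n * (A.length + B.length + 2) := by gcongr
  rw [if_pos rfl, if_pos rfl]
  push_cast
  linarith

lemma Consistent.ends_neighbourLists (h : Consistent p t s) (hθ : Thresholds n p t θ)
    (h₁ : f₁ = true → NoOut s.Edge s.pos u v) (h₂ : f₂ = true → NoIn s.Edge s.pos u v) :
    Ends (neighbourLists p t u v f₁ f₂ (s.pos v - s.pos u)) s fun AB s' =>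
      ∃ (T : ℕ) (c₁ c₂ : ℝ), Later s T s' ∧
        (T : ℝ) ≤ p + 1 + 44 * θ + 6 * logBound n * (AB.1.length + AB.2.length + 2) +
          22 * θ * (c₁ + c₂) ∧
        Neighbours s.Edge s.pos u v AB.1 AB.2 f₁ f₂ c₁ c₂ := by
  have hθ₀ := hθ.one_le
  have hdist : (s.pos v - s.pos u : ℕ) ≤ t (p + 1) :=
    (Nat.sub_le ..).trans ((s.pos v).2.le.trans hθ.top_le)
  rw [neighbourLists, ends_bind]
  refine (ends_findLevel hdist).mono fun level s₀ ⟨hs₀, hlevel⟩ => ?_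
  obtain ⟨k, -, rfl⟩ := id hs₀
  cases level with
  | none =>
    refine ((hs₀.consistent h).ends_nearestLists hθ (by simpa [add_comm] using hlevel)).mono
      fun AB s' ⟨T, hs', hT, hAB⟩ => ⟨_, 0, 0, hs₀.trans hs', ?_, hAB⟩
    have : (0 : ℝ) ≤ 6 * logBound n * (AB.1.length + AB.2.length + 2) := by positivity
    push_cast
    linarith
  | some i =>
    obtain ⟨hi, hnear, hfar⟩ := hlevel
    refine ((hs₀.consistent h).ends_levelLists hθ (Nat.lt_succ_iff.1 hi)
      (Nat.add_lt_of_lt_sub' hnear) (Nat.sub_le_iff_le_add'.1 hfar) h₁ h₂).mono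
      fun AB s' ⟨T, c₁, c₂, hs', hT, hAB⟩ => ⟨_, c₁, c₂, hs₀.trans hs', ?_, hAB⟩
    push_cast
    linarith

end Search

/-! ### The loops -/

section LoopInv

variable {n l r N : ℕ} {X Y U V : Fin n → Prop} {g g' : Fin n → Fin n} {a b : Fin n} {S : ℝ}
  {q : Fin n × Fin n} {qs : List (Fin n × Fin n)}

/-- The invariant of the two nested loops over the vertices satisfying `X` and `Y`, where `qs` is
the list of the pairs that remain to be treated and `g` is the current order. -/
structure LoopInv (X Y : Fin n → Prop) (g : Fin n → Fin n) (qs : List (Fin n × Fin n)) : Prop where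
  flipped : ∀ x y, X x → Y y → (x, y) ∈ qs ∨ g y < g x
  mem : ∀ q ∈ qs, X q.1 ∧ Y q.2 ∧ g q.1 < g q.2
  sorted : qs.Pairwise fun q q' => (q'.1 = q.1 ∧ g q.2 < g q'.2) ∨ g q'.1 < g q.1

lemma loopInv_loopPairs {u v : Fin n} {A B : List (Fin n)} (hinj : Function.Injective g)
    (hA : (u :: A).Pairwise (g · < g ·)) (hB : (B ++ [v]).Pairwise (g · < g ·))
    (hne : ∀ x y, x = u ∨ x ∈ A → y ∈ B ∨ y = v → x ≠ y) :
    LoopInv (fun x => x = u ∨ x ∈ A) (fun y => y ∈ B ∨ y = v) g (loopPairs g u v A B) where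
  flipped x y hx hy := (hinj.ne (hne x y hx hy)).lt_or_gt.imp_left fun hxy =>
    (mem_loopPairs hB).2 ⟨hx, hy, hxy⟩
  mem _ hq := (mem_loopPairs hB).1 hq
  sorted := pairwise_loopPairs hA hB

namespace LoopInv

lemma lt_of_lt_left (h : LoopInv X Y g ((a, b) :: qs)) {x : Fin n} (hx : X x) (hax : g a < g x) :
    g b < g x := by
  obtain hmem | hlt := h.flipped x b hx (h.mem _ List.mem_cons_self).2.1
  · obtain heq | hmem := List.mem_cons.1 hmem
    · exact absurd hax (congrArg g (Prod.mk.inj heq).1).le.not_gt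
    · obtain ⟨-, hlt⟩ | hlt := (List.pairwise_cons.1 h.sorted).1 _ hmem
      · exact absurd hlt (lt_irrefl _)
      · exact absurd hlt hax.not_gt
  · exact hlt

lemma lt_of_lt_right (h : LoopInv X Y g ((a, b) :: qs)) {y : Fin n} (hy : Y y) (hyb : g y < g b) :
    g y < g a := by
  obtain hmem | hlt := h.flipped a y (h.mem _ List.mem_cons_self).1 hy
  · obtain heq | hmem := List.mem_cons.1 hmem
    · exact absurd hyb (congrArg g (Prod.mk.inj heq).2).ge.not_gt
    · obtain ⟨-, hlt⟩ | hlt := (List.pairwise_cons.1 h.sorted).1 _ hmem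
      · exact absurd hlt hyb.not_gt
      · exact absurd hlt (lt_irrefl _)
  · exact hlt

lemma sub_lt_sub (h : LoopInv X Y g ((a, b) :: q :: qs)) (hX : ∀ x, X x → l ≤ g x)
    (hY : ∀ y, Y y → g y ≤ r) : (g b - g a : ℕ) < r - l := by
  obtain ⟨hXa, hYb, hab⟩ : X a ∧ Y b ∧ g a < g b := h.mem (a, b) List.mem_cons_self
  obtain ⟨hXq, hYq, -⟩ := h.mem q (by simp)
  have hlt : g b < g q.2 ∨ g q.1 < g a :=
    ((List.pairwise_cons.1 h.sorted).1 q List.mem_cons_self).imp_left And.right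
  have := hX a hXa
  have := hY b hYb
  have := hX _ hXq
  have := hY _ hYq
  rw [Fin.lt_def] at hab
  rw [Fin.lt_def, Fin.lt_def] at hlt
  omega

lemma tail (h : LoopInv X Y g ((a, b) :: qs)) (hm : Moves U V (g a) (g b) g g' N S)
    (hUV : ∀ x, U x → ¬ V x) (hX : ∀ x, X x → U x) (hY : ∀ y, Y y → V y) (hab : g' b < g' a) :
    LoopInv X Y g' qs := by
  obtain ⟨hXa, hYb, hgab⟩ := h.mem (a, b) List.mem_cons_self
  obtain ⟨hhead, htail⟩ := List.pairwise_cons.1 h.sorted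
  have hmem (q) (hq : q ∈ qs) := h.mem q (List.mem_cons_of_mem _ hq)
  refine ⟨fun x y hx hy => ?_, fun q hq => ⟨(hmem q hq).1, (hmem q hq).2.1, ?_⟩,
    htail.imp_of_mem fun {q q'} hq _ hqq' => ?_⟩
  · obtain hxy | hlt := h.flipped x y hx hy
    · obtain heq | hxy := List.mem_cons.1 hxy
      · obtain ⟨rfl, rfl⟩ := Prod.mk.inj heq
        exact Or.inr hab
      · exact Or.inl hxy
    · exact Or.inr ((hm.down hUV (hY y hy)).trans_lt (hlt.trans_le (hm.up hUV (hX x hx))))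
  · obtain ⟨heq, hlt⟩ | hlt := hhead q hq
    · exact hm.lt_of_lt_right hlt (heq ▸ hgab.trans hlt)
    · exact hm.lt_of_lt_left hlt (hmem q hq).2.2
  · obtain ⟨heq, hlt⟩ | hlt := hqq'
    · refine Or.inl ⟨heq, ?_⟩
      by_cases hbq' : g b < g q'.2
      · exact hm.lt_of_lt_right hbq' hlt
      · exact hm.lt_of_lt_left (h.lt_of_lt_right (hmem q hq).2.1 (hlt.trans_le (not_lt.1 hbq'))) hlt
    · refine Or.inr (hm.lt_of_lt_left (hlt.trans_le ?_) hlt)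
      exact (hhead q hq).elim (fun heq => (congrArg g heq.1).le) le_of_lt

end LoopInv

end LoopInv

section LoopLists

variable {n : ℕ} {E : Fin n → Fin n → Prop} {f g : Fin n → Fin n} {a b u v x y : Fin n}
  {A B : List (Fin n)} {α C S : ℝ} {N : ℕ}

/-- The properties of the lists `A` and `B` over which a call for `u` and `v` loops, where `f` is
the order at the start of the call. -/
structure LoopLists (E : Fin n → Fin n → Prop) (f : Fin n → Fin n) (u v : Fin n)
    (A B : List (Fin n)) : Prop where
  topo : ∀ a b, E a b → f a < f b
  inj : Function.Injective f
  not_reach : ¬ ReflTransGen E u v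
  lt : f u < f v
  mem_left : ∀ w ∈ A, E u w ∧ f w < f v
  mem_right : ∀ w ∈ B, E w v ∧ f u < f w
  nil_left : A = [] → Covers E f u v A
  nil_right : B = [] → Covers (Function.swap E) (Fin.rev ∘ f) v u B

namespace LoopLists

lemma reflect (h : LoopLists E f u v A B) :
    LoopLists (Function.swap E) (Fin.rev ∘ f) v u B A where
  topo a b hab := Fin.rev_lt_rev.2 (h.topo b a hab)
  inj := Fin.rev_injective.comp h.inj
  not_reach := fun hvu => h.not_reach (Relation.reflTransGen_swap.1 hvu)
  lt := Fin.rev_lt_rev.2 h.lt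
  mem_left w hw := (h.mem_right w hw).imp_right Fin.rev_lt_rev.2
  mem_right w hw := (h.mem_left w hw).imp_right Fin.rev_lt_rev.2
  nil_left := h.nil_right
  nil_right hA z hz hzv := h.nil_left hA z hz (by simpa using hzv)

lemma reach_left (h : LoopLists E f u v A B) (hx : x = u ∨ x ∈ A) : ReflTransGen E u x := by
  obtain rfl | hx := hx
  · exact .refl
  · exact .single (h.mem_left x hx).1

lemma reach_right (h : LoopLists E f u v A B) (hy : y ∈ B ∨ y = v) : ReflTransGen E y v :=
  Relation.reflTransGen_swap.1 (h.reflect.reach_left hy.symm)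

lemma range_left (h : LoopLists E f u v A B) (hx : x = u ∨ x ∈ A) : f u ≤ f x ∧ f x ≤ f v := by
  obtain rfl | hx := hx
  · exact ⟨le_rfl, h.lt.le⟩
  · exact ⟨(h.topo u x (h.mem_left x hx).1).le, (h.mem_left x hx).2.le⟩

lemma range_right (h : LoopLists E f u v A B) (hy : y ∈ B ∨ y = v) : f u ≤ f y ∧ f y ≤ f v :=
  (h.reflect.range_left hy.symm).symm.imp Fin.rev_le_rev.1 Fin.rev_le_rev.1

lemma pairwise_left (h : LoopLists E f u v A B) (hA : A.Pairwise (f · < f ·)) :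
    (u :: A).Pairwise (f · < f ·) :=
  List.pairwise_cons.2 ⟨fun w hw => h.topo u w (h.mem_left w hw).1, hA⟩

lemma pairwise_right (h : LoopLists E f u v A B) (hB : B.Pairwise (f · < f ·)) :
    (B ++ [v]).Pairwise (f · < f ·) :=
  List.pairwise_append.2 ⟨hB, List.pairwise_singleton _ _, fun w hw _ hz =>
    List.mem_singleton.1 hz ▸ h.topo w v (h.mem_right w hw).1⟩

/-- A call for `a ≠ u` does not move `u`, which is not a descendant of `a`. -/
lemma exists_outRate (h : LoopLists E f u v A B) (hα : CoverRate E f u v A α)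
    (hm : CallMoves E f g u v N S) (htopo : ∀ x y, E x y → g x < g y)
    (hC : SideCost f g u A α S C) (ha : a = u ∨ a ∈ A) (hb : b ∈ B ∨ b = v)
    (hbA : ∀ z, z = u ∨ z ∈ A → g a < g z → g b < g z) :
    ∃ α', OutRate E g a b (decide (a = u ∧ A = [])) α' ∧
      ∀ {g' : Fin n → Fin n} {N' : ℕ} {S' : ℝ}, CallMoves E g g' a b N' S' →
        SideCost f g' u A α (S + S') (C + α' * S') := by
  obtain ⟨α', hα', hαα'⟩ := hα.exists_outRate (a := a) h.nil_left fun hau hcov =>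
    noOut_of_covers hcov h.inj (fun huv => h.not_reach (.single huv))
      (fun z hz => hm.outside (Or.inr hz)) (hm.inside (h.range_right hb)).2
      fun z hz huz => (hbA z (Or.inr hz) (hau ▸ htopo u z huz)).le
  refine ⟨α', hα', fun hm' => hC.step hm' (hαα'.imp_right fun ⟨hau, hα'⟩ => ?_)⟩
  have haA := ha.resolve_left hau
  exact ⟨List.ne_nil_of_mem haA, hm'.outside (Or.inl (htopo u a (h.mem_left a haA).1)), hα'⟩

end LoopLists

end LoopLists

/-! ### The recursion -/

lemma Store.edge_congr {n : ℕ} {s s' : Store n} (h : s'.outList = s.outList) :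
    s'.Edge = s.Edge := by
  funext a b
  simp only [Store.Edge, h]

/-- A bound on the depth of the recursion of a call for `u` and `v` in the order `g`, where `F` is
the order that the final order shall agree with. -/
def callRank {n : ℕ} (F g : Fin n → Fin n) (u v : Fin n) : ℕ :=
  (n * (n * n) - agreement F g) * (n + 1) + (g v - g u)

lemma callRank_lt {n N : ℕ} {F g g' : Fin n → Fin n} {u v a b : Fin n}
    (h : agreement F g + N ≤ agreement F g') (hN : N = 0 → (g' b : ℕ) - g' a < g v - g u) :
    callRank F g' a b < callRank F g u v := by
  have hmono : n * (n * n) - agreement F g' ≤ n * (n * n) - agreement F g := by omega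
  rw [callRank, callRank]
  obtain rfl | hpos := N.eq_zero_or_pos
  · exact add_lt_add_of_le_of_lt (Nat.mul_le_mul_right _ hmono) (hN rfl)
  · have := agreement_le F g'
    have hlt : n * (n * n) - agreement F g' + 1 ≤ n * (n * n) - agreement F g := by omega
    have hmul := Nat.mul_le_mul_right (n + 1) hlt
    have := (g' b).2
    rw [add_mul] at hmul
    omega

section Recursion

variable {n p : ℕ} {t : ℕ → ℕ} {κ : ℝ} {F : Fin n → Fin n} {s₀ s s' : Store n} {a b u v : Fin n}
  {A B : List (Fin n)} {qs : List (Fin n × Fin n)} {α β α' β' S S' C D : ℝ} {depth len N N' : ℕ}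

/-- A call for `u` and `v` that pays for its searches at the total rate `γ` leads from `s` to `s'`
by `N` swaps of total cost `S`. Of the `3 * N` units of time paid for the swaps two are left over,
for the loops of the parent call. -/
structure Reordered (p : ℕ) (t : ℕ → ℕ) (κ : ℝ) (u v : Fin n) (γ : ℝ) (s s' : Store n)
    (N : ℕ) (S : ℝ) : Prop where
  consistent : Consistent p t s'
  outList : s'.outList = s.outList
  moves : CallMoves s.Edge s.pos s'.pos u v N S
  one_le : 1 ≤ N
  flipped : s'.pos v < s'.pos u
  time : (s'.time : ℝ) ≤ s.time + κ * (3 * N - 2 + γ * S)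

/-- The calls whose rank is less than `depth` behave as intended. -/
def ReorderSpec (p : ℕ) (t : ℕ → ℕ) (κ : ℝ) (F : Fin n → Fin n) (depth : ℕ) : Prop :=
  ∀ ⦃s : Store n⦄ ⦃u v : Fin n⦄ ⦃f₁ f₂ : Bool⦄ ⦃α β : ℝ⦄, Consistent p t s →
    (∀ a b, s.Edge a b → F a < F b) → F v < F u → s.pos u < s.pos v →
    OutRate s.Edge s.pos u v f₁ α → InRate s.Edge s.pos u v f₂ β → callRank F s.pos u v < depth →
    Ends (reorder p t depth u v f₁ f₂) s fun _ s' =>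
      ∃ N S, Reordered p t κ u v (α + β + 1) s s' N S

/-- The state of the loops of a call for `u` and `v`, which start in `s₀` with a list of length
`len`, when the pairs `qs` remain to be treated. The calls made so far have made `N` swaps of total
cost `S`, and `C` and `D` are the amounts that they have paid for their searches for out- and
in-neighbours. -/
structure LoopState (p : ℕ) (t : ℕ → ℕ) (κ : ℝ) (s₀ : Store n) (u v : Fin n) (A B : List (Fin n))
    (α β : ℝ) (len : ℕ) (qs : List (Fin n × Fin n)) (s : Store n) (N : ℕ) (S C D : ℝ) : Prop where
  consistent : Consistent p t s
  outList : s.outList = s₀.outList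
  moves : CallMoves s₀.Edge s₀.pos s.pos u v N S
  count : len ≤ N + qs.length
  inv : LoopInv (fun x => x = u ∨ x ∈ A) (fun y => y ∈ B ∨ y = v) s.pos qs
  out : SideCost s₀.pos s.pos u A α S C
  inn : SideCost (Fin.rev ∘ s₀.pos) (Fin.rev ∘ s.pos) v B β S D
  time : (s.time : ℝ) ≤ s₀.time + κ * (3 * N - 2 * (len - qs.length) + C + D + S)

namespace LoopState

lemma start (h : Consistent p t s₀)
    (hinv : LoopInv (fun x => x = u ∨ x ∈ A) (fun y => y ∈ B ∨ y = v) s₀.pos qs) :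
    LoopState p t κ s₀ u v A B α β qs.length qs s₀ 0 0 0 0 where
  consistent := h
  outList := rfl
  moves := .refl
  count := by simp
  inv := hinv
  out := .refl ..
  inn := .refl ..
  time := by simp

lemma callRank_lt (h : LoopState p t κ s₀ u v A B α β len ((a, b) :: qs) s N S C D)
    (hl : LoopLists s₀.Edge s₀.pos u v A B) (hF : ∀ a b, s₀.Edge a b → F a < F b) (hFuv : F v < F u)
    (hlen : 2 ≤ len) : callRank F s.pos a b < callRank F s₀.pos u v := by
  refine OnlineTopo.callRank_lt (h.moves.agreement_add_le fun x y hx hy =>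
    (reach_le hF hy).trans_lt (hFuv.trans_le (reach_le hF hx))) ?_
  rintro rfl
  have hpos := h.moves.eq_of_zero
  have hinv := h.inv
  have hcount := h.count
  rw [hpos] at hinv ⊢
  cases qs with
  | nil => simp at hcount; omega
  | cons q qs =>
    exact hinv.sub_lt_sub (fun x hx => (hl.range_left hx).1) fun y hy => (hl.range_right hy).2

lemma next (h : LoopState p t κ s₀ u v A B α β len ((a, b) :: qs) s N S C D)
    (hl : LoopLists s₀.Edge s₀.pos u v A B) (h' : Reordered p t κ a b (α' + β' + 1) s s' N' S')
    (hC : SideCost s₀.pos s'.pos u A α (S + S') (C + α' * S'))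
    (hD : SideCost (Fin.rev ∘ s₀.pos) (Fin.rev ∘ s'.pos) v B β (S + S') (D + β' * S')) :
    LoopState p t κ s₀ u v A B α β len qs s' (N + N') (S + S') (C + α' * S') (D + β' * S') := by
  obtain ⟨ha, hb, -⟩ := h.inv.mem (a, b) List.mem_cons_self
  have hmoves := h'.moves
  rw [CallMoves, Store.edge_congr h.outList] at hmoves
  have hmoves' := hmoves.mono (fun x hx => (hl.reach_left ha).trans hx)
    (fun y hy => ReflTransGen.trans hy (hl.reach_right hb)) le_rfl le_rfl
  refine ⟨h'.consistent, h'.outList.trans h.outList, h.moves.trans (hmoves'.mono (fun _ => id)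
    (fun _ => id) (h.moves.inside (hl.range_left ha)).1 (h.moves.inside (hl.range_right hb)).2), ?_,
    h.inv.tail hmoves' (not_reach_of_reach hl.not_reach) (fun x => hl.reach_left)
      (fun y => hl.reach_right) h'.flipped, hC, hD, ?_⟩
  · have := h.count
    have := h'.one_le
    rw [List.length_cons] at *
    omega
  · have := h.time
    have := h'.time
    push_cast [List.length_cons] at *
    linarith

lemma ends_reorder (h : LoopState p t κ s₀ u v A B α β len ((a, b) :: qs) s N S C D)
    (hl : LoopLists s₀.Edge s₀.pos u v A B) (ih : ReorderSpec p t κ F depth)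
    (hF : ∀ a b, s₀.Edge a b → F a < F b) (hFuv : F v < F u) (hlen : 2 ≤ len)
    (hrank : callRank F s₀.pos u v ≤ depth) (hα : CoverRate s₀.Edge s₀.pos u v A α)
    (hβ : CoverRate (Function.swap s₀.Edge) (Fin.rev ∘ s₀.pos) v u B β) :
    Ends (reorder p t depth a b (decide (a = u ∧ A = [])) (decide (b = v ∧ B = []))) s
      fun _ s' => ∃ N S C D, LoopState p t κ s₀ u v A B α β len qs s' N S C D := by
  have hedge := Store.edge_congr h.outList
  obtain ⟨ha, hb, hab⟩ : (a = u ∨ a ∈ A) ∧ (b ∈ B ∨ b = v) ∧ s.pos a < s.pos b :=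
    h.inv.mem (a, b) List.mem_cons_self
  have htopo := h.consistent.topo
  rw [hedge] at htopo
  obtain ⟨α', hα', hC⟩ := hl.exists_outRate hα h.moves htopo h.out ha hb
    fun z hz => h.inv.lt_of_lt_left hz
  obtain ⟨β', hβ', hD⟩ := hl.reflect.exists_outRate hβ h.moves.reflect
    (fun x y hxy => Fin.rev_lt_rev.2 (htopo y x hxy)) h.inn hb.symm ha.symm
    fun z hz hbz => Fin.rev_lt_rev.2 (h.inv.lt_of_lt_right hz.symm (Fin.rev_lt_rev.1 hbz))
  rw [← hedge] at hα' hβ'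
  refine (ih h.consistent (by rwa [hedge]) ?_ hab hα' hβ'
    ((h.callRank_lt hl hF hFuv hlen).trans_le hrank)).mono fun _ s' ⟨N', S', h'⟩ => ?_
  · exact (reach_le hF (hl.reach_right hb)).trans_lt
      (hFuv.trans_le (reach_le hF (hl.reach_left ha)))
  · have hmoves : CallMoves s₀.Edge s.pos s'.pos a b N' S' := hedge ▸ h'.moves
    exact ⟨_, _, _, _, h.next hl h' (hC hmoves) (hD hmoves.reflect)⟩

lemma flipped (h : LoopState p t κ s₀ u v A B α β len [] s N S C D) : s.pos v < s.pos u :=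
  (h.inv.flipped u v (Or.inl rfl) (Or.inr rfl)).resolve_left List.not_mem_nil

end LoopState

end Recursion

section Cost

/-- The number of steps that a call of `reorder` may take per unit of cost. -/
noncomputable def unitCost (n p : ℕ) (θ : ℝ) : ℝ := 120 * (p + 2) * logBound n * θ

variable {n p : ℕ} {θ : ℝ}

lemma le_unitCost (hθ : 1 ≤ θ) :
    240 * θ ≤ unitCost n p θ ∧ 240 * (logBound n : ℝ) ≤ unitCost n p θ ∧
    60 * ((p : ℝ) + 4) ≤ unitCost n p θ ∧ 240 ≤ unitCost n p θ := by
  have hL : (1 : ℝ) ≤ logBound n := mod_cast one_le_logBound n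
  have hp : (0 : ℝ) ≤ p := p.cast_nonneg
  have hLθ : 1 ≤ logBound n * θ := one_le_mul_of_one_le_of_one_le hL hθ
  have hpLθ : 0 ≤ p * (logBound n * θ - 1) := mul_nonneg hp (by linarith)
  have : 0 ≤ p * (logBound n * θ) := by positivity
  have hθL : θ ≤ logBound n * θ := le_mul_of_one_le_left (by linarith) hL
  have hLL : logBound n ≤ logBound n * θ := le_mul_of_one_le_right (by linarith) hθ
  have hunit : unitCost n p θ = 120 * (p * (logBound n * θ)) + 240 * (logBound n * θ) := by
    rw [unitCost]; ring
  refine ⟨?_, ?_, ?_, ?_⟩ <;> linarith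

lemma search_cost_le (hθ : 1 ≤ θ) {T m c : ℝ} (hm : 2 ≤ m) (hc : 0 ≤ c)
    (hT : T ≤ p + 4 + 44 * θ + 6 * logBound n * m + 22 * θ * c) :
    T ≤ unitCost n p θ * (m / 8 + c) := by
  obtain ⟨hκθ, hκL, hκp, hκ⟩ := le_unitCost (n := n) (p := p) hθ
  have := mul_le_mul_of_nonneg_right hκL (show 0 ≤ m by linarith)
  have := mul_le_mul_of_nonneg_right hκθ hc
  have : unitCost n p θ * 2 ≤ unitCost n p θ * m := by gcongr
  have : 0 ≤ θ * c := by positivity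
  linarith

lemma swap_cost_le (hθ : √(n : ℝ) ≤ θ) {d : ℝ} (hd : 0 ≤ d) (hdn : d ≤ n) :
    60 * (p + 2) * logBound n * d ≤ unitCost n p θ / 2 * √d := by
  have hdθ : √d ≤ θ := (Real.sqrt_le_sqrt hdn).trans hθ
  calc 60 * (p + 2) * logBound n * d = 60 * (p + 2) * logBound n * (√d * √d) := by
        rw [Real.mul_self_sqrt hd]
    _ ≤ 60 * (p + 2) * logBound n * (θ * √d) := by gcongr
    _ = unitCost n p θ / 2 * √d := by rw [unitCost]; ring

end Cost

section ReorderSpec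

variable {n p : ℕ} {t : ℕ → ℕ} {θ κ : ℝ} {F : Fin n → Fin n} {s s' s'' : Store n} {u v : Fin n}
  {A B : List (Fin n)} {f₁ f₂ : Bool} {α β c₁ c₂ : ℝ} {depth T : ℕ}

lemma Consistent.ends_reorderBody_leaf (h : Consistent p t s) (hθ : Thresholds n p t θ)
    (hs' : Later s T s') (huv : s.pos u < s.pos v) (hE : ¬ s.Edge u v)
    (hnb : Neighbours s.Edge s.pos u v [] [] f₁ f₂ c₁ c₂) (hα : OutRate s.Edge s.pos u v f₁ α)
    (hβ : InRate s.Edge s.pos u v f₂ β) (hT : T ≤ unitCost n p θ * (1 / 4 + (c₁ + c₂))) :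
    Ends (reorderBody p t depth u v [] []) s' fun _ s'' =>
      ∃ N S, Reordered p t (unitCost n p θ) u v (α + β + 1) s s'' N S := by
  have huv' : (s.pos u : ℝ) ≤ s.pos v := mod_cast huv.le
  have hd : (s.pos v : ℝ) - s.pos u ≤ n := by
    have : (s.pos v : ℝ) ≤ n := mod_cast (s.pos v).2.le
    have : (0 : ℝ) ≤ s.pos u := Nat.cast_nonneg _
    linarith
  obtain ⟨k, hk, rfl⟩ := id hs'
  rw [reorderBody, if_pos ⟨rfl, rfl⟩]
  refine ((hs'.consistent h).ends_swap huv (fun z hz => hnb.out.noOut.lt h.pos_injective hE hz)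
    fun z hz => NoIn.lt (OutInfo.noOut hnb.inn) h.pos_injective hE hz).mono
    fun _ s'' ⟨hs'', hout, hpos, htime⟩ => ⟨1, _, hs'', hout,
      hpos ▸ callMoves_comp_swap huv, le_rfl, ?_, ?_⟩
  · simpa [hpos] using huv
  · have htime' : (s''.time : ℝ) ≤ s.time + T +
        60 * (p + 2) * logBound n * ((s.pos v : ℝ) - s.pos u) := by
      rw [← Nat.cast_sub (Fin.le_def.1 huv.le)]
      exact_mod_cast htime.trans (Nat.add_le_add_right (Nat.add_le_add_left hk _) _)
    have hκ : 0 ≤ unitCost n p θ := by linarith [(le_unitCost (n := n) (p := p) hθ.one_le).2.2.2]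
    have hcharge := mul_le_mul_of_nonneg_left
      (add_le_add (hnb.out.charge_le_rate hα) (hnb.inn.charge_le_rate hβ)) hκ
    have := swap_cost_le (p := p) hθ.sqrt_le (sub_nonneg.2 huv') hd
    have := mul_nonneg hκ (Real.sqrt_nonneg ((s.pos v : ℝ) - s.pos u))
    push_cast
    linarith

lemma Neighbours.loopLists (h : Consistent p t s)
    (hnb : Neighbours s.Edge s.pos u v A B f₁ f₂ c₁ c₂) (huv : s.pos u < s.pos v)
    (hreach : ¬ ReflTransGen s.Edge u v) : LoopLists s.Edge s.pos u v A B where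
  topo := h.topo
  inj := h.pos_injective
  not_reach := hreach
  lt := huv
  mem_left := hnb.out.mem
  mem_right w hw := (OutInfo.mem hnb.inn w hw).imp_right Fin.rev_lt_rev.1
  nil_left := hnb.out.nil
  nil_right := OutInfo.nil hnb.inn

lemma LoopState.reordered {κ a b C D S : ℝ} {len N : ℕ}
    (h : LoopState p t κ s' u v A B a b len [] s'' N S C D) (hs' : Later s T s') (hκ : 0 ≤ κ)
    (hlen : 1 ≤ len) (hC : C + c₁ ≤ α * S) (hD : D + c₂ ≤ β * S)
    (hT : T ≤ κ * (2 * len - 2 + (c₁ + c₂))) : Reordered p t κ u v (α + β + 1) s s'' N S := by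
  obtain ⟨k, hk, rfl⟩ := hs'
  refine ⟨h.consistent, h.outList, h.moves, hlen.trans h.count, h.flipped, ?_⟩
  have htime := h.time
  have hk' : (k : ℝ) ≤ T := mod_cast hk
  have := mul_le_mul_of_nonneg_left (add_le_add hC hD) hκ
  push_cast [List.length_nil] at htime
  linarith

lemma Consistent.ends_reorderBody_loop (h : Consistent p t s) (hs' : Later s T s')
    (ih : ReorderSpec p t κ F depth) (hF : ∀ a b, s.Edge a b → F a < F b) (hFuv : F v < F u)
    (hrank : callRank F s.pos u v ≤ depth) (huv : s.pos u < s.pos v) (hAB : ¬ (A = [] ∧ B = []))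
    (hnb : Neighbours s.Edge s.pos u v A B f₁ f₂ c₁ c₂) (hα : OutRate s.Edge s.pos u v f₁ α)
    (hβ : InRate s.Edge s.pos u v f₂ β) (hκ : 120 ≤ κ)
    (hT : T ≤ κ * ((A.length + B.length + 2) / 8 + (c₁ + c₂))) :
    Ends (reorderBody p t depth u v A B) s' fun _ s'' =>
      ∃ N S, Reordered p t κ u v (α + β + 1) s s'' N S := by
  have hreach : ¬ ReflTransGen s.Edge u v := fun huv => (reach_le hF huv).not_gt hFuv
  have hl := hnb.loopLists h huv hreach
  have hA := hl.pairwise_left hnb.sorted_left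
  have hB := hl.pairwise_right hnb.sorted_right
  have hinv := loopInv_loopPairs h.pos_injective hA hB fun x y hx hy hxy =>
    hreach ((hl.reach_left hx).trans (hxy ▸ hl.reach_right hy))
  have hlenA := length_add_one_le_length_loopPairs_left hA hB <| List.forall_mem_cons.2
    ⟨huv, fun w hw => (hl.mem_left w hw).2⟩
  have hlenB := length_add_one_le_length_loopPairs_right (u := u) (A := A) hB <|
    List.forall_mem_append.2 ⟨fun w hw => (hl.mem_right w hw).2, by simpa using huv⟩
  obtain ⟨a, ha, hcostA⟩ := hnb.out.exists_coverRate h.topo hreach hα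
  obtain ⟨b, hb, hcostB⟩ := OutInfo.exists_coverRate hnb.inn
    (fun x y hxy => Fin.rev_lt_rev.2 (h.topo y x hxy)) hl.reflect.not_reach hβ
  obtain ⟨k, -, rfl⟩ := id hs'
  rw [reorderBody, if_neg hAB]
  simp only [ends_bind, ends_get, ends_tick]
  have hs₀ := hs'.addTime ((loopPairs s.pos u v A B).length + A.length + B.length + 1)
  have hstart := LoopState.start (A := A) (B := B) (α := a) (β := b) (κ := κ)
    (hs₀.consistent h) hinv
  generalize hlen : (loopPairs s.pos u v A B).length = len at hlenA hlenB hs₀ hstart ⊢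
  have hlen2 : 2 ≤ len := by
    obtain hA' | hB' := not_and_or.1 hAB
    · have := List.length_pos_iff.2 hA'
      omega
    · have := List.length_pos_iff.2 hB'
      omega
  refine (Ends.forM (fun _ qs s'' => ∃ N S C D, LoopState p t κ _ u v A B a b len qs s'' N S C D)
    ?_ ⟨0, 0, 0, 0, hstart⟩).mono ?_
  · rintro - q qs s₁ ⟨N, S, C, D, hs₁⟩
    exact hs₁.ends_reorder hl ih hF hFuv hlen2 hrank ha hb
  · rintro - s₁ ⟨N, S, C, D, hs₁⟩
    refine ⟨N, S, hs₁.reordered hs₀ (by linarith) (by omega) (hcostA hs₁.moves hs₁.flipped hs₁.out)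
      (hcostB hs₁.moves.reflect (Fin.rev_lt_rev.2 hs₁.flipped) hs₁.inn) ?_⟩
    have : (A.length : ℝ) + 1 ≤ len := mod_cast hlenA
    have : (B.length : ℝ) + 1 ≤ len := mod_cast hlenB
    have : (2 : ℝ) ≤ len := mod_cast hlen2
    have := mul_le_mul_of_nonneg_right hκ (show (0 : ℝ) ≤ len by linarith)
    push_cast
    nlinarith

lemma reorderSpec (hθ : Thresholds n p t θ) (F : Fin n → Fin n) (depth : ℕ) :
    ReorderSpec p t (unitCost n p θ) F depth := by
  induction depth with
  | zero => exact fun _ _ _ _ _ _ _ _ _ _ _ _ _ hrank => absurd hrank (Nat.not_lt_zero _)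
  | succ depth ih =>
    intro s u v f₁ f₂ α β h hF hFuv huv hα hβ hrank
    have hs₃ := Later.of_addTime s 3
    refine ends_reorder_succ huv
      (((hs₃.consistent h).ends_neighbourLists hθ hα.noOut hβ.noOut).mono ?_)
    rintro ⟨A, B⟩ s' ⟨T, c₁, c₂, hs', hT, hnb⟩
    have hT' : ((3 + T : ℕ) : ℝ) ≤
        unitCost n p θ * ((A.length + B.length + 2) / 8 + (c₁ + c₂)) := by
      refine search_cost_le hθ.one_le ?_ (add_nonneg hnb.out.nonneg (OutInfo.nonneg hnb.inn)) ?_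
      · linarith [A.length.cast_nonneg (α := ℝ), B.length.cast_nonneg (α := ℝ)]
      · push_cast
        linarith
    by_cases hAB : A = [] ∧ B = []
    · obtain ⟨rfl, rfl⟩ := hAB
      refine h.ends_reorderBody_leaf hθ (hs₃.trans hs') huv (fun hE => (hF u v hE).not_gt hFuv) hnb
        hα hβ (hT'.trans_eq ?_)
      norm_num
    · exact h.ends_reorderBody_loop (hs₃.trans hs') ih hF hFuv (Nat.lt_succ_iff.1 hrank) huv hAB hnb
        hα hβ (by linarith [(le_unitCost (n := n) (p := p) hθ.one_le).2.2.2]) hT'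

end ReorderSpec

/-! ### The potential -/

section Potential

variable {n : ℕ} {U V : Fin n → Prop} {lo hi N : ℕ} {S : ℝ} {F f g : Fin n → Fin n} {u v : Fin n}
  {E E' : Fin n → Fin n → Prop} {q : Fin n × Fin n}

/-- The weight in the potential of a pair of vertices which the order `F` reverses. -/
noncomputable def pairWeight (F : Fin n → Fin n) (q : Fin n × Fin n) : ℝ :=
  1 + n / ((F q.1 : ℝ) - F q.2)

lemma pairWeight_nonneg (hq : F q.2 < F q.1) : 0 ≤ pairWeight F q := by
  have : (0 : ℝ) < F q.1 - F q.2 := sub_pos.2 (mod_cast hq)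
  rw [pairWeight]
  positivity

lemma two_mul_sqrt_le {a d m : ℝ} (ha : 0 < a) (hd : 0 ≤ d) (hm : 0 < m) :
    2 * √d ≤ m / a + a * d / m := by
  have hsq : m / a + a * d / m - 2 * √d = (m - a * √d) ^ 2 / (a * m) := by
    have := Real.sq_sqrt hd
    field_simp
    linear_combination (-(a ^ 2)) * this
  have : 0 ≤ (m - a * √d) ^ 2 / (a * m) := by positivity
  linarith

open Classical in
/-- The total weight of the pairs of a vertex in `U` and a higher vertex in `V`. -/
noncomputable def pendingWeight (F : Fin n → Fin n) (U V : Fin n → Prop) (g : Fin n → Fin n) : ℝ :=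
  ∑ q : Fin n × Fin n with U q.1 ∧ V q.2 ∧ g q.1 < g q.2, pairWeight F q

lemma pendingWeight_nonneg (hF : ∀ x y, U x → V y → F y < F x) : 0 ≤ pendingWeight F U V g := by
  classical
  refine Finset.sum_nonneg fun _ hq => ?_
  obtain ⟨hU, hV, -⟩ := (Finset.mem_filter.1 hq).2
  exact pairWeight_nonneg (hF _ _ hU hV)

lemma pairWeight_add_pendingWeight_le (hF : ∀ x y, U x → V y → F y < F x) {x y : Fin n} (hx : U x)
    (hy : V y) (hxy : g x < g y) :
    pairWeight F (x, y) + pendingWeight F U V (g ∘ Equiv.swap x y) ≤ pendingWeight F U V g := by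
  classical
  have hUV : ∀ w, U w → ¬ V w := fun w hU hV => lt_irrefl _ (hF w w hU hV)
  have hm := (Moves.refl (lo := 0) (hi := n) (f := g)).step hx hy (Nat.zero_le _) hxy (g y).2.le
  rw [pendingWeight, pendingWeight, ← Finset.add_sum_erase
    (Finset.univ.filter fun q => U q.1 ∧ V q.2 ∧ g q.1 < g q.2) _ (a := (x, y)) (by simp [*])]
  refine add_le_add_right
    (Finset.sum_le_sum_of_subset_of_nonneg (fun q hq => ?_) fun q hq _ => ?_) _
  · obtain ⟨hU, hV, hlt⟩ := (Finset.mem_filter.1 hq).2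
    refine Finset.mem_erase.2 ⟨?_, Finset.mem_filter.2 ⟨Finset.mem_univ q, hU, hV,
      (hm.up hUV hU).trans_lt (hlt.trans_le (hm.down hUV hV))⟩⟩
    rintro rfl
    simp only [Function.comp, Equiv.swap_apply_left, Equiv.swap_apply_right] at hlt
    exact hlt.not_gt hxy
  · obtain ⟨hU, hV, -⟩ := (Finset.mem_filter.1 (Finset.mem_of_mem_erase hq)).2
    exact pairWeight_nonneg (hF _ _ hU hV)

lemma one_add_two_mul_sqrt_le {x y : Fin n} (hF : F y < F x) (hg : g x < g y) :
    1 + 2 * √((g y : ℝ) - g x) ≤ pairWeight F (x, y) +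
      ((agreement F (g ∘ Equiv.swap x y) : ℝ) - agreement F g) / n := by
  have hF' : (0 : ℝ) < F x - F y := sub_pos.2 (mod_cast hF)
  have hg' : (0 : ℝ) < g y - g x := sub_pos.2 (mod_cast hg)
  have hgain : (agreement F (g ∘ Equiv.swap x y) : ℝ) - agreement F g =
      ((F x : ℝ) - F y) * ((g y : ℝ) - g x) := by
    rw [agreement_comp_swap hF hg]
    push_cast [Nat.cast_sub (Fin.le_def.1 hF.le), Nat.cast_sub (Fin.le_def.1 hg.le)]
    ring
  rw [hgain, pairWeight]
  linarith [two_mul_sqrt_le hF' hg'.le (Nat.cast_pos.2 x.pos)]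

lemma Moves.add_pendingWeight_le (hm : Moves U V lo hi f g N S)
    (hF : ∀ x y, U x → V y → F y < F x) :
    N + 2 * S + pendingWeight F U V g ≤
      pendingWeight F U V f + ((agreement F g : ℝ) - agreement F f) / n := by
  induction hm with
  | refl => simp
  | @step g N S x y _ hx hy _ hlt _ ih =>
    have := one_add_two_mul_sqrt_le (hF x y hx hy) hlt
    have := pairWeight_add_pendingWeight_le hF hx hy hlt
    rw [sub_div] at *
    push_cast
    linarith

open Classical in
/-- The pairs `(x, y)` with `F y < F x` such that there is no path from `y` to `x` yet. These are
the pairs that may still be swapped. -/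
noncomputable def openPairs (F : Fin n → Fin n) (E : Fin n → Fin n → Prop) :
    Finset (Fin n × Fin n) :=
  Finset.univ.filter fun q => F q.2 < F q.1 ∧ ¬ TransGen E q.2 q.1

lemma mem_openPairs : q ∈ openPairs F E ↔ F q.2 < F q.1 ∧ ¬ TransGen E q.2 q.1 := by
  simp [openPairs]

lemma openPairs_subset (h : ∀ a b, E a b → E' a b) : openPairs F E' ⊆ openPairs F E := fun _ hq =>
  have ⟨hlt, hpath⟩ := mem_openPairs.1 hq
  mem_openPairs.2 ⟨hlt, fun hE => hpath (TransGen.mono h _ _ hE)⟩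

lemma sum_pairWeight_le_of_subset {D : Finset (Fin n × Fin n)} (hD : D ⊆ openPairs F E) :
    ∑ q ∈ D, pairWeight F q ≤ ∑ q ∈ openPairs F E, pairWeight F q :=
  Finset.sum_le_sum_of_subset_of_nonneg hD fun _ hq _ => pairWeight_nonneg (mem_openPairs.1 hq).1

/-- The potential of a graph and an order: the weight of the open pairs, which decreases with the
edges, less the agreement of the order with `F` on the scale of that weight. -/
noncomputable def potential (F : Fin n → Fin n) (E : Fin n → Fin n → Prop) (g : Fin n → Fin n) :
    ℝ :=
  ∑ q ∈ openPairs F E, pairWeight F q - (agreement F g : ℝ) / n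

lemma potential_anti (h : ∀ a b, E a b → E' a b) : potential F E' g ≤ potential F E g :=
  sub_le_sub_right (sum_pairWeight_le_of_subset (openPairs_subset h)) _

lemma lt_of_transGen (hf : ∀ a b, E a b → f a < f b) {a b : Fin n} (h : TransGen E a b) :
    f a < f b := by
  induction h with
  | single h => exact hf _ _ h
  | tail _ h ih => exact ih.trans (hf _ _ h)

lemma pendingWeight_add_sum_openPairs_le (hF : ∀ a b, E a b → F a < F b) (hFuv : F u < F v)
    (hf : ∀ a b, E a b → f a < f b) (hE : ∀ a b, E a b → E' a b) (huv : E' u v) :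
    pendingWeight F (ReflTransGen E v) (fun y => ReflTransGen E y u) f +
      ∑ q ∈ openPairs F E', pairWeight F q ≤ ∑ q ∈ openPairs F E, pairWeight F q := by
  classical
  rw [pendingWeight, ← Finset.sum_union]
  · refine sum_pairWeight_le_of_subset (Finset.union_subset (fun q hq => ?_) (openPairs_subset hE))
    obtain ⟨hv, hu, hlt⟩ := (Finset.mem_filter.1 hq).2
    exact mem_openPairs.2 ⟨(reach_le hF hu).trans_lt (hFuv.trans_le (reach_le hF hv)),
      fun hpath => (lt_of_transGen hf hpath).not_gt hlt⟩
  · refine Finset.disjoint_left.2 fun q hq hq' => (mem_openPairs.1 hq').2 ?_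
    obtain ⟨hv, hu, -⟩ := (Finset.mem_filter.1 hq).2
    exact .trans_left (.trans_right (ReflTransGen.mono hE _ _ hu) (.single huv))
      (ReflTransGen.mono hE _ _ hv)

lemma Moves.add_potential_le
    (hm : Moves (ReflTransGen E v) (fun y => ReflTransGen E y u) lo hi f g N S)
    (hF : ∀ a b, E a b → F a < F b) (hFuv : F u < F v) (hf : ∀ a b, E a b → f a < f b)
    (hE : ∀ a b, E a b → E' a b) (huv : E' u v) :
    N + 2 * S + potential F E' g ≤ potential F E f := by
  have hFUV : ∀ x y, ReflTransGen E v x → ReflTransGen E y u → F y < F x := fun x y hx hy =>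
    (reach_le hF hy).trans_lt (hFuv.trans_le (reach_le hF hx))
  have hcost := hm.add_pendingWeight_le hFUV
  have := pendingWeight_nonneg (g := g) hFUV
  have := pendingWeight_add_sum_openPairs_le hF hFuv hf hE huv
  rw [sub_div] at hcost
  rw [potential, potential]
  linarith

lemma neg_le_potential : -((n : ℝ) * n) ≤ potential F E g := by
  have hsum : 0 ≤ ∑ q ∈ openPairs F E, pairWeight F q :=
    Finset.sum_nonneg fun q hq => pairWeight_nonneg (mem_openPairs.1 hq).1
  have hagree : (agreement F g : ℝ) / n ≤ n * n :=
    div_le_of_le_mul₀ n.cast_nonneg (by positivity) <|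
      mod_cast (agreement_le F g).trans_eq (by ring)
  rw [potential]
  linarith

lemma sum_inv_sub_le (hF : Function.Injective F) (x : Fin n) :
    ∑ y with F y < F x, ((F x : ℝ) - F y)⁻¹ ≤ 1 + Real.log n := by
  calc ∑ y with F y < F x, ((F x : ℝ) - F y)⁻¹
      = ∑ j ∈ (Finset.univ.filter fun y => F y < F x).image fun y => (F y : ℕ),
          ((F x : ℝ) - j)⁻¹ :=
        (Finset.sum_image (g := fun y => (F y : ℕ)) (f := fun j : ℕ => ((F x : ℝ) - j)⁻¹)
          fun _ _ _ _ h => hF (Fin.ext h)).symm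
    _ ≤ ∑ j ∈ Finset.range (F x), ((F x : ℝ) - j)⁻¹ := by
        refine Finset.sum_le_sum_of_subset_of_nonneg ?_ fun j hj _ => ?_
        · intro j hj
          obtain ⟨y, hy, rfl⟩ := Finset.mem_image.1 hj
          exact Finset.mem_range.2 (Finset.mem_filter.1 hy).2
        · exact inv_nonneg.2 (sub_nonneg.2 (mod_cast (Finset.mem_range.1 hj).le))
    _ = ∑ k ∈ Finset.range (F x), ((k : ℝ) + 1)⁻¹ := by
        rw [← Finset.sum_range_reflect]
        refine Finset.sum_congr rfl fun k hk => ?_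
        have hk := Finset.mem_range.1 hk
        rw [Nat.sub_sub, Nat.cast_sub (by omega)]
        push_cast
        ring
    _ ≤ ∑ k ∈ Finset.range n, ((k : ℝ) + 1)⁻¹ :=
        Finset.sum_le_sum_of_subset_of_nonneg (Finset.range_subset_range.2 (F x).2.le)
          fun _ _ _ => by positivity
    _ ≤ 1 + Real.log n := le_of_eq_of_le (by simp [harmonic]) (harmonic_le_one_add_log n)

lemma sum_pairWeight_le (hF : Function.Injective F) (x : Fin n) :
    ∑ y with F y < F x, pairWeight F (x, y) ≤ n * (2 + Real.log n) := by
  have hcard : ((Finset.univ.filter fun y => F y < F x).card : ℝ) ≤ n :=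
    mod_cast (Finset.card_le_univ _).trans_eq (Fintype.card_fin n)
  have hsum := mul_le_mul_of_nonneg_left (sum_inv_sub_le hF x) (Nat.cast_nonneg (α := ℝ) n)
  simp only [pairWeight, Finset.sum_add_distrib, Finset.sum_const, nsmul_eq_mul, mul_one,
    div_eq_mul_inv, ← Finset.mul_sum]
  linarith

lemma potential_le (hF : Function.Injective F) : potential F E g ≤ n * n * (2 + Real.log n) := by
  have hagree : 0 ≤ (agreement F g : ℝ) / n := by positivity
  calc potential F E g
      ≤ ∑ q ∈ openPairs F E, pairWeight F q := sub_le_self _ hagree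
    _ ≤ ∑ q : Fin n × Fin n with F q.2 < F q.1, pairWeight F q :=
        Finset.sum_le_sum_of_subset_of_nonneg
          (fun q hq => Finset.mem_filter.2 ⟨Finset.mem_univ q, (mem_openPairs.1 hq).1⟩)
          fun q hq _ => pairWeight_nonneg (Finset.mem_filter.1 hq).2
    _ = ∑ x, ∑ y with F y < F x, pairWeight F (x, y) := by
        simp only [Finset.sum_filter, Fintype.sum_prod_type]
    _ ≤ ∑ _x : Fin n, n * (2 + Real.log n) := Finset.sum_le_sum fun x _ => sum_pairWeight_le hF x
    _ = n * n * (2 + Real.log n) := by simp [mul_assoc]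

end Potential

lemma exists_equiv_fin_of_acyclic {α : Type*} [Fintype α] {n : ℕ} (hα : Fintype.card α = n)
    {E : α → α → Prop} (hE : ∀ x, ¬ TransGen E x x) :
    ∃ F : α ≃ Fin n, ∀ a b, E a b → F a < F b := by
  let _ : PartialOrder α :=
    { le := ReflTransGen E
      le_refl := fun _ => .refl
      le_trans := fun _ _ _ => .trans
      le_antisymm := fun a b hab hba => by
        obtain hab | hab := Relation.reflTransGen_iff_eq_or_transGen.1 hab
        · exact hab.symm
        · exact absurd (hab.trans_left hba) (hE a) }
  let _ : Fintype (LinearExtension α) := inferInstanceAs (Fintype α)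
  let F : Fin n ≃o LinearExtension α := monoEquivOfFin (LinearExtension α) hα
  refine ⟨F.symm.toEquiv, fun a b hab => lt_of_le_of_ne ?_ fun heq => ?_⟩
  · exact F.symm.monotone (toLinearExtension.monotone (ReflTransGen.single hab))
  · obtain rfl : a = b := F.symm.injective heq
    exact hE a (.single hab)

/-! ### The whole run -/

section Run

variable {n p : ℕ} {t : ℕ → ℕ} {s s₀ s' : Store n} {F : Fin n → Fin n} {u v : Fin n} {θ κ M S : ℝ}
  {N : ℕ}

lemma unitCost_nonneg (hθ : 0 ≤ θ) : 0 ≤ unitCost n p θ := by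
  rw [unitCost]
  positivity

lemma consistent_initStore (p : ℕ) (t : ℕ → ℕ) (T₀ : Equiv.Perm (Fin n)) :
    Consistent p t (initStore p T₀) where
  vert_pos := T₀.symm_apply_apply
  pos_vert := T₀.apply_symm_apply
  inList_eq _ _ := rfl
  topo _ _ h := absurd h (by simp [Store.Edge, initStore])
  pails _ _ _ := ⟨.nil (by simp [Store.Close, Store.Edge, initStore]),
    .nil (by simp [Store.Close, Store.Edge, initStore])⟩

lemma callRank_lt_add (F g : Fin n → Fin n) (u v : Fin n) :
    callRank F g u v < n * (n * n) * (n + 1) + n := by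
  have := Nat.mul_le_mul_right (n + 1) (Nat.sub_le (n * (n * n)) (agreement F g))
  have := (g v).2
  rw [callRank]
  omega

/-- The time used so far together with the potential, where one unit of potential is worth `3 * κ`
units of time. -/
noncomputable def amortizedTime (κ : ℝ) (F : Fin n → Fin n) (s : Store n) : ℝ :=
  s.time + 3 * κ * potential F s.Edge s.pos

/-- The edge from `u` to `v` has been inserted, which leads from `s` to `s'`. -/
structure Inserted (p : ℕ) (t : ℕ → ℕ) (κ : ℝ) (F : Fin n → Fin n) (u v : Fin n) (s s' : Store n) :
    Prop where
  consistent : Consistent p t s'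
  edge_iff : ∀ a b, s'.Edge a b ↔ s.Edge a b ∨ (a = u ∧ b = v)
  amortizedTime_le : amortizedTime κ F s' ≤
    amortizedTime κ F s + (3 + 9 * (p + 2) * logBound n : ℕ)

lemma Reordered.time_add_potential_le (h : Reordered p t κ v u 5 s s' N S) (hκ : 0 ≤ κ)
    (htopo : ∀ a b, s.Edge a b → s.pos a < s.pos b) (hF : ∀ a b, s.Edge a b → F a < F b)
    (hFuv : F u < F v) {E' : Fin n → Fin n → Prop} (hE : ∀ a b, s.Edge a b → E' a b)
    (huv : E' u v) :
    s'.time + 3 * κ * potential F E' s'.pos ≤ amortizedTime κ F s := by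
  have hpot := h.moves.add_potential_le hF hFuv htopo hE huv
  have hswaps : κ * (3 * N - 2 + 5 * S) ≤ κ * (3 * (N + 2 * S)) := by
    have := h.moves.nonneg
    gcongr
    linarith
  have := h.time
  have := mul_le_mul_of_nonneg_left hpot hκ
  rw [amortizedTime]
  linarith

lemma Consistent.ends_insertEdge_of_time_add_potential_le (h : Consistent p t s)
    (hE : s.Edge = s₀.Edge) (huv : s.pos u < s.pos v)
    (hpaid : ∀ E' : Fin n → Fin n → Prop, (∀ a b, s₀.Edge a b → E' a b) → E' u v →
      s.time + 3 * κ * potential F E' s.pos ≤ amortizedTime κ F s₀ + 3) :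
    Ends (insertEdge p t u v) s fun _ => Inserted p t κ F u v s₀ := by
  refine (h.ends_insertEdge huv).mono fun _ s' ⟨hs', hedge, hpos, htime⟩ => ?_
  rw [hE] at hedge
  refine ⟨hs', hedge, ?_⟩
  have := hpaid s'.Edge (fun a b hab => (hedge a b).2 (Or.inl hab))
    ((hedge u v).2 (Or.inr ⟨rfl, rfl⟩))
  have htime' : (s'.time : ℝ) ≤ s.time + (9 * (p + 2) * logBound n : ℕ) := mod_cast htime
  rw [amortizedTime, hpos]
  push_cast at *
  linarith

lemma Consistent.ends_insert (h : Consistent p t s) (hθ : Thresholds n p t θ)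
    (hF : ∀ a b, s.Edge a b → F a < F b) (hFuv : F u < F v) :
    Ends (insert p t (n * (n * n) * (n + 1) + n) u v) s fun _ =>
      Inserted p t (unitCost n p θ) F u v s := by
  have hκ : 0 ≤ unitCost n p θ := unitCost_nonneg (zero_le_one.trans hθ.one_le)
  simp only [insert, ends_bind, ends_getPos, ends_tick, Nat.add_assoc]
  set s₃ : Store n := { s with time := s.time + (1 + (1 + 1)) } with hs₃
  have h₃ : Consistent p t s₃ := h.addTime _
  have htime : amortizedTime (unitCost n p θ) F s₃ = amortizedTime (unitCost n p θ) F s + 3 := by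
    have : (s₃.time : ℝ) = s.time + 3 := by rw [hs₃]; push_cast; ring
    rw [amortizedTime, amortizedTime, this]
    exact add_right_comm ..
  split_ifs with hvu
  · have hvu' : s.pos v < s.pos u := hvu.lt_of_ne fun heq =>
      hFuv.ne (congrArg F (h.pos_injective (Fin.ext heq)).symm)
    have hrate : (2 : ℝ) + 2 + 1 = 5 := by norm_num
    refine ends_bind.2 ((reorderSpec hθ F _ h₃ hF hFuv hvu'
      ⟨Bool.noConfusion, Or.inr (Or.inr rfl)⟩ ⟨Bool.noConfusion, Or.inr (Or.inr rfl)⟩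
      (callRank_lt_add F s.pos v u)).mono ?_)
    rintro - s₁ ⟨N, S, hs₁⟩
    refine hs₁.consistent.ends_insertEdge_of_time_add_potential_le
      (Store.edge_congr hs₁.outList) hs₁.flipped fun E' hE huv => ?_
    exact ((hrate ▸ hs₁).time_add_potential_le hκ h.topo hF hFuv hE huv).trans_eq htime
  · refine h₃.ends_insertEdge_of_time_add_potential_le rfl (Fin.lt_def.2 (not_le.1 hvu))
      fun E' hE _ => htime ▸ ?_
    rw [amortizedTime]
    gcongr
    exact potential_anti hE

lemma ends_build {T₀ : Equiv.Perm (Fin n)} {E₀ : List (Fin n × Fin n)}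
    (hT₀ : ∀ e ∈ E₀, T₀ e.1 < T₀ e.2) :
    Ends (E₀.forM fun e => insertEdge p t e.1 e.2) (initStore p T₀) fun _ s =>
      Consistent p t s ∧ (∀ a b, s.Edge a b → (a, b) ∈ E₀) ∧
      s.time ≤ 2 * n + 2 * n * n + 2 * n * (p + 2) + E₀.length * (9 * (p + 2) * logBound n) := by
  refine (Ends.forM (fun done rest s => done ++ rest = E₀ ∧ Consistent p t s ∧ s.pos = T₀ ∧
    (∀ a b, s.Edge a b → (a, b) ∈ done) ∧ s.time ≤ 2 * n + 2 * n * n + 2 * n * (p + 2) +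
      done.length * (9 * (p + 2) * logBound n)) ?_ ?_).mono fun _ _ hs => hs.2.imp_right And.right
  · rintro done e rest s ⟨hsplit, h, hpos, hedge, htime⟩
    refine (h.ends_insertEdge (hpos ▸ hT₀ e (hsplit ▸ by simp))).mono ?_
    rintro - s' ⟨h', hedge', hpos', htime'⟩
    refine ⟨by simpa using hsplit, h', hpos'.trans hpos, fun a b hab => ?_, ?_⟩
    · obtain hab | ⟨rfl, rfl⟩ := (hedge' a b).1 hab
      · exact List.mem_append_left _ (hedge a b hab)
      · exact List.mem_append_right _ (List.mem_singleton_self e)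
    · rw [List.length_append, List.length_singleton, add_mul, one_mul]
      omega
  · exact ⟨rfl, consistent_initStore p t T₀, rfl, by simp [Store.Edge, initStore],
      by simp [initStore]⟩

lemma Consistent.ends_forM_insert (h : Consistent p t s) (hθ : Thresholds n p t θ)
    {es : List (Fin n × Fin n)} (hF : ∀ a b, s.Edge a b → F a < F b)
    (hes : ∀ e ∈ es, F e.1 < F e.2) :
    Ends (es.forM fun e => insert p t (n * (n * n) * (n + 1) + n) e.1 e.2) s fun _ s' =>
      amortizedTime (unitCost n p θ) F s' ≤ amortizedTime (unitCost n p θ) F s +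
        es.length * (3 + 9 * (p + 2) * logBound n : ℕ) := by
  refine (Ends.forM (fun done rest s' => done ++ rest = es ∧ Consistent p t s' ∧
    (∀ a b, s'.Edge a b → F a < F b) ∧ amortizedTime (unitCost n p θ) F s' ≤
      amortizedTime (unitCost n p θ) F s + done.length * (3 + 9 * (p + 2) * logBound n : ℕ))
    ?_ ⟨rfl, h, hF, by simp⟩).mono fun _ _ hs' => hs'.2.2.2
  rintro done e rest s₁ ⟨hsplit, h₁, hF₁, htime₁⟩
  have he := hes e (hsplit ▸ by simp)
  refine (h₁.ends_insert hθ hF₁ he).mono fun _ s₂ h₂ =>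
    ⟨by simpa using hsplit, h₂.consistent, fun a b hab => ?_, ?_⟩
  · obtain hab | ⟨rfl, rfl⟩ := (h₂.edge_iff a b).1 hab
    · exact hF₁ a b hab
    · exact he
  · rw [List.length_append, List.length_singleton, Nat.cast_succ, add_mul, one_mul, ← add_assoc]
    exact h₂.amortizedTime_le.trans (add_le_add_left htime₁ _)

lemma time_le_of_amortizedTime_le (hF : Function.Injective F) (hκ : 0 ≤ κ)
    (h : amortizedTime κ F s' ≤ amortizedTime κ F s + M) :
    (s'.time : ℝ) ≤ s.time + 3 * κ * (n * n * (3 + Real.log n)) + M := by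
  have := mul_le_mul_of_nonneg_left (potential_le hF (E := s.Edge) (g := s.pos)) hκ
  have := mul_le_mul_of_nonneg_left (neg_le_potential (F := F) (E := s'.Edge) (g := s'.pos)) hκ
  rw [amortizedTime, amortizedTime] at h
  linarith

lemma exists_run_time_le (hθ : Thresholds n p t θ) {T₀ : Equiv.Perm (Fin n)}
    {E₀ es : List (Fin n × Fin n)} (hT₀ : ∀ e ∈ E₀, T₀ e.1 < T₀ e.2) (hnodup : (E₀ ++ es).Nodup)
    (hacyclic : ∀ x : Fin n, ¬ TransGen (fun a b => (a, b) ∈ E₀ ++ es) x x) :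
    ∃ (depth : ℕ) (s : Store n), run p t depth T₀ E₀ es = some s ∧
      (s.time : ℝ) ≤ 2 * n + 2 * n * n + 2 * n * (p + 2) +
        n * n * (3 + 9 * (p + 2) * logBound n) +
        3 * unitCost n p θ * (n * n * (3 + Real.log n)) := by
  obtain ⟨F, hF⟩ := exists_equiv_fin_of_acyclic (Fintype.card_fin n) hacyclic
  have hlen : (E₀.length : ℝ) + es.length ≤ n * n := by
    have := hnodup.length_le_card
    rw [List.length_append, Fintype.card_prod, Fintype.card_fin] at this
    exact_mod_cast this
  obtain ⟨_, s₀, hbuild, h₀, hE₀, htime₀⟩ := ends_build (p := p) (t := t) hT₀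
  obtain ⟨_, s, hinsert, htime⟩ := h₀.ends_forM_insert (F := F) hθ
    (fun a b hab => hF a b (List.mem_append_left _ (hE₀ a b hab)))
    fun e he => hF e.1 e.2 (List.mem_append_right _ he)
  have hrun : Ends (do
      E₀.forM fun e => insertEdge p t e.1 e.2
      es.forM fun e => insert p t (n * (n * n) * (n + 1) + n) e.1 e.2
      get : Prog n (Store n)) (initStore p T₀) fun a _ => a = s :=
    ends_bind.2 ⟨_, s₀, hbuild, ends_bind.2 ⟨_, s, hinsert, ends_get.2 rfl⟩⟩
  obtain ⟨s, s', hrun, rfl⟩ := hrun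
  refine ⟨_, s, by rw [run, StateT.run', hrun]; rfl, ?_⟩
  have := time_le_of_amortizedTime_le F.injective
    (unitCost_nonneg (zero_le_one.trans hθ.one_le)) htime
  have htime₀' : (s₀.time : ℝ) ≤ 2 * n + 2 * n * n + 2 * n * (p + 2) +
      E₀.length * (9 * (p + 2) * logBound n) := mod_cast htime₀
  have := mul_le_mul_of_nonneg_right hlen
    (show (0 : ℝ) ≤ 3 + 9 * (p + 2) * logBound n by positivity)
  push_cast at *
  linarith [E₀.length.cast_nonneg (α := ℝ)]

end Run

section Bounds

lemma expo_mul (p : ℕ) : expo p * (2 - (2 / 3 : ℝ) ^ (p + 1)) = 1 := by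
  have hle : (2 : ℝ) ^ (p + 1) ≤ 3 ^ (p + 1) := by gcongr; norm_num
  have hpos : (0 : ℝ) < 3 ^ (p + 1) := by positivity
  have hne : (2 * 3 ^ (p + 1) - 2 ^ (p + 1) : ℝ) ≠ 0 := by linarith
  rw [expo, div_pow]
  field_simp
  exact div_self (by rwa [mul_comm])

lemma half_le_expo (p : ℕ) : 1 / 2 ≤ expo p := by
  have hle : (2 / 3 : ℝ) ^ (p + 1) ≤ 1 := pow_le_one₀ (by norm_num) (by norm_num)
  have hpos : (0 : ℝ) < (2 / 3 : ℝ) ^ (p + 1) := by positivity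
  rw [eq_one_div_of_mul_eq_one_left (expo_mul p)]
  exact one_div_le_one_div_of_le (by linarith) (by linarith)

lemma rpow_two_sub_le {x : ℝ} (hx : 1 ≤ x) (i : ℕ) :
    x ^ (2 - (2 / 3 : ℝ) ^ (i + 1)) ≤ x * √(x ^ (2 - (2 / 3 : ℝ) ^ i)) := by
  have hx' : 0 < x := by linarith
  have hpos : (0 : ℝ) < (2 / 3) ^ i := by positivity
  calc x ^ (2 - (2 / 3 : ℝ) ^ (i + 1)) ≤ x ^ (1 + (2 - (2 / 3 : ℝ) ^ i) * (1 / 2)) :=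
        Real.rpow_le_rpow_of_exponent_le hx (by rw [pow_succ]; linarith)
    _ = x * √(x ^ (2 - (2 / 3 : ℝ) ^ i)) := by
        rw [Real.rpow_add hx', Real.rpow_one, Real.rpow_mul hx'.le, Real.sqrt_eq_rpow]

lemma thresholds_floor {n p : ℕ} (hn : 1 ≤ n) {t : ℕ → ℝ} (h₀ : t 0 = (n : ℝ) ^ expo p)
    (h : ∀ i : ℕ, 1 ≤ i → i ≤ p + 1 → t i = t 0 ^ (2 - (2 / 3 : ℝ) ^ i)) :
    Thresholds n p (fun i => ⌊t i⌋₊) (t 0) := by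
  have hn' : (1 : ℝ) ≤ n := mod_cast hn
  have hone : 1 ≤ t 0 := h₀ ▸ Real.one_le_rpow hn' (by linarith [half_le_expo p])
  have ht : ∀ i ≤ p + 1, t i = t 0 ^ (2 - (2 / 3 : ℝ) ^ i) := fun i hi => by
    obtain rfl | hpos := i.eq_zero_or_pos
    · norm_num
    · exact h i hpos hi
  have htop : t (p + 1) = n := by
    rw [ht _ le_rfl, h₀, ← Real.rpow_mul (by positivity), expo_mul, Real.rpow_one]
  refine ⟨hone, Nat.floor_le (by linarith), fun i hi => ?_, ?_, ?_⟩
  · have hnonneg : 0 ≤ t (i + 1) := ht (i + 1) (by omega) ▸ by positivity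
    calc (⌊t (i + 1)⌋₊ : ℝ) ≤ t (i + 1) := Nat.floor_le hnonneg
      _ ≤ t 0 * √(t i) := by
        rw [ht (i + 1) (by omega), ht i (by omega)]
        exact rpow_two_sub_le hone i
      _ ≤ t 0 * √((⌊t i⌋₊ : ℝ) + 1) := by
        gcongr
        exact (Nat.lt_floor_add_one _).le
  · simp only [htop, Nat.floor_natCast, le_refl]
  · rw [h₀, Real.sqrt_eq_rpow]
    exact Real.rpow_le_rpow_of_exponent_le hn' (half_le_expo p)

lemma half_le_log {n : ℕ} (hn : 2 ≤ n) : 1 / 2 ≤ Real.log n := by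
  have := Real.log_le_log two_pos (show (2 : ℝ) ≤ n by exact_mod_cast hn)
  linarith [Real.log_two_gt_d9]

lemma logBound_le {n : ℕ} (hn : 2 ≤ n) : (logBound n : ℝ) ≤ 10 * Real.log n := by
  have hn' : (2 : ℝ) ≤ n := mod_cast hn
  have hlog : Real.log ((n : ℝ) + 1) ≤ 2 * Real.log n := by
    rw [← Nat.cast_ofNat, ← Real.log_pow]
    exact Real.log_le_log (by linarith) (by nlinarith)
  have hlog' : 0 ≤ Real.log ((n : ℝ) + 1) := Real.log_nonneg (by linarith)
  have := Nat.floor_le (mul_nonneg zero_le_four hlog')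
  have := half_le_log hn
  rw [logBound]
  push_cast
  linarith

lemma time_le_mul {m P L R θ : ℝ} (hm : 1 ≤ m) (hP : 1 ≤ P) (hL : 1 ≤ L) (hR : 1 ≤ R) (hθ : 1 ≤ θ) :
    2 * m + 2 * m * m + 2 * m * P + m * m * (3 + 9 * P * L) + 3 * (120 * P * L * θ) * (m * m * R) ≤
      378 * (m * m * θ) * (P * L * R) := by
  have hmm : m ≤ m * m := le_mul_of_one_le_left (by linarith) hm
  have hPL : P ≤ P * L := le_mul_of_one_le_right (by linarith) hL
  have hmmP : m * P ≤ m * m * (P * L) := mul_le_mul hmm hPL (by linarith) (by positivity)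
  have hmmPL : m * m ≤ m * m * (P * L) := le_mul_of_one_le_right (by positivity) (hP.trans hPL)
  have hθR : m * m * (P * L) ≤ m * m * (P * L) * (θ * R) :=
    le_mul_of_one_le_right (by positivity) (one_le_mul_of_one_le_of_one_le hθ hR)
  linarith

lemma time_le {n p : ℕ} (hn : 2 ≤ n) {K θ : ℝ} (hθ : 1 ≤ θ) (hp : (p : ℝ) ≤ K * Real.log n) :
    2 * n + 2 * n * n + 2 * n * (p + 2) + n * n * (3 + 9 * (p + 2) * logBound n) +
        3 * unitCost n p θ * (n * n * (3 + Real.log n)) ≤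
      378 * 70 * (K + 4) * (n ^ 2 * θ) * Real.log n ^ 3 := by
  have hlog := half_le_log hn
  have hL : (1 : ℝ) ≤ logBound n := mod_cast one_le_logBound n
  have hP : (p : ℝ) + 2 ≤ (K + 4) * Real.log n := by linarith
  have hP' : 1 ≤ (p : ℝ) + 2 := by linarith [p.cast_nonneg (α := ℝ)]
  have hR : 3 + Real.log n ≤ 7 * Real.log n := by linarith
  have hfactors : ((p : ℝ) + 2) * logBound n * (3 + Real.log n) ≤
      (K + 4) * Real.log n * (10 * Real.log n) * (7 * Real.log n) := by
    have hKlog : 0 ≤ (K + 4) * Real.log n := by linarith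
    gcongr
    exact logBound_le hn
  refine (time_le_mul (by exact_mod_cast one_le_two.trans hn) hP' hL (by linarith) hθ).trans ?_
  calc 378 * (n * n * θ) * (((p : ℝ) + 2) * logBound n * (3 + Real.log n))
      ≤ 378 * (n * n * θ) * ((K + 4) * Real.log n * (10 * Real.log n) * (7 * Real.log n)) := by
        gcongr
    _ = 378 * 70 * (K + 4) * (n ^ 2 * θ) * Real.log n ^ 3 := by ring

end Bounds

end OnlineTopo

theorem mainTheorem10 :
    ∃ k : ℕ, ∀ K : ℝ, ∃ C : ℝ, ∀ n p : ℕ, 2 ≤ n → (p : ℝ) ≤ K * Real.log n →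
      ∀ t : ℕ → ℝ, t 0 = (n : ℝ) ^ OnlineTopo.expo p →
        (∀ i : ℕ, 1 ≤ i → i ≤ p + 1 → t i = t 0 ^ (2 - (2 / 3 : ℝ) ^ i)) →
      ∀ (T₀ : Equiv.Perm (Fin n)) (E₀ es : List (Fin n × Fin n)),
        (∀ e ∈ E₀, T₀ e.1 < T₀ e.2) →
        (E₀ ++ es).Nodup →
        (∀ x : Fin n, ¬ Relation.TransGen (fun a b => (a, b) ∈ E₀ ++ es) x x) →
        ∃ (depth : ℕ) (s : OnlineTopo.Store n),
          OnlineTopo.run p (fun i => ⌊t i⌋₊) depth T₀ E₀ es = some s ∧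
          (s.time : ℝ) ≤ C * (n : ℝ) ^ (2 + OnlineTopo.expo p) * Real.log n ^ k := by
  refine ⟨3, fun K => ⟨378 * 70 * (K + 4), ?_⟩⟩
  intro n p hn hp t h₀ ht T₀ E₀ es hT₀ hnodup hacyclic
  have hθ := OnlineTopo.thresholds_floor (one_le_two.trans hn) h₀ ht
  obtain ⟨depth, s, hs, htime⟩ := OnlineTopo.exists_run_time_le hθ hT₀ hnodup hacyclic
  refine ⟨depth, s, hs, htime.trans ((OnlineTopo.time_le hn hθ.one_le hp).trans_eq ?_)⟩
  rw [h₀, Real.rpow_add (by positivity), Real.rpow_two]
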